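/- Let $n\ge 1$, let $B$ be the open unit ball of $\mathbb C^n$ and $S=\partial B$. Write $z\bar w=\sum_k z_k\bar w_k$, $d(z,w)=|1-z\bar w|$, $d(z,E)=\inf_{\zeta\in E}d(z,\zeta)$ and $B(x,r)=\{y: d(x,y)<r\}$. **Measure and kernel.** Let $E\subset S$ be closed, let $\upsilon\in\mathbb R$ and let $\mu$ be a Borel probability measure with support $E$ for which there is a constant $C_0$ with $\mu(B(x,kR))\le C_0k^{\upsilon}\mu(B(x,R))$ for all $x\in E$ and $0<R<kR\le 1$. Let $\alpha>0$ with $2\alpha\notin\mathbb N$, let $q>\alpha+\upsilon$, and put $h_q(z)=\int_E(1-z\bar\zeta)^{-q}\,d\mu(\zeta)$ (principal branch). Assume that there is $c>0$ such that for every $z\in\overline B\setminus E$, $|h_q(z)|\ge c\,d(z,E)^{-q}\mu(B_z)$, where $B_z=B(z_0,3d(z,E))$ for a point $z_0\in E$ with $d(z,z_0)=d(z,E)$. **Jets.** For each $\zeta\in E$ fix an orthonormal basis $v_1(\zeta),\dots,v_n(\zeta)$ of $\mathbb C^n$ with $v_n(\zeta)=\zeta$ (so that $v_1(\zeta),\dots,v_{n-1}(\zeta)$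 span the complex tangent space of $S$ at $\zeta$), with the coordinates $w_i(z,\zeta)=(z-\zeta)\overline{v_i(\zeta)}$. The weight of $j\in\mathbb N^n$ is $\omega(j)=j_n+\frac12(j_1+\dots+j_{n-1})$. For a jet $f=\{f_j\}_{\omega(j)\le\alpha}$ of functions on $E$ put $T_\zeta f(z)=\sum_{\omega(j)\le\alpha}\frac1{j!}f_j(\zeta)w(z,\zeta)^j$ and $\Delta_j(y,x)=f_j(x)-D^j_xT_yf(x)$, where $D_x^j$ is the $j$-th derivative in the coordinates $w(\cdot,x)$. Let $A_\alpha(E)$ be the space of continuous jets (meaning that the polynomial $T_\zeta f$ depends continuously on $\zeta\in E$) with $$\|f\|_\alpha=\sum_{\omega(j)\le\alpha}\Big(\sup_E|f_j|+\sup_{x,y\in E}\frac{|\Delta_j(y,x)|}{d(x,y)^{\alpha-\omega(j)}}\Big)<\infty .$$ **Operators.** A vector field $X=\sum_k a_k\partial_{z_k}+\overline{a_k}\partial_{\bar z_k}$ with $a_k\in C^\infty(\overline B)$ has weight $\omega(X)=\frac12$ if $\sum_k a_k\bar z_k=0$ on $\overline B$, and $\omega(X)=1$ otherwise; an operator $\mathbb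 X=X_1\cdots X_p$ ($p\ge0$) has weight $\omega(\mathbb X)=\sum_i\omega(X_i)$. Put $$\mathcal E(f)(z)=\frac1{h_q(z)}\int_E\frac{T_\zeta f(z)}{(1-z\bar\zeta)^q}\,d\mu(\zeta),\qquad \mathcal E(\mathbb Xf)(z)=\frac1{h_q(z)}\int_E\frac{\mathbb X(T_\zeta f)(z)}{(1-z\bar\zeta)^q}\,d\mu(\zeta).$$ Then, for every $f\in A_\alpha(E)$, these integrals converge absolutely for $z\in\overline B\setminus E$, $\mathcal E(f)$ is holomorphic in a neighbourhood of each point of $\overline B\setminus E$, and: 1. If $\omega(\mathbb X)<\alpha$, there is a constant $C=C(\mathbb X)$, independent of $f$ and $z$, such that $|\mathbb X\mathcal E(f)(z)-\mathcal E(\mathbb Xf)(z)|\le C\|f\|_\alpha\,d(z,E)^{\alpha-\omega(\mathbb X)}$ for all $f\in A_\alpha(E)$ and $z\in\overline B\setminus E$. 2. If $\omega(\mathbb X)>\alpha$, there is a constant $C=C(\mathbb X)$, independent of $f$ and $z$, such that $|\mathbb X\mathcal E(f)(z)|\le C\|f\|_\alpha\,d(z,E)^{\alpha-\omega(\mathbb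 X)}$ for all $f\in A_\alpha(E)$ and $z\in\overline B\setminus E$. 3. For every $f\in A_\alpha(E)$, $\mathcal E(f)\in A_\alpha(B)=\mathrm{Hol}(B)\cap C^\alpha(\overline B)$, and $\mathcal E(f)$ extends $f$: if $\omega(\mathbb X)<\alpha$ and $\zeta_0\in E$, then $\mathbb X\mathcal E(f)(z)\to\mathbb X(T_{\zeta_0}f)(\zeta_0)$ as $z\to\zeta_0$, $z\in\overline B\setminus E$. -/

import Mathlib

open MeasureTheory Filter Topology
open scoped ContDiff ENNReal

namespace NonIso

/-- The space `ℂⁿ`, with `n = m + 1 ≥ 1`. -/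
abbrev Cn (m : ℕ) := EuclideanSpace ℂ (Fin (m + 1))

/-- The function `τ(z, w) = 1 - z w̄`, where `z w̄ = ∑ zₖ w̄ₖ`. -/
noncomputable def tau {m : ℕ} (z w : Cn m) : ℂ := 1 - inner ℂ w z

/-- The non-isotropic pseudo-metric `d(z, w) = |1 - z w̄|`. -/
noncomputable def pdist {m : ℕ} (z w : Cn m) : ℝ := ‖tau z w‖

/-- `d(z, E) = inf {d(z, ζ) : ζ ∈ E}`. -/
noncomputable def pdistSet {m : ℕ} (z : Cn m) (E : Set (Cn m)) : ℝ :=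
  sInf ((fun ζ => pdist z ζ) '' E)

/-- The ball `B(x, r)` of the pseudo-metric. -/
def pball {m : ℕ} (x : Cn m) (r : ℝ) : Set (Cn m) := {y | pdist x y < r}

/-- The class `U_υ(E)`: probability measures with support `E` such that
`μ(B(x, kR)) ≤ C k^υ μ(B(x, R))` for `x ∈ E` and `0 < R < kR ≤ 1`. -/
structure MemU {m : ℕ} (E : Set (Cn m)) (υ : ℝ) (μ : Measure (Cn m)) : Prop where
  prob : IsProbabilityMeasure μ
  supp : μ.support = E
  bound : ∃ C : ℝ, ∀ x ∈ E, ∀ R k : ℝ, 0 < R → R < k * R → k * R ≤ 1 →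
    μ.real (pball x (k * R)) ≤ C * k ^ υ * μ.real (pball x R)

/-- The kernel `(1 - z ζ̄)^(-q)`, with the principal branch: for `|z| ≤ 1 = |ζ|`, `z ≠ ζ`, the
base is non-zero and has non-negative real part. -/
noncomputable def kern {m : ℕ} (q : ℝ) (z ζ : Cn m) : ℂ := (tau z ζ) ^ (-(q : ℂ))

/-- `h_q(z) = ∫ (1 - z ζ̄)^(-q) dμ(ζ)`. -/
noncomputable def hq {m : ℕ} (μ : Measure (Cn m)) (q : ℝ) (z : Cn m) : ℂ :=
  ∫ ζ, kern q z ζ ∂μ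

/-- The bound `|h_q(z)| ≥ c d(z, E)^(-q) μ(B_z)` on the closed unit ball minus `E`, where
`B_z = B(z₀, 3 d(z, E))` for a point `z₀ ∈ E` with `d(z, z₀) = d(z, E)`. -/
def LowerBound {m : ℕ} (E : Set (Cn m)) (μ : Measure (Cn m)) (q : ℝ) : Prop :=
  ∃ c : ℝ, 0 < c ∧ ∀ z ∈ Metric.closedBall (0 : Cn m) 1 \ E,
    ∃ z₀ ∈ E, pdist z z₀ = pdistSet z E ∧
      c * pdistSet z E ^ (-q) * μ.real (pball z₀ (3 * pdistSet z E)) ≤ ‖hq μ q z‖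

/-- The weight `ω(j) = jₙ + (j₁ + ⋯ + jₙ₋₁) / 2` of a multi-index. -/
noncomputable def wt {m : ℕ} (j : Fin (m + 1) → ℕ) : ℝ :=
  j (Fin.last m) + (∑ i : Fin m, (j i.castSucc : ℝ)) / 2

open scoped Classical in
/-- The multi-indices of weight at most `α` (see `mem_indices`). -/
noncomputable def indices (m : ℕ) (α : ℝ) : Finset (Fin (m + 1) → ℕ) :=
  (Fintype.piFinset fun _ => Finset.range (⌊2 * α⌋₊ + 1)).filter fun j => wt j ≤ α

theorem mem_indices {m : ℕ} {α : ℝ} {j : Fin (m + 1) → ℕ} : j ∈ indices m α ↔ wt j ≤ α := by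
  simp only [indices, Finset.mem_filter, Fintype.mem_piFinset, Finset.mem_range,
    and_iff_right_iff_imp]
  intro h i
  refine Nat.lt_succ_of_le (Nat.le_floor ?_)
  have hs : 0 ≤ ∑ i : Fin m, (j i.castSucc : ℝ) := Finset.sum_nonneg fun _ _ => Nat.cast_nonneg _
  have hl : (0 : ℝ) ≤ j (Fin.last m) := Nat.cast_nonneg _
  unfold wt at h
  refine Fin.lastCases ?_ (fun i => ?_) i
  · linarith
  · have : (j i.castSucc : ℝ) ≤ ∑ i : Fin m, (j i.castSucc : ℝ) :=
      Finset.single_le_sum (f := fun i : Fin m => (j i.castSucc : ℝ))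
        (fun _ _ => Nat.cast_nonneg _) (Finset.mem_univ i)
    linarith

/-- A choice, at each `ζ ∈ E`, of unitary coordinates of `ℂⁿ`: an orthonormal basis whose last
vector is the normal `ζ`, so that the others span the complex tangent space at `ζ`. -/
def IsFrame {m : ℕ} (E : Set (Cn m)) (v : Cn m → Fin (m + 1) → Cn m) : Prop :=
  ∀ ζ ∈ E, Orthonormal ℂ (v ζ) ∧ v ζ (Fin.last m) = ζ

/-- The coordinates `wᵢ(z, ζ)` centred at `ζ`; the normal one is `wₙ(z, ζ) = z ζ̄ - 1`. -/
noncomputable def coord {m : ℕ} (v : Cn m → Fin (m + 1) → Cn m) (z ζ : Cn m)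
    (i : Fin (m + 1)) : ℂ :=
  inner ℂ (v ζ i) (z - ζ)

/-- A family `f_j`, indexed by multi-indices, of functions on `E`. Only the values on `E` and the
indices of weight at most `α` are ever used. -/
abbrev Jet (m : ℕ) := (Fin (m + 1) → ℕ) → Cn m → ℂ

/-- The Taylor polynomial `T_ζ f(z) = ∑_{ω(j) ≤ α} f_j(ζ) w(z, ζ)^j / j!`. -/
noncomputable def taylor {m : ℕ} (v : Cn m → Fin (m + 1) → Cn m) (α : ℝ) (f : Jet m)
    (ζ z : Cn m) : ℂ :=
  ∑ j ∈ indices m α,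
    (∏ i, ((j i).factorial : ℂ))⁻¹ * f j ζ * ∏ i, coord v z ζ i ^ j i

/-- `D^j F`, the `j`-th derivative in the coordinates given by the orthonormal basis `b`. -/
noncomputable def coordDeriv {m : ℕ} (b : Fin (m + 1) → Cn m) (j : Fin (m + 1) → ℕ)
    (F : Cn m → ℂ) : Cn m → ℂ :=
  (List.finRange (m + 1)).foldr
    (fun i G => (fun (H : Cn m → ℂ) z => fderiv ℂ H z (b i))^[j i] G) F

/-- `Δ_j(y, x) = f_j(x) - D_x^j T_y f(x)`, with `D_x^j` in the coordinates centred at `x`. -/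
noncomputable def delta {m : ℕ} (v : Cn m → Fin (m + 1) → Cn m) (α : ℝ) (f : Jet m)
    (j : Fin (m + 1) → ℕ) (y x : Cn m) : ℂ :=
  f j x - coordDeriv (v x) j (taylor v α f y) x

/-- The norm `∑_{ω(j) ≤ α} (sup_E |f_j| + sup_{x, y ∈ E} |Δ_j(y, x)| / d(x, y)^{α - ω(j)})`,
with values in `[0, ∞]`. -/
noncomputable def lipENorm {m : ℕ} (E : Set (Cn m)) (v : Cn m → Fin (m + 1) → Cn m) (α : ℝ)
    (f : Jet m) : ℝ≥0∞ :=
  ∑ j ∈ indices m α,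
    ((⨆ x ∈ E, ENNReal.ofReal ‖f j x‖) +
      ⨆ x ∈ E, ⨆ y ∈ E, ENNReal.ofReal (‖delta v α f j y x‖ / pdist x y ^ (α - wt j)))

/-- The norm `‖f‖_α` of a jet, meaningful when `lipENorm` is finite. -/
noncomputable def lipNorm {m : ℕ} (E : Set (Cn m)) (v : Cn m → Fin (m + 1) → Cn m) (α : ℝ)
    (f : Jet m) : ℝ :=
  (lipENorm E v α f).toReal

/-- `f ∈ A_α(E)`: a continuous jet of finite norm. Since in general there is no continuous choice
of bases on all of `E`, continuity is that of `ζ ↦ T_ζ f` (a polynomial); where the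
bases vary continuously, this is the continuity of the components `f_j`. -/
structure MemLip {m : ℕ} (E : Set (Cn m)) (v : Cn m → Fin (m + 1) → Cn m) (α : ℝ)
    (f : Jet m) : Prop where
  continuous : ∀ z, ContinuousOn (fun ζ => taylor v α f ζ z) E
  finite : lipENorm E v α f < ⊤

/-- For a family `P_ζ` of functions, the weighted mean
`h_q(z)⁻¹ ∫ P_ζ(z) (1 - z ζ̄)^(-q) dμ(ζ)`. -/
noncomputable def mean {m : ℕ} (μ : Measure (Cn m)) (q : ℝ) (P : Cn m → Cn m → ℂ)
    (z : Cn m) : ℂ :=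
  (hq μ q z)⁻¹ * ∫ ζ, P ζ z * kern q z ζ ∂μ

/-- The extension operator `𝓔(f)(z) = h_q(z)⁻¹ ∫ T_ζ f(z) (1 - z ζ̄)^(-q) dμ(ζ)`. -/
noncomputable def extOperator {m : ℕ} (μ : Measure (Cn m)) (q : ℝ) (v : Cn m → Fin (m + 1) → Cn m)
    (α : ℝ) (f : Jet m) : Cn m → ℂ :=
  mean μ q (taylor v α f)

/-- The vector field `∑ aⱼ ∂/∂zⱼ + āⱼ ∂/∂z̄ⱼ` acting on `F`: the real derivative of `F` in the
direction `a(z)`. -/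
noncomputable def applyField {m : ℕ} (a : Cn m → Cn m) (F : Cn m → ℂ) : Cn m → ℂ :=
  fun z => fderiv ℝ F z (a z)

/-- The operator `X₁ ⋯ X_p`, for a list of vector fields. -/
noncomputable def applyOp {m : ℕ} (X : List (Cn m → Cn m)) (F : Cn m → ℂ) : Cn m → ℂ :=
  X.foldr applyField F

open scoped Classical in
/-- The weight of a vector field: `1/2` if it is complex-tangential (`∑ aⱼ z̄ⱼ = 0` on the closed
ball), and `1` otherwise. -/
noncomputable def fieldWeight {m : ℕ} (a : Cn m → Cn m) : ℝ :=
  if ∀ z ∈ Metric.closedBall (0 : Cn m) 1, inner ℂ z (a z) = 0 then 1 / 2 else 1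

/-- `ω(X₁ ⋯ X_p) = ω(X₁) + ⋯ + ω(X_p)`. -/
noncomputable def opWeight {m : ℕ} (X : List (Cn m → Cn m)) : ℝ :=
  (X.map fieldWeight).sum

/-- All the vector fields have coefficients in `C^∞` of the closed ball, i.e. restrictions
to it of smooth functions on `ℂⁿ`. -/
def SmoothOp {m : ℕ} (X : List (Cn m → Cn m)) : Prop := ∀ a ∈ X, ContDiff ℝ ∞ a

/-- `𝓔(𝕏f)(z) = h_q(z)⁻¹ ∫ 𝕏(T_ζ f)(z) (1 - z ζ̄)^(-q) dμ(ζ)`. -/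
noncomputable def extDeriv {m : ℕ} (μ : Measure (Cn m)) (q : ℝ) (v : Cn m → Fin (m + 1) → Cn m)
    (α : ℝ) (X : List (Cn m → Cn m)) (f : Jet m) : Cn m → ℂ :=
  mean μ q fun ζ => applyOp X (taylor v α f ζ)

/-- `F ∈ A_α(B)`, for non-integer `α > 0`: `F` is holomorphic in the open unit ball, and is there of
class `C^α` up to the boundary, i.e. its derivatives of order at most `⌊α⌋` are bounded and those
of order `⌊α⌋` are Hölder continuous with exponent `α - ⌊α⌋` (so that all of them extend
continuously to the closed ball). -/
def MemHolLip {m : ℕ} (α : ℝ) (F : Cn m → ℂ) : Prop :=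
  DifferentiableOn ℂ F (Metric.ball 0 1) ∧
  ∃ C : ℝ,
    (∀ k : ℕ, k ≤ ⌊α⌋₊ → ∀ z ∈ Metric.ball (0 : Cn m) 1, ‖iteratedFDeriv ℝ k F z‖ ≤ C) ∧
    ∀ z ∈ Metric.ball (0 : Cn m) 1, ∀ w ∈ Metric.ball (0 : Cn m) 1,
      ‖iteratedFDeriv ℝ ⌊α⌋₊ F z - iteratedFDeriv ℝ ⌊α⌋₊ F w‖ ≤ C * ‖z - w‖ ^ (α - ⌊α⌋₊)

end NonIso

namespace NonIso

/-! ### The pseudo-metric on the closed ball. -/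

section Geometry

variable {m : ℕ}

/-! Near `z`, the extension is compared with one polynomial `T_ξ f`, where `ξ` is a point of `E`
nearest to `z`, kept fixed under differentiation. Since `h_q` normalises the kernel, 𝓔(f) = T_ξ f +
h_q⁻¹ ∫ (T_ζ f − T_ξ f)(1 − zζ̄)^(-q) dμ(ζ). Everything rests on the estimate O(‖f‖ δ^(α − ω(𝕏))),
with δ = d(z, E), for 𝕏 applied to the remainder (`exists_applyOp_extOperator_sub_le`).

That estimate is a count of powers. Re-expanded at `ζ`, the difference T_ζ f − T_ξ f has
coefficients controlled by the Δ_k(ξ, ζ), hence by ‖f‖ d(ζ, ξ)^(α − ω(k)) when ω(k) ≤ α. As d(ζ, ξ)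
≤ 4 d(z, ζ), the difference has size ‖f‖ d(z, ζ)^α (`isSymbol_taylor_sub`). The kernel has size d(z,
ζ)^(-q), and each field costs d(z, ζ) to the power minus its weight. A dyadic decomposition gives ∫
d(z, ζ)^(-s) dμ ≲ δ^(-s) μ(B_z) for s > υ (`MemU.lintegral_pdist_le`); it is applied with s = q − α
+ ω(𝕏), which is where q > α + υ enters. The lower bound for h_q then cancels the factor δ^(-q)
μ(B_z).

The bookkeeping of iterated derivatives is done by `IsSymbol`, a class of families closed under
sums, products, inverses, powers and integration in `ζ`. Its index runs over all jets and points at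
once, so constants independent of `f` and `z` come for free. The geometric heart is `isSymbol_tau`:
a complex-tangential field `a` applied to 1 − zζ̄ gives −a(z)·ζ̄ = −a(z)·(ζ̄ − z̄), of size d(z,
ζ)^(1/2), so that it costs only half a power.

The conclusions follow. 𝓔(𝕏f) satisfies the same comparison with 𝕏 T_ξ f (`exists_extDeriv_sub_le`),
which gives part 1. For ω(𝕏) > α the bounded term 𝕏 T_ξ f is absorbed in δ^(α − ω(𝕏)), which gives
part 2. The boundary values come from comparing T_ξ f with T_{ζ₀} f. For Hölder regularity, nonzero
constant fields have weight 1 and 1 − |z| ≤ d(z, E), so part 2 at order ⌊α⌋ + 1 feeds the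
Hardy–Littlewood lemma. -/

theorem pdist_nonneg (z w : Cn m) : 0 ≤ pdist z w := norm_nonneg _

theorem pdist_comm (z w : Cn m) : pdist z w = pdist w z := by
  unfold pdist tau
  rw [← inner_conj_symm w z, ← Complex.norm_conj]
  simp

theorem pdist_le_two {z w : Cn m} (hz : ‖z‖ ≤ 1) (hw : ‖w‖ ≤ 1) : pdist z w ≤ 2 := by
  unfold pdist tau
  calc ‖1 - inner ℂ w z‖ ≤ ‖(1 : ℂ)‖ + ‖inner ℂ w z‖ := norm_sub_le _ _
    _ ≤ 1 + 1 := by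
        gcongr
        · simp
        · exact (norm_inner_le_norm _ _).trans (mul_le_one₀ hw (norm_nonneg _) hz)
    _ = 2 := by norm_num

theorem one_sub_norm_inner_sq_le {z w : Cn m} (hz : ‖z‖ ≤ 1) (hw : ‖w‖ ≤ 1) :
    1 - ‖inner ℂ w z‖ ^ 2 ≤ 2 * pdist z w := by
  have h1 : ‖inner ℂ w z‖ ≤ 1 :=
    (norm_inner_le_norm _ _).trans (mul_le_one₀ hw (norm_nonneg _) hz)
  have h2 : 1 - ‖inner ℂ w z‖ ≤ pdist z w := by
    have := norm_sub_norm_le (1 : ℂ) (inner ℂ w z)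
    simpa [pdist, tau] using this
  nlinarith [norm_nonneg (inner ℂ w z), pdist_nonneg z w]

/-- When |x| < 1 the vector z − ⟨x, z⟩x is not an orthogonal projection. The factor 2 − |x|² records
the defect, which cancels in `pdist_triangle`. -/
theorem norm_sub_smul_sq (z x : Cn m) :
    ‖z - (inner ℂ x z : ℂ) • x‖ ^ 2 = ‖z‖ ^ 2 - (2 - ‖x‖ ^ 2) * ‖inner ℂ x z‖ ^ 2 := by
  have h := norm_sub_sq (𝕜 := ℂ) z ((inner ℂ x z : ℂ) • x)
  rw [h, inner_smul_right, norm_smul, ← inner_conj_symm z x, Complex.mul_conj,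
    Complex.normSq_eq_norm_sq]
  rw [RCLike.re_eq_complex_re, Complex.ofReal_re]
  ring

/-- The quasi-triangle inequality, on the closed ball. -/
theorem pdist_triangle {z x w : Cn m} (hz : ‖z‖ ≤ 1) (hx : ‖x‖ ≤ 1) (hw : ‖w‖ ≤ 1) :
    pdist z w ≤ 2 * (pdist z x + pdist x w) := by
  set a : ℂ := inner ℂ x z with ha
  set b : ℂ := inner ℂ w x with hb
  -- The middle point may lie inside the ball, hence the correction (1 − |x|²)ab. After
  -- Cauchy–Schwarz and the arithmetic-geometric inequality the terms in |x|² cancel, leaving ½(1 −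
  -- |a|²) + ½(1 − |b|²).
  have hab : (inner ℂ w z : ℂ) - a * b =
      inner ℂ (w - (inner ℂ x w : ℂ) • x) (z - a • x) + ((1 - ‖x‖ ^ 2 : ℝ) : ℂ) * (a * b) := by
    simp only [inner_sub_left, inner_sub_right, inner_smul_left, inner_smul_right,
      inner_conj_symm, inner_self_eq_norm_sq_to_K, ← ha, ← hb]
    push_cast
    simp only [Complex.coe_algebraMap]
    ring
  have h1 : ‖(inner ℂ w z : ℂ) - a * b‖ ≤ pdist z x + pdist x w := by
    rw [hab]
    have hs : 0 ≤ 1 - ‖x‖ ^ 2 := by nlinarith [norm_nonneg x]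
    refine (norm_add_le _ _).trans ?_
    rw [norm_mul, norm_mul, Complex.norm_real, Real.norm_of_nonneg hs]
    have h2 := norm_inner_le_norm (𝕜 := ℂ) (w - (inner ℂ x w : ℂ) • x) (z - a • x)
    have hA := norm_sub_smul_sq z x
    have hB := norm_sub_smul_sq w x
    have hbn : ‖(inner ℂ x w : ℂ)‖ = ‖b‖ := norm_inner_symm _ _
    have h3 := one_sub_norm_inner_sq_le hz hx
    have h4 := one_sub_norm_inner_sq_le hx hw
    rw [← ha] at hA h3
    rw [hbn] at hB
    rw [← hb] at h4
    have h5 : ‖z‖ ^ 2 ≤ 1 := by nlinarith [norm_nonneg z]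
    have h6 : ‖w‖ ^ 2 ≤ 1 := by nlinarith [norm_nonneg w]
    have h7 : (1 - ‖x‖ ^ 2) * (‖a‖ * ‖b‖) ≤ (1 - ‖x‖ ^ 2) * ((‖a‖ ^ 2 + ‖b‖ ^ 2) / 2) := by
      apply mul_le_mul_of_nonneg_left _ hs
      nlinarith [sq_nonneg (‖a‖ - ‖b‖)]
    nlinarith [sq_nonneg (‖w - (inner ℂ x w : ℂ) • x‖ - ‖z - a • x‖)]
  have h8 : ‖1 - a * b‖ ≤ pdist z x + pdist x w := by
    have : 1 - a * b = (1 - a) + a * (1 - b) := by ring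
    rw [this]
    refine (norm_add_le _ _).trans ?_
    have ha1 : ‖a‖ ≤ 1 := (norm_inner_le_norm _ _).trans (mul_le_one₀ hx (norm_nonneg _) hz)
    rw [norm_mul]
    have := mul_le_of_le_one_left (norm_nonneg (1 - b)) ha1
    simp only [pdist, tau, ← ha, ← hb]
    linarith
  have h9 : pdist z w ≤ ‖1 - a * b‖ + ‖(inner ℂ w z : ℂ) - a * b‖ := by
    have : tau z w = (1 - a * b) - (inner ℂ w z - a * b) := by simp [tau]
    rw [pdist, this]
    exact norm_sub_le _ _
  linarith

/-- Expand |z − ζ|² = |z|² + 1 − 2 Re(zζ̄) and use |z| ≤ 1. This keeps the base of the kernel in the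
right half-plane and gives |z − ζ| ≲ d(z, ζ)^(1/2). -/
theorem re_tau_ge {z ζ : Cn m} (hz : ‖z‖ ≤ 1) (hζ : ‖ζ‖ = 1) :
    ‖z - ζ‖ ^ 2 ≤ 2 * (tau z ζ).re := by
  have h := norm_sub_sq (𝕜 := ℂ) z ζ
  have h2 : (inner ℂ ζ z : ℂ).re = RCLike.re (inner ℂ z ζ : ℂ) := by
    rw [← inner_conj_symm, Complex.conj_re, RCLike.re_eq_complex_re]
  rw [h, hζ, ← h2]
  simp only [tau, Complex.sub_re, Complex.one_re]
  nlinarith [norm_nonneg z]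

theorem norm_sub_sq_le_pdist {z ζ : Cn m} (hz : ‖z‖ ≤ 1) (hζ : ‖ζ‖ = 1) :
    ‖z - ζ‖ ^ 2 ≤ 2 * pdist z ζ :=
  (re_tau_ge hz hζ).trans (by
    have := Complex.re_le_norm (tau z ζ)
    unfold pdist
    linarith)

theorem norm_sub_le_pdist {z ζ : Cn m} (hz : ‖z‖ ≤ 1) (hζ : ‖ζ‖ = 1) :
    ‖z - ζ‖ ≤ 2 * pdist z ζ ^ (1 / 2 : ℝ) := by
  have h := norm_sub_sq_le_pdist hz hζ
  rw [← Real.sqrt_eq_rpow]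
  have h1 : ‖z - ζ‖ ≤ Real.sqrt (2 * pdist z ζ) := Real.le_sqrt_of_sq_le h
  refine h1.trans ?_
  rw [Real.sqrt_mul (by norm_num)]
  gcongr
  rw [Real.sqrt_le_left (by norm_num)]
  norm_num

theorem norm_tau_sub_le {z z' ζ : Cn m} (hζ : ‖ζ‖ = 1) : ‖tau z ζ - tau z' ζ‖ ≤ ‖z - z'‖ := by
  have : tau z ζ - tau z' ζ = inner ℂ ζ (z' - z) := by
    rw [inner_sub_right]; simp [tau]
  rw [this, norm_sub_rev z z']
  have h := norm_inner_le_norm (𝕜 := ℂ) ζ (z' - z)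
  rwa [hζ, one_mul] at h

/-- The points at which all the kernels `τ(·, ζ)`, `ζ ∈ E`, have positive real part. -/
def posSet (E : Set (Cn m)) : Set (Cn m) := {z | ∀ ζ ∈ E, 0 < (tau z ζ).re}

variable {E : Set (Cn m)}

theorem norm_eq_one (hES : E ⊆ Metric.sphere 0 1) {ζ : Cn m} (h : ζ ∈ E) : ‖ζ‖ = 1 := by
  simpa using hES h

theorem norm_le_one {z : Cn m} (h : z ∈ Metric.closedBall (0 : Cn m) 1 \ E) : ‖z‖ ≤ 1 := by
  simpa using h.1

theorem subset_posSet (hES : E ⊆ Metric.sphere 0 1) :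
    Metric.closedBall (0 : Cn m) 1 \ E ⊆ posSet E := by
  intro z hz ζ hζ
  have h := re_tau_ge (norm_le_one hz) (norm_eq_one hES hζ)
  have : 0 < ‖z - ζ‖ := by
    rw [norm_pos_iff, sub_ne_zero]
    rintro rfl
    exact hz.2 hζ
  nlinarith

theorem pdist_pos {z ζ : Cn m} (hz : z ∈ posSet E) (hζ : ζ ∈ E) : 0 < pdist z ζ := by
  have := hz ζ hζ
  rw [pdist, norm_pos_iff]
  intro h
  simp [h] at this

theorem continuous_tau : Continuous fun p : Cn m × Cn m => tau p.1 p.2 := by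
  unfold tau
  fun_prop

/-- The minimum over the compact `E` is positive, and moving `z` by less than half of it changes
each value by at most that half. This makes `posSet E` open and provides the domination for
differentiating under the integral. -/
theorem exists_re_tau_ge (hE : IsCompact E) (hES : E ⊆ Metric.sphere 0 1)
    {z : Cn m} (hz : z ∈ posSet E) :
    ∃ ε > 0, ∀ z' ∈ Metric.ball z ε, ∀ ζ ∈ E, ε ≤ (tau z' ζ).re := by
  have hc : ContinuousOn (fun ζ => (tau z ζ).re) E := by
    have := (continuous_tau (m := m)).comp (Continuous.prodMk_right z)
    exact (Complex.continuous_re.comp this).continuousOn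
  obtain ⟨ε, hε, h⟩ : ∃ ε > 0, ∀ ζ ∈ E, ε ≤ (tau z ζ).re := by
    rcases E.eq_empty_or_nonempty with h0 | hne
    · exact ⟨1, one_pos, by simp [h0]⟩
    · obtain ⟨x, hx, hmin⟩ := hE.exists_isMinOn hne hc
      exact ⟨_, hz x hx, fun ζ hζ => hmin hζ⟩
  refine ⟨ε / 2, by positivity, fun z' hz' ζ hζ => ?_⟩
  have h1 := h ζ hζ
  have h2 := norm_tau_sub_le (z := z) (z' := z') (norm_eq_one hES hζ)
  have h3 := Complex.re_le_norm (tau z ζ - tau z' ζ)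
  rw [Metric.mem_ball, dist_comm, dist_eq_norm] at hz'
  simp only [Complex.sub_re] at h3
  linarith

theorem isOpen_posSet (hE : IsCompact E) (hES : E ⊆ Metric.sphere 0 1) : IsOpen (posSet E) := by
  rw [Metric.isOpen_iff]
  intro z hz
  obtain ⟨ε, hε, h⟩ := exists_re_tau_ge hE hES hz
  exact ⟨ε, hε, fun z' hz' ζ hζ => hε.trans_le (h z' hz' ζ hζ)⟩

theorem pdistSet_le {z ζ : Cn m} (hζ : ζ ∈ E) : pdistSet z E ≤ pdist z ζ :=
  csInf_le ⟨0, by rintro _ ⟨x, -, rfl⟩; exact pdist_nonneg _ _⟩ ⟨ζ, hζ, rfl⟩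

theorem one_sub_norm_le_pdist (z : Cn m) {ζ : Cn m} (hζ : ‖ζ‖ = 1) : 1 - ‖z‖ ≤ pdist z ζ := by
  have h1 := norm_inner_le_norm (𝕜 := ℂ) ζ z
  have h2 := norm_sub_norm_le (1 : ℂ) (inner ℂ ζ z)
  rw [hζ, one_mul] at h1
  simp only [norm_one] at h2
  unfold pdist tau
  linarith

theorem isOpen_pball (x : Cn m) (r : ℝ) : IsOpen (pball x r) := by
  have : Continuous fun y => pdist x y :=
    (continuous_tau.comp (Continuous.prodMk_right x)).norm
  exact isOpen_lt this continuous_const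

theorem mem_pball_self {x : Cn m} (hx : ‖x‖ = 1) {r : ℝ} (hr : 0 < r) : x ∈ pball x r := by
  simp [pball, pdist, tau, hx, hr]

end Geometry

/-! ### Growth of the measure and integrals of powers of the pseudo-distance. -/

section MeasureGrowth

variable {m : ℕ} {E : Set (Cn m)} {υ : ℝ} {μ : Measure (Cn m)}

theorem MemU.ae_mem (hμ : MemU E υ μ) : ∀ᵐ ζ ∂μ, ζ ∈ E := by
  have := Measure.support_mem_ae (μ := μ)
  rw [hμ.supp] at this
  exact this

theorem MemU.nonempty (hμ : MemU E υ μ) : E.Nonempty := by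
  have := hμ.prob
  rw [← hμ.supp]
  exact Measure.nonempty_support (IsProbabilityMeasure.ne_zero μ)

/-- The inclusion is only tested on `E` because the quasi-triangle inequality is available in the
closed ball and not on all of ℂⁿ. -/
theorem MemU.real_mono (hμ : MemU E υ μ) {A B : Set (Cn m)} (h : ∀ ζ ∈ E, ζ ∈ A → ζ ∈ B) :
    μ.real A ≤ μ.real B := by
  have := hμ.prob
  refine ENNReal.toReal_mono (measure_ne_top _ _) (measure_mono_ae ?_)
  filter_upwards [hμ.ae_mem] with ζ hζ hA using h ζ hζ hA

theorem MemU.pball_pos (hμ : MemU E υ μ) (hES : E ⊆ Metric.sphere 0 1) {x : Cn m} (hx : x ∈ E)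
    {r : ℝ} (hr : 0 < r) : 0 < μ.real (pball x r) := by
  have := hμ.prob
  have h1 : x ∈ μ.support := hμ.supp ▸ hx
  rw [Measure.mem_support_iff_forall] at h1
  have h2 := h1 _ ((isOpen_pball x r).mem_nhds (mem_pball_self (norm_eq_one hES hx) hr))
  exact ENNReal.toReal_pos h2.ne' (measure_ne_top _ _)

/-- Take R = 1/k. Then μ(B(x, 1)) ≤ C k^υ μ(B(x, 1/k)) ≤ C k^υ μ(B(x, 1)), and a negative exponent
would make the factor smaller than 1 for large k. -/
theorem MemU.exponent_nonneg (hμ : MemU E υ μ) (hES : E ⊆ Metric.sphere 0 1) : 0 ≤ υ := by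
  by_contra! hneg
  obtain ⟨C, hC⟩ := hμ.bound
  obtain ⟨x, hx⟩ := hμ.nonempty
  have hlim : Tendsto (fun k : ℝ => C * k ^ υ) atTop (𝓝 (C * 0)) := by
    have := tendsto_rpow_neg_atTop (neg_pos.mpr hneg)
    simp only [neg_neg] at this
    exact this.const_mul C
  rw [mul_zero] at hlim
  obtain ⟨k, hk, hk1⟩ := ((hlim.eventually (gt_mem_nhds one_pos)).and
    (eventually_gt_atTop 1)).exists
  have hk0 : 0 < k := one_pos.trans hk1
  have h1 := hC x hx k⁻¹ k (by positivity)
    (by rw [mul_inv_cancel₀ hk0.ne']; exact inv_lt_one_of_one_lt₀ hk1)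
    (by rw [mul_inv_cancel₀ hk0.ne'])
  rw [mul_inv_cancel₀ hk0.ne'] at h1
  have h2 : μ.real (pball x k⁻¹) ≤ μ.real (pball x 1) := hμ.real_mono fun ζ _ h =>
    lt_trans (show pdist x ζ < k⁻¹ from h) (inv_lt_one_of_one_lt₀ hk1)
  have h3 := hμ.pball_pos hES hx (r := k⁻¹) (by positivity)
  nlinarith

/-- Finitely many balls of radius 1/4 cover `E`. If `x` lies in one of them, the points of `E` in
that ball are in B(x, 1), because 2(1/4 + 1/4) = 1. -/
theorem MemU.exists_le_pball_one (hμ : MemU E υ μ) (hE : IsCompact E)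
    (hES : E ⊆ Metric.sphere 0 1) : ∃ η > 0, ∀ x ∈ E, η ≤ μ.real (pball x 1) := by
  obtain ⟨t, htE, ht⟩ := hE.elim_nhds_subcover (fun x => pball x (1 / 4)) fun x hx =>
    (isOpen_pball x _).mem_nhds (mem_pball_self (norm_eq_one hES hx) (by norm_num))
  obtain ⟨x₀, hx₀⟩ := hμ.nonempty
  have htne : t.Nonempty := by
    have := ht hx₀
    simp only [Set.mem_iUnion] at this
    obtain ⟨i, hi, -⟩ := this
    exact ⟨i, hi⟩
  obtain ⟨y, hy, hmin⟩ := t.exists_min_image (fun x => μ.real (pball x (1 / 4))) htne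
  refine ⟨_, hμ.pball_pos hES (htE y hy) (r := 1 / 4) (by norm_num), fun x hx => ?_⟩
  have := ht hx
  simp only [Set.mem_iUnion] at this
  obtain ⟨i, hi, hxi⟩ := this
  refine (hmin i hi).trans (hμ.real_mono fun ζ hζ h => ?_)
  have h1 := pdist_triangle (norm_eq_one hES hx).le (norm_eq_one hES (htE i hi)).le
    (norm_eq_one hES hζ).le
  rw [pdist_comm x i] at h1
  simp only [pball, Set.mem_ofPred_eq] at h hxi ⊢
  linarith

/-- The growth condition holds at all scales. -/
theorem MemU.doubling (hμ : MemU E υ μ) (hE : IsCompact E) (hES : E ⊆ Metric.sphere 0 1) :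
    ∃ C : ℝ, 0 < C ∧ ∀ x ∈ E, ∀ R k : ℝ, 0 < R → 1 ≤ k →
      μ.real (pball x (k * R)) ≤ C * k ^ υ * μ.real (pball x R) := by
  have := hμ.prob
  obtain ⟨C₀, hC₀⟩ := hμ.bound
  obtain ⟨η, hη, hball⟩ := hμ.exists_le_pball_one hE hES
  have hυ := hμ.exponent_nonneg hES
  have hC : ∀ x ∈ E, ∀ R k : ℝ, 0 < R → R < k * R → k * R ≤ 1 → 0 ≤ k →
      μ.real (pball x (k * R)) ≤ |C₀| * k ^ υ * μ.real (pball x R) := by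
    intro x hx R k h1 h2 h3 h4
    refine (hC₀ x hx R k h1 h2 h3).trans ?_
    gcongr
    exact le_abs_self _
  -- The product dominates the constant of each case: 1 for k = 1, |C₀| for kR ≤ 1, and |C₀|η⁻¹ or
  -- η⁻¹ for kR > 1. In the last regime the measure is at most 1 ≤ η⁻¹ μ(B(x, 1)), and the unit ball
  -- is compared with B(x, R) by the growth condition with factor 1/R ≤ k if R < 1, by inclusion
  -- otherwise.
  refine ⟨(1 + |C₀|) * (1 + η⁻¹), by positivity, fun x hx R k hR hk => ?_⟩
  have hM : 0 ≤ μ.real (pball x R) := measureReal_nonneg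
  have hkυ : 1 ≤ k ^ υ := Real.one_le_rpow hk hυ
  have hη' : 0 < η⁻¹ := by positivity
  have hprob : μ.real (pball x (k * R)) ≤ 1 := measureReal_le_one
  have hone : 1 ≤ η⁻¹ * μ.real (pball x 1) := by
    rw [inv_mul_eq_div, le_div_iff₀ hη, one_mul]
    exact hball x hx
  have h0 : 0 ≤ |C₀| := abs_nonneg _
  rcases le_or_gt (k * R) 1 with h1 | h1
  · rcases hk.eq_or_lt with rfl | hk1
    · rw [one_mul, Real.one_rpow, mul_one]
      exact le_mul_of_one_le_left hM (by nlinarith)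
    · refine (hC x hx R k hR (by nlinarith) h1 (by linarith)).trans ?_
      gcongr
      nlinarith
  · refine hprob.trans (hone.trans ?_)
    rcases lt_or_ge R 1 with hR1 | hR1
    · have h2 := hC x hx R R⁻¹ hR (by rwa [inv_mul_cancel₀ hR.ne'])
        (by rw [inv_mul_cancel₀ hR.ne']) (by positivity)
      rw [inv_mul_cancel₀ hR.ne'] at h2
      have h3 : R⁻¹ ^ υ ≤ k ^ υ := by
        gcongr
        rw [inv_le_iff_one_le_mul₀ hR]
        exact h1.le
      calc η⁻¹ * μ.real (pball x 1) ≤ η⁻¹ * (|C₀| * R⁻¹ ^ υ * μ.real (pball x R)) := by gcongr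
        _ ≤ η⁻¹ * (|C₀| * k ^ υ * μ.real (pball x R)) := by gcongr
        _ = (|C₀| * η⁻¹) * k ^ υ * μ.real (pball x R) := by ring
        _ ≤ _ := by gcongr <;> linarith
    · have h2 : μ.real (pball x 1) ≤ μ.real (pball x R) := hμ.real_mono fun ζ _ h =>
        lt_of_lt_of_le (show pdist x ζ < 1 from h) hR1
      calc η⁻¹ * μ.real (pball x 1) ≤ η⁻¹ * 1 * μ.real (pball x R) := by rw [mul_one]; gcongr
        _ ≤ _ := by
          gcongr
          nlinarith

/-- Integrals of negative powers of the pseudo-distance, by dyadic decomposition. -/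
theorem MemU.lintegral_pdist_le (hμ : MemU E υ μ) (hE : IsCompact E)
    (hES : E ⊆ Metric.sphere 0 1) {p : ℝ} (hp : υ < p) :
    ∃ C : ℝ, 0 ≤ C ∧ ∀ z : Cn m, ‖z‖ ≤ 1 → ∀ δ > 0, ∀ ξ ∈ E, pdist z ξ ≤ δ →
      (∀ ζ ∈ E, δ ≤ pdist z ζ) →
      ∫⁻ ζ, ENNReal.ofReal (pdist z ζ ^ (-p)) ∂μ ≤
        ENNReal.ofReal (C * δ ^ (-p) * μ.real (pball ξ (3 * δ))) := by
  have := hμ.prob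
  obtain ⟨C₀, hC₀, hdbl⟩ := hμ.doubling hE hES
  have hυ := hμ.exponent_nonneg hES
  have hp0 : 0 ≤ p := hυ.trans hp.le
  -- On the k-th dyadic shell the integrand contributes 2^(-kp) and the growth of the measure
  -- 2^(kυ), so this is the ratio of the geometric series.
  set r : ℝ := 2 ^ (υ - p) with hr
  have hr0 : 0 < r := by positivity
  have hr1 : r < 1 := Real.rpow_lt_one_of_one_lt_of_neg (by norm_num) (by linarith)
  have hsum := summable_geometric_of_lt_one hr0.le hr1
  refine ⟨C₀ * 2 ^ υ * ∑' k : ℕ, r ^ k,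
    mul_nonneg (by positivity) (tsum_nonneg fun k => by positivity),
    fun z hz δ hδ ξ hξ hzξ hmin => ?_⟩
  set M := μ.real (pball ξ (3 * δ)) with hM
  have hM0 : 0 ≤ M := measureReal_nonneg
  -- If 2^k δ ≤ d(z, ζ) < 2^(k+1) δ, then d(ξ, ζ) ≤ 2(δ + d(z, ζ)) < 2^(k+1)·3δ, which is the source
  -- of the radius 3δ.
  have hpt : ∀ᵐ ζ ∂μ, ENNReal.ofReal (pdist z ζ ^ (-p)) ≤
      ∑' k : ℕ, (pball ξ (2 ^ (k + 1) * (3 * δ))).indicator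
        (fun _ => ENNReal.ofReal ((2 ^ k * δ) ^ (-p))) ζ := by
    filter_upwards [hμ.ae_mem] with ζ hζ
    obtain ⟨k, hk1, hk2⟩ := exists_nat_pow_near (x := pdist z ζ / δ) (y := 2)
      ((one_le_div hδ).mpr (hmin ζ hζ)) (by norm_num)
    rw [le_div_iff₀ hδ] at hk1
    rw [div_lt_iff₀ hδ] at hk2
    refine le_trans ?_ (ENNReal.le_tsum k)
    rw [Set.indicator_of_mem]
    · apply ENNReal.ofReal_le_ofReal
      exact Real.rpow_le_rpow_of_nonpos (by positivity) hk1 (by linarith)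
    · have h1 := pdist_triangle (norm_eq_one hES hξ).le hz (norm_eq_one hES hζ).le
      rw [pdist_comm ξ z] at h1
      have h2 : (1 : ℝ) ≤ 2 ^ k := one_le_pow₀ (by norm_num)
      have h3 : δ ≤ 2 ^ k * δ := le_mul_of_one_le_left hδ.le h2
      simp only [pball, Set.mem_ofPred_eq, pow_succ] at hk2 ⊢
      linarith
  refine (lintegral_mono_ae hpt).trans ?_
  rw [lintegral_tsum fun k => (measurable_const.indicator
    (isOpen_pball _ _).measurableSet).aemeasurable]
  have hterm : ∀ k : ℕ, ∫⁻ ζ, (pball ξ (2 ^ (k + 1) * (3 * δ))).indicator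
        (fun _ => ENNReal.ofReal ((2 ^ k * δ) ^ (-p))) ζ ∂μ ≤
      ENNReal.ofReal (C₀ * 2 ^ υ * δ ^ (-p) * M * r ^ k) := by
    intro k
    rw [lintegral_indicator_const (isOpen_pball _ _).measurableSet,
      ← ENNReal.ofReal_toReal (measure_ne_top μ (pball ξ (2 ^ (k + 1) * (3 * δ)))),
      ← ENNReal.ofReal_mul (by positivity)]
    apply ENNReal.ofReal_le_ofReal
    have h1 := hdbl ξ hξ (3 * δ) (2 ^ (k + 1)) (by positivity) (one_le_pow₀ (by norm_num))
    have h2 : (2 ^ k * δ) ^ (-p) * (C₀ * ((2 : ℝ) ^ (k + 1)) ^ υ * M) =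
        C₀ * 2 ^ υ * δ ^ (-p) * M * r ^ k := by
      rw [Real.mul_rpow (by positivity) hδ.le, pow_succ, Real.mul_rpow (by positivity)
        (by norm_num), hr, ← Real.rpow_natCast, ← Real.rpow_natCast, ← Real.rpow_mul (by norm_num),
        ← Real.rpow_mul (by norm_num), ← Real.rpow_mul (by norm_num)]
      have h3 : (2 : ℝ) ^ ((υ - p) * k) = 2 ^ ((k : ℝ) * -p) * 2 ^ ((k : ℝ) * υ) := by
        rw [← Real.rpow_add (by norm_num)]
        congr 1
        ring
      rw [h3]
      ring
    rw [← h2]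
    exact mul_le_mul_of_nonneg_left h1 (by positivity)
  refine (ENNReal.tsum_le_tsum hterm).trans ?_
  rw [← ENNReal.ofReal_tsum_of_nonneg (fun k => by positivity) (hsum.mul_left _), tsum_mul_left]
  apply ENNReal.ofReal_le_ofReal
  apply le_of_eq
  ring

/-- The bound passes through the lower integral of the norm, so `G` needs no measurability. -/
theorem MemU.norm_integral_le (hμ : MemU E υ μ) (hE : IsCompact E)
    (hES : E ⊆ Metric.sphere 0 1) {p : ℝ} (hp : υ < p) :
    ∃ C : ℝ, 0 ≤ C ∧ ∀ z : Cn m, ‖z‖ ≤ 1 → ∀ δ > 0, ∀ ξ ∈ E, pdist z ξ ≤ δ →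
      (∀ ζ ∈ E, δ ≤ pdist z ζ) → ∀ (A : ℝ) (G : Cn m → ℂ), 0 ≤ A →
      (∀ ζ ∈ E, ‖G ζ‖ ≤ A * pdist z ζ ^ (-p)) →
      ‖∫ ζ, G ζ ∂μ‖ ≤ C * (A * δ ^ (-p) * μ.real (pball ξ (3 * δ))) := by
  obtain ⟨C, hC, h⟩ := hμ.lintegral_pdist_le hE hES hp
  refine ⟨C, hC, fun z hz δ hδ ξ hξ hzξ hmin A G hA hG => ?_⟩
  have hM0 : 0 ≤ μ.real (pball ξ (3 * δ)) := measureReal_nonneg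
  have h1 : ‖∫ ζ, G ζ ∂μ‖ₑ ≤
      ENNReal.ofReal (C * (A * δ ^ (-p) * μ.real (pball ξ (3 * δ)))) := by
    refine (enorm_integral_le_lintegral_enorm _).trans ?_
    calc ∫⁻ ζ, ‖G ζ‖ₑ ∂μ ≤ ∫⁻ ζ, ENNReal.ofReal A * ENNReal.ofReal (pdist z ζ ^ (-p)) ∂μ := by
          apply lintegral_mono_ae
          filter_upwards [hμ.ae_mem] with ζ hζ
          rw [← ENNReal.ofReal_mul hA, ← ofReal_norm]
          exact ENNReal.ofReal_le_ofReal (hG ζ hζ)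
      _ = ENNReal.ofReal A * ∫⁻ ζ, ENNReal.ofReal (pdist z ζ ^ (-p)) ∂μ :=
          lintegral_const_mul' _ _ ENNReal.ofReal_ne_top
      _ ≤ ENNReal.ofReal A * ENNReal.ofReal (C * δ ^ (-p) * μ.real (pball ξ (3 * δ))) := by
          gcongr
          exact h z hz δ hδ ξ hξ hzξ hmin
      _ = _ := by
          rw [← ENNReal.ofReal_mul hA]
          congr 1
          ring
  rw [← ofReal_norm] at h1
  exact (ENNReal.ofReal_le_ofReal_iff (by positivity)).mp h1

end MeasureGrowth

/-! ### Algebra of vector fields acting on smooth functions. -/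

section Operators

variable {m : ℕ} {V : Set (Cn m)}

/-- The last field of the list acts first. Inductions that replace the function by its derivative
peel the list from this end. -/
theorem applyOp_append_singleton (X : List (Cn m → Cn m)) (a : Cn m → Cn m) (F : Cn m → ℂ) :
    applyOp (X ++ [a]) F = applyOp X (applyField a F) := by
  simp [applyOp]

theorem applyOp_cons (a : Cn m → Cn m) (X : List (Cn m → Cn m)) (F : Cn m → ℂ) :
    applyOp (a :: X) F = applyField a (applyOp X F) := rfl

theorem opWeight_append_singleton (X : List (Cn m → Cn m)) (a : Cn m → Cn m) :
    opWeight (X ++ [a]) = fieldWeight a + opWeight X := by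
  simp [opWeight, add_comm]

theorem fieldWeight_eq (a : Cn m → Cn m) : fieldWeight a = 1 / 2 ∨ fieldWeight a = 1 := by
  unfold fieldWeight
  split_ifs <;> simp

theorem fieldWeight_ge (a : Cn m → Cn m) : 1 / 2 ≤ fieldWeight a := by
  rcases fieldWeight_eq a with h | h <;> rw [h]
  norm_num

theorem opWeight_nonneg (X : List (Cn m → Cn m)) : 0 ≤ opWeight X := by
  apply List.sum_nonneg
  intro x hx
  simp only [List.mem_map] at hx
  obtain ⟨a, -, rfl⟩ := hx
  linarith [fieldWeight_ge a]

theorem contDiffOn_applyField (hV : IsOpen V) {a : Cn m → Cn m} (ha : ContDiff ℝ ∞ a)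
    {F : Cn m → ℂ} (hF : ContDiffOn ℝ ∞ F V) : ContDiffOn ℝ ∞ (applyField a F) V :=
  (hF.fderiv_of_isOpen hV (by simp)).clm_apply ha.contDiffOn

theorem contDiffOn_applyOp (hV : IsOpen V) {X : List (Cn m → Cn m)} (hX : SmoothOp X)
    {F : Cn m → ℂ} (hF : ContDiffOn ℝ ∞ F V) : ContDiffOn ℝ ∞ (applyOp X F) V := by
  induction X with
  | nil => exact hF
  | cons a X ih =>
    exact contDiffOn_applyField hV (hX a (by simp)) (ih fun b hb => hX b (by simp [hb]))

theorem applyField_congr (hV : IsOpen V) (a : Cn m → Cn m) {F G : Cn m → ℂ}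
    (h : Set.EqOn F G V) : Set.EqOn (applyField a F) (applyField a G) V := by
  intro z hz
  have : F =ᶠ[𝓝 z] G := Filter.eventuallyEq_of_mem (hV.mem_nhds hz) h
  simp only [applyField, this.fderiv_eq]

theorem applyOp_congr (hV : IsOpen V) (X : List (Cn m → Cn m)) {F G : Cn m → ℂ}
    (h : Set.EqOn F G V) : Set.EqOn (applyOp X F) (applyOp X G) V := by
  induction X with
  | nil => exact h
  | cons a X ih => exact applyField_congr hV a ih

theorem differentiableAt_of_contDiffOn (hV : IsOpen V) {F : Cn m → ℂ} (hF : ContDiffOn ℝ ∞ F V)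
    {z : Cn m} (hz : z ∈ V) : DifferentiableAt ℝ F z :=
  (hF.differentiableOn (by simp)).differentiableAt (hV.mem_nhds hz)

theorem applyField_add (hV : IsOpen V) (a : Cn m → Cn m) {F G : Cn m → ℂ}
    (hF : ContDiffOn ℝ ∞ F V) (hG : ContDiffOn ℝ ∞ G V) :
    Set.EqOn (applyField a fun z => F z + G z) (fun z => applyField a F z + applyField a G z) V := by
  intro z hz
  simp only [applyField]
  rw [fderiv_fun_add (differentiableAt_of_contDiffOn hV hF hz)
    (differentiableAt_of_contDiffOn hV hG hz)]
  rfl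

theorem applyOp_add (hV : IsOpen V) {X : List (Cn m → Cn m)} (hX : SmoothOp X) {F G : Cn m → ℂ}
    (hF : ContDiffOn ℝ ∞ F V) (hG : ContDiffOn ℝ ∞ G V) :
    Set.EqOn (applyOp X fun z => F z + G z) (fun z => applyOp X F z + applyOp X G z) V := by
  induction X with
  | nil => exact fun _ _ => rfl
  | cons a X ih =>
    have hX' : SmoothOp X := fun b hb => hX b (by simp [hb])
    exact (applyField_congr hV a (ih hX')).trans
      (applyField_add hV a (contDiffOn_applyOp hV hX' hF) (contDiffOn_applyOp hV hX' hG))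

theorem applyField_const_mul (a : Cn m → Cn m) (c : ℂ) (F : Cn m → ℂ) :
    (applyField a fun z => c * F z) = fun z => c * applyField a F z := by
  funext z
  have h := congrFun (fderiv_const_smul_field (𝕜 := ℝ) (f := F) c) z
  simp only [applyField]
  have h2 : (fun z => c * F z) = c • F := rfl
  rw [h2, h]
  rfl

theorem applyOp_const_mul (X : List (Cn m → Cn m)) (c : ℂ) (F : Cn m → ℂ) :
    (applyOp X fun z => c * F z) = fun z => c * applyOp X F z := by
  induction X with
  | nil => rfl
  | cons a X ih => rw [applyOp_cons, ih, applyField_const_mul, applyOp_cons]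

theorem applyOp_sub (hV : IsOpen V) {X : List (Cn m → Cn m)} (hX : SmoothOp X) {F G : Cn m → ℂ}
    (hF : ContDiffOn ℝ ∞ F V) (hG : ContDiffOn ℝ ∞ G V) :
    Set.EqOn (applyOp X fun z => F z - G z) (fun z => applyOp X F z - applyOp X G z) V := by
  have h1 : (fun z => F z - G z) = fun z => F z + (-1) * G z := by funext z; ring
  intro z hz
  rw [h1, applyOp_add hV hX hF (contDiffOn_const.mul hG) hz, applyOp_const_mul]
  ring

theorem applyOp_zero (X : List (Cn m → Cn m)) : (applyOp X fun _ => 0) = fun _ => 0 := by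
  have := applyOp_const_mul X 0 fun _ => 0
  simpa using this

theorem applyOp_sum (hV : IsOpen V) {X : List (Cn m → Cn m)} (hX : SmoothOp X) {κ : Type*}
    (s : Finset κ) {F : κ → Cn m → ℂ} (hF : ∀ k ∈ s, ContDiffOn ℝ ∞ (F k) V) :
    Set.EqOn (applyOp X fun z => ∑ k ∈ s, F k z) (fun z => ∑ k ∈ s, applyOp X (F k) z) V := by
  classical
  induction s using Finset.induction_on with
  | empty => intro z _; simp [applyOp_zero]
  | insert k s hk ih =>
    intro z hz
    have h1 := ih fun l hl => hF l (by simp [hl])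
    simp only [Finset.sum_insert hk]
    rw [applyOp_add hV hX (hF k (by simp))
      (ContDiffOn.sum fun l hl => hF l (by simp [hl])) hz]
    simp only [h1 hz]

theorem applyField_mul (hV : IsOpen V) (a : Cn m → Cn m) {F G : Cn m → ℂ}
    (hF : ContDiffOn ℝ ∞ F V) (hG : ContDiffOn ℝ ∞ G V) :
    Set.EqOn (applyField a fun z => F z * G z)
      (fun z => applyField a F z * G z + F z * applyField a G z) V := by
  intro z hz
  simp only [applyField]
  rw [fderiv_fun_mul (differentiableAt_of_contDiffOn hV hF hz)
    (differentiableAt_of_contDiffOn hV hG hz)]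
  simp only [add_apply, smul_apply, smul_eq_mul]
  ring

theorem applyField_inv (hV : IsOpen V) (a : Cn m → Cn m) {F : Cn m → ℂ}
    (hF : ContDiffOn ℝ ∞ F V) (h0 : ∀ z ∈ V, F z ≠ 0) :
    Set.EqOn (applyField a fun z => (F z)⁻¹)
      (fun z => (-1) * ((F z)⁻¹ * (F z)⁻¹ * applyField a F z)) V := by
  intro z hz
  have h1 : HasFDerivAt (fun z => (F z)⁻¹) _ z :=
    ((hasDerivAt_inv (h0 z hz)).hasFDerivAt.restrictScalars ℝ).comp z
      (differentiableAt_of_contDiffOn hV hF hz).hasFDerivAt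
  simp only [applyField, h1.fderiv]
  simp
  ring

theorem applyField_cpow (hV : IsOpen V) (a : Cn m → Cn m) (s : ℂ) {F : Cn m → ℂ}
    (hF : ContDiffOn ℝ ∞ F V) (h0 : ∀ z ∈ V, F z ∈ Complex.slitPlane) :
    Set.EqOn (applyField a fun z => F z ^ s)
      (fun z => s * (F z ^ s * (F z)⁻¹ * applyField a F z)) V := by
  intro z hz
  have hne := Complex.slitPlane_ne_zero (h0 z hz)
  have h1 : HasFDerivAt (fun z => F z ^ s) _ z :=
    ((hasStrictDerivAt_id _).cpow_const (c := s) (h0 z hz)).hasDerivAt.hasFDerivAt.restrictScalars ℝ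
      |>.comp z (differentiableAt_of_contDiffOn hV hF hz).hasFDerivAt
  simp only [applyField, h1.fderiv]
  simp only [id, ContinuousLinearMap.comp_apply, ContinuousLinearMap.coe_restrictScalars',
    ContinuousLinearMap.toSpanSingleton_apply, smul_eq_mul, mul_one]
  rw [Complex.cpow_sub _ _ hne, Complex.cpow_one]
  ring

end Operators

/-! ### The symbol calculus. -/

section Symbols

variable {m : ℕ} {ι : Type*}

/-- A family of functions `G i`, tested at the points `z i`, is a symbol of amplitude `M` and scale
`ρ` (up to order `N`) when `X₁ ⋯ X_p (G i)` is `O(M i ρ i ^ (-ω(X₁ ⋯ X_p)))` at `z i`, `p ≤ N`. -/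
def IsSymbol (z : ι → Cn m) (ρ : ι → ℝ) : ℕ → (ι → ℝ) → (ι → Cn m → ℂ) → Prop
  | 0, M, G => ∃ C : ℝ, 0 ≤ C ∧ ∀ i, ‖G i (z i)‖ ≤ C * M i
  | N + 1, M, G => (∃ C : ℝ, 0 ≤ C ∧ ∀ i, ‖G i (z i)‖ ≤ C * M i) ∧
      ∀ a, ContDiff ℝ ∞ a →
        IsSymbol z ρ N (fun i => M i * ρ i ^ (-fieldWeight a)) fun i => applyField a (G i)

namespace IsSymbol

variable {z : ι → Cn m} {ρ M M' : ι → ℝ} {G G' : ι → Cn m → ℂ} {N : ℕ} {V : Set (Cn m)}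

theorem bound (h : IsSymbol z ρ N M G) : ∃ C : ℝ, 0 ≤ C ∧ ∀ i, ‖G i (z i)‖ ≤ C * M i := by
  cases N with
  | zero => exact h
  | succ N => exact h.1

theorem congr (hV : IsOpen V) (hz : ∀ i, z i ∈ V) (hGG : ∀ i, Set.EqOn (G i) (G' i) V)
    (h : IsSymbol z ρ N M G) : IsSymbol z ρ N M G' := by
  induction N generalizing M G G' with
  | zero =>
    obtain ⟨C, hC, h⟩ := h
    exact ⟨C, hC, fun i => (hGG i (hz i)) ▸ h i⟩
  | succ N ih =>
    obtain ⟨⟨C, hC, h⟩, h2⟩ := h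
    exact ⟨⟨C, hC, fun i => (hGG i (hz i)) ▸ h i⟩, fun a ha =>
      ih (fun i => applyField_congr hV a (hGG i)) (h2 a ha)⟩

theorem mono (hρ : ∀ i, 0 < ρ i) {C : ℝ} (hC : 0 ≤ C) (hM : ∀ i, M i ≤ C * M' i)
    (h : IsSymbol z ρ N M G) : IsSymbol z ρ N M' G := by
  have key : ∀ {M M' : ι → ℝ} {G : ι → Cn m → ℂ}, (∀ i, M i ≤ C * M' i) →
      (∃ C : ℝ, 0 ≤ C ∧ ∀ i, ‖G i (z i)‖ ≤ C * M i) →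
      ∃ C : ℝ, 0 ≤ C ∧ ∀ i, ‖G i (z i)‖ ≤ C * M' i := by
    rintro M M' G hM ⟨C', hC', h⟩
    refine ⟨C' * C, mul_nonneg hC' hC, fun i => (h i).trans ?_⟩
    rw [mul_assoc]
    exact mul_le_mul_of_nonneg_left (hM i) hC'
  induction N generalizing M M' G with
  | zero => exact key hM h
  | succ N ih =>
    refine ⟨key hM h.1, fun a ha => ih (fun i => ?_) (h.2 a ha)⟩
    rw [← mul_assoc]
    exact mul_le_mul_of_nonneg_right (hM i) (Real.rpow_nonneg (hρ i).le _)

theorem of_succ (h : IsSymbol z ρ (N + 1) M G) : IsSymbol z ρ N M G := by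
  induction N generalizing M G with
  | zero => exact h.1
  | succ N ih => exact ⟨h.1, fun a ha => ih (h.2 a ha)⟩

theorem add (hV : IsOpen V) (hz : ∀ i, z i ∈ V) (hG : ∀ i, ContDiffOn ℝ ∞ (G i) V)
    (hG' : ∀ i, ContDiffOn ℝ ∞ (G' i) V) (h : IsSymbol z ρ N M G) (h' : IsSymbol z ρ N M G') :
    IsSymbol z ρ N M fun i w => G i w + G' i w := by
  have key : ∀ {M : ι → ℝ} {G G' : ι → Cn m → ℂ},
      (∃ C : ℝ, 0 ≤ C ∧ ∀ i, ‖G i (z i)‖ ≤ C * M i) →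
      (∃ C : ℝ, 0 ≤ C ∧ ∀ i, ‖G' i (z i)‖ ≤ C * M i) →
      ∃ C : ℝ, 0 ≤ C ∧ ∀ i, ‖G i (z i) + G' i (z i)‖ ≤ C * M i := by
    rintro M G G' ⟨C, hC, h⟩ ⟨C', hC', h'⟩
    refine ⟨C + C', add_nonneg hC hC', fun i => (norm_add_le _ _).trans ?_⟩
    linarith [h i, h' i, add_mul C C' (M i)]
  induction N generalizing M G G' with
  | zero => exact key h h'
  | succ N ih =>
    refine ⟨key h.1 h'.1, fun a ha => ?_⟩
    exact (ih (fun i => contDiffOn_applyField hV ha (hG i))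
      (fun i => contDiffOn_applyField hV ha (hG' i)) (h.2 a ha) (h'.2 a ha)).congr hV hz
      fun i => (applyField_add hV a (hG i) (hG' i)).symm

theorem const_mul {A : ι → ℝ} {c : ι → ℂ} (hc : ∀ i, ‖c i‖ ≤ A i)
    (h : IsSymbol z ρ N M G) : IsSymbol z ρ N (fun i => A i * M i) fun i w => c i * G i w := by
  have key : ∀ {M : ι → ℝ} {G : ι → Cn m → ℂ},
      (∃ C : ℝ, 0 ≤ C ∧ ∀ i, ‖G i (z i)‖ ≤ C * M i) →
      ∃ C : ℝ, 0 ≤ C ∧ ∀ i, ‖c i * G i (z i)‖ ≤ C * (A i * M i) := by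
    rintro M G ⟨C, hC, h⟩
    refine ⟨C, hC, fun i => ?_⟩
    rw [norm_mul, mul_left_comm]
    exact mul_le_mul (hc i) (h i) (norm_nonneg _) ((norm_nonneg _).trans (hc i))
  induction N generalizing M G with
  | zero => exact key h
  | succ N ih =>
    refine ⟨key h.1, fun a ha => ?_⟩
    have := ih (h.2 a ha)
    simp only [← mul_assoc] at this
    simpa only [applyField_const_mul] using this

/-- The Leibniz rule and induction on the order: in each term one factor carries the derivative, and
both are taken as symbols of order one less. -/
theorem mul (hV : IsOpen V) (hz : ∀ i, z i ∈ V) (hρ : ∀ i, 0 < ρ i)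
    (hG : ∀ i, ContDiffOn ℝ ∞ (G i) V)
    (hG' : ∀ i, ContDiffOn ℝ ∞ (G' i) V) (h : IsSymbol z ρ N M G) (h' : IsSymbol z ρ N M' G') :
    IsSymbol z ρ N (fun i => M i * M' i) fun i w => G i w * G' i w := by
  have key : ∀ {M M' : ι → ℝ} {G G' : ι → Cn m → ℂ},
      (∃ C : ℝ, 0 ≤ C ∧ ∀ i, ‖G i (z i)‖ ≤ C * M i) →
      (∃ C : ℝ, 0 ≤ C ∧ ∀ i, ‖G' i (z i)‖ ≤ C * M' i) →
      ∃ C : ℝ, 0 ≤ C ∧ ∀ i, ‖G i (z i) * G' i (z i)‖ ≤ C * (M i * M' i) := by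
    rintro M M' G G' ⟨C, hC, h⟩ ⟨C', hC', h'⟩
    refine ⟨C * C', mul_nonneg hC hC', fun i => ?_⟩
    rw [norm_mul, mul_mul_mul_comm]
    exact mul_le_mul (h i) (h' i) (norm_nonneg _) ((norm_nonneg _).trans (h i))
  induction N generalizing M M' G G' with
  | zero => exact key h h'
  | succ N ih =>
    refine ⟨key h.1 h'.1, fun a ha => ?_⟩
    have h1 := ih (fun i => contDiffOn_applyField hV ha (hG i)) hG' (h.2 a ha) h'.of_succ
    have h2 := ih hG (fun i => contDiffOn_applyField hV ha (hG' i)) h.of_succ (h'.2 a ha)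
    have h1' := h1.mono (M' := fun i => M i * M' i * ρ i ^ (-fieldWeight a)) hρ zero_le_one
      fun i => by rw [one_mul, mul_right_comm]
    have h2' := h2.mono (M' := fun i => M i * M' i * ρ i ^ (-fieldWeight a)) hρ zero_le_one
      fun i => by rw [one_mul, mul_assoc]
    exact (h1'.add hV hz (fun i => (contDiffOn_applyField hV ha (hG i)).mul (hG' i))
      (fun i => (hG i).mul (contDiffOn_applyField hV ha (hG' i))) h2').congr hV hz
      fun i => (applyField_mul hV a (hG i) (hG' i)).symm

/-- A field maps 1/G to −(1/G)²·aG, so order N for 1/G gives order N + 1. The lower bound on |G| at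
the base points starts the induction. -/
theorem inv (hV : IsOpen V) (hz : ∀ i, z i ∈ V) (hρ : ∀ i, 0 < ρ i)
    (hG : ∀ i, ContDiffOn ℝ ∞ (G i) V) (h0 : ∀ i, ∀ w ∈ V, G i w ≠ 0) {c : ℝ} (hc : 0 < c)
    (hM : ∀ i, 0 < M i) (hlow : ∀ i, c * M i ≤ ‖G i (z i)‖) (h : IsSymbol z ρ N M G) :
    IsSymbol z ρ N (fun i => (M i)⁻¹) fun i w => (G i w)⁻¹ := by
  have key : ∃ C : ℝ, 0 ≤ C ∧ ∀ i, ‖(G i (z i))⁻¹‖ ≤ C * (M i)⁻¹ := by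
    refine ⟨c⁻¹, by positivity, fun i => ?_⟩
    rw [norm_inv, ← mul_inv]
    exact inv_anti₀ (mul_pos hc (hM i)) (hlow i)
  have hinv : ∀ i, ContDiffOn ℝ ∞ (fun w => (G i w)⁻¹) V := fun i => (hG i).inv (h0 i)
  induction N with
  | zero => exact key
  | succ N ih =>
    refine ⟨key, fun a ha => ?_⟩
    have h1 := ih h.of_succ
    have h2 := ((h1.mul hV hz hρ hinv hinv h1).mul hV hz hρ (fun i => (hinv i).mul (hinv i))
      (fun i => contDiffOn_applyField hV ha (hG i)) (h.2 a ha)).const_mul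
      (A := fun _ => 1) (c := fun _ => -1) (by simp)
    refine (h2.congr hV hz
      fun i => (applyField_inv hV a (hG i) (h0 i)).symm).mono hρ zero_le_one fun i => ?_
    have := (hM i).ne'
    apply le_of_eq
    field_simp

/-- Same induction, with a(G^s) = s·G^s·G⁻¹·aG. The amplitude must equal |G| at the base points, so
that both signs of `s` are covered. -/
theorem cpow (hV : IsOpen V) (hz : ∀ i, z i ∈ V) (hρ : ∀ i, 0 < ρ i)
    (hG : ∀ i, ContDiffOn ℝ ∞ (G i) V) (h0 : ∀ i, ∀ w ∈ V, G i w ∈ Complex.slitPlane)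
    (hM : ∀ i, ‖G i (z i)‖ = M i) (h : IsSymbol z ρ N M G) (s : ℝ) :
    IsSymbol z ρ N (fun i => M i ^ s) fun i w => G i w ^ (s : ℂ) := by
  have hne : ∀ i, ∀ w ∈ V, G i w ≠ 0 := fun i w hw => Complex.slitPlane_ne_zero (h0 i w hw)
  have hMpos : ∀ i, 0 < M i := fun i => hM i ▸ norm_pos_iff.mpr (hne i _ (hz i))
  have key : ∃ C : ℝ, 0 ≤ C ∧ ∀ i, ‖G i (z i) ^ (s : ℂ)‖ ≤ C * M i ^ s := by
    refine ⟨1, zero_le_one, fun i => ?_⟩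
    rw [Complex.norm_cpow_real, hM, one_mul]
  have hinv : ∀ i, ContDiffOn ℝ ∞ (fun w => (G i w)⁻¹) V := fun i => (hG i).inv (hne i)
  have hpow : ∀ i, ContDiffOn ℝ ∞ (fun w => G i w ^ (s : ℂ)) V := by
    intro i w hw
    have h1 : ContDiffAt ℝ ∞ (fun u : ℂ => u ^ (s : ℂ)) (G i w) := by
      have : ContDiffAt ℂ ∞ (fun u : ℂ => u ^ (s : ℂ)) (G i w) :=
        (analyticAt_id.cpow analyticAt_const (h0 i w hw)).contDiffAt
      exact this.restrict_scalars ℝ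
    exact h1.comp_contDiffWithinAt w (hG i w hw)
  induction N with
  | zero => exact key
  | succ N ih =>
    refine ⟨key, fun a ha => ?_⟩
    have h1 := ih h.of_succ
    have h3 := h.of_succ.inv hV hz hρ hG hne one_pos hMpos fun i => by rw [one_mul, hM]
    have h2 := ((h1.mul hV hz hρ hpow hinv h3).mul hV hz hρ (fun i => (hpow i).mul (hinv i))
      (fun i => contDiffOn_applyField hV ha (hG i)) (h.2 a ha)).const_mul
      (A := fun _ => ‖(s : ℂ)‖) (c := fun _ => s) (fun _ => le_rfl)
    refine (h2.congr hV hz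
      fun i => (applyField_cpow hV a s (hG i) (h0 i)).symm).mono hρ (norm_nonneg (s : ℂ))
      fun i => ?_
    have := (hMpos i).ne'
    apply le_of_eq
    field_simp

/-- The recursive definition differentiates by the innermost field first, hence the induction from
the end of the list. -/
theorem applyOp_bound (h : ∀ N, IsSymbol z ρ N M G) (hρ : ∀ i, 0 < ρ i)
    {X : List (Cn m → Cn m)} (hX : SmoothOp X) :
    ∃ C : ℝ, 0 ≤ C ∧ ∀ i, ‖applyOp X (G i) (z i)‖ ≤ C * (M i * ρ i ^ (-opWeight X)) := by
  induction X using List.reverseRecOn generalizing M G with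
  | nil =>
    obtain ⟨C, hC, h1⟩ := (h 0).bound
    exact ⟨C, hC, fun i => by simpa [opWeight, applyOp] using h1 i⟩
  | append_singleton X a ih =>
    obtain ⟨C, hC, h1⟩ := ih (fun N => (h (N + 1)).2 a (hX a (by simp)))
      fun b hb => hX b (by simp [hb])
    refine ⟨C, hC, fun i => ?_⟩
    rw [applyOp_append_singleton, opWeight_append_singleton]
    refine (h1 i).trans (le_of_eq ?_)
    rw [mul_assoc (M i), ← Real.rpow_add (hρ i)]
    ring_nf

/-- The converse of `applyOp_bound`: it brings into the calculus functions whose derivatives are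
estimated directly, in particular integrals. -/
theorem of_applyOp_bound (hρ : ∀ i, 0 < ρ i)
    (h : ∀ X : List (Cn m → Cn m), SmoothOp X →
      ∃ C : ℝ, 0 ≤ C ∧ ∀ i, ‖applyOp X (G i) (z i)‖ ≤ C * (M i * ρ i ^ (-opWeight X))) (N : ℕ) :
    IsSymbol z ρ N M G := by
  have key : ∀ {M : ι → ℝ} {G : ι → Cn m → ℂ}, (∀ X : List (Cn m → Cn m), SmoothOp X →
      ∃ C : ℝ, 0 ≤ C ∧ ∀ i, ‖applyOp X (G i) (z i)‖ ≤ C * (M i * ρ i ^ (-opWeight X))) →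
      ∃ C : ℝ, 0 ≤ C ∧ ∀ i, ‖G i (z i)‖ ≤ C * M i := by
    intro M G h
    obtain ⟨C, hC, h1⟩ := h [] (by simp [SmoothOp])
    exact ⟨C, hC, fun i => by simpa [opWeight, applyOp] using h1 i⟩
  induction N generalizing M G with
  | zero => exact key h
  | succ N ih =>
    refine ⟨key h, fun a ha => ih fun X hX => ?_⟩
    obtain ⟨C, hC, h1⟩ := h (X ++ [a]) (by
      intro b hb
      rcases List.mem_append.mp hb with hb | hb
      · exact hX b hb
      · rw [List.mem_singleton.mp hb]; exact ha)
    refine ⟨C, hC, fun i => ?_⟩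
    have h2 := h1 i
    rw [applyOp_append_singleton, opWeight_append_singleton] at h2
    refine h2.trans (le_of_eq ?_)
    rw [mul_assoc (M i), ← Real.rpow_add (hρ i)]
    ring_nf

theorem sum (hV : IsOpen V) (hz : ∀ i, z i ∈ V) (hρ : ∀ i, 0 < ρ i)
    {κ : Type*} (s : Finset κ) {F : κ → ι → Cn m → ℂ}
    (hF : ∀ k ∈ s, ∀ i, ContDiffOn ℝ ∞ (F k i) V) (h : ∀ k ∈ s, IsSymbol z ρ N M (F k)) :
    IsSymbol z ρ N M fun i w => ∑ k ∈ s, F k i w := by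
  classical
  induction s using Finset.induction_on with
  | empty =>
    refine of_applyOp_bound hρ (fun X _ => ⟨0, le_rfl, fun i => ?_⟩) N
    simp [applyOp_zero]
  | insert k s hk ih =>
    simp only [Finset.sum_insert hk]
    exact (h k (by simp)).add hV hz (hF k (by simp))
      (fun i => ContDiffOn.sum fun l hl => hF l (by simp [hl]) i)
      (ih (fun l hl => hF l (by simp [hl])) fun l hl => h l (by simp [hl]))

theorem one (hρ : ∀ i, 0 < ρ i) : IsSymbol z ρ N (fun _ => 1) fun _ _ => 1 := by
  refine of_applyOp_bound hρ (fun X _ => ?_) N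
  rcases List.eq_nil_or_concat X with rfl | ⟨X, a, rfl⟩
  · exact ⟨1, zero_le_one, fun i => by simp [applyOp, opWeight]⟩
  · refine ⟨0, le_rfl, fun i => ?_⟩
    rw [List.concat_eq_append, applyOp_append_singleton]
    have : applyField a (fun _ : Cn m => (1 : ℂ)) = fun _ => 0 := by
      funext w; simp [applyField]
    simp [this, applyOp_zero]

theorem pow (hV : IsOpen V) (hz : ∀ i, z i ∈ V) (hρ : ∀ i, 0 < ρ i)
    (hG : ∀ i, ContDiffOn ℝ ∞ (G i) V) (h : IsSymbol z ρ N M G) (k : ℕ) :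
    IsSymbol z ρ N (fun i => M i ^ k) fun i w => G i w ^ k := by
  induction k with
  | zero => simpa using one hρ
  | succ k ih =>
    simp only [pow_succ]
    exact ih.mul hV hz hρ (fun i => (hG i).pow k) hG h

theorem prod (hV : IsOpen V) (hz : ∀ i, z i ∈ V) (hρ : ∀ i, 0 < ρ i)
    {κ : Type*} (s : Finset κ) {A : κ → ι → ℝ} {F : κ → ι → Cn m → ℂ}
    (hF : ∀ k ∈ s, ∀ i, ContDiffOn ℝ ∞ (F k i) V) (h : ∀ k ∈ s, IsSymbol z ρ N (A k) (F k)) :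
    IsSymbol z ρ N (fun i => ∏ k ∈ s, A k i) fun i w => ∏ k ∈ s, F k i w := by
  classical
  induction s using Finset.induction_on with
  | empty => simpa using one hρ
  | insert k s hk ih =>
    simp only [Finset.prod_insert hk]
    exact (h k (by simp)).mul hV hz hρ (hF k (by simp))
      (fun i => contDiffOn_prod fun l hl => hF l (by simp [hl]) i)
      (ih (fun l hl => hF l (by simp [hl])) fun l hl => h l (by simp [hl]))

end IsSymbol

end Symbols

/-! ### Symbol estimates for affine functions, the kernel and monomials. -/

section BasicSymbols

variable {m : ℕ} {ι : Type*} {z u x : ι → Cn m} {ρ M : ι → ℝ}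

/-- Pseudo-distances in the closed ball are at most 2, so a bounded quantity is always absorbed by a
non-positive power of the scale. -/
theorem one_le_rpow_neg {r s : ℝ} (hr : 0 < r) (hr2 : r ≤ 2) (hs : 0 ≤ s) :
    1 ≤ 2 ^ s * r ^ (-s) := by
  rw [Real.rpow_neg hr.le, ← div_eq_mul_inv, one_le_div (by positivity)]
  gcongr

theorem isSymbol_const (hz : ∀ i, ‖z i‖ ≤ 1) (hρ : ∀ i, 0 < ρ i) (hρ2 : ∀ i, ρ i ≤ 2)
    {b : Cn m → ℂ} (hb : ContDiff ℝ ∞ b) (N : ℕ) :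
    IsSymbol z ρ N (fun _ => 1) fun _ => b := by
  refine IsSymbol.of_applyOp_bound hρ (fun X hX => ?_) N
  have hc : Continuous (applyOp X b) :=
    continuousOn_univ.mp (contDiffOn_applyOp isOpen_univ hX hb.contDiffOn).continuousOn
  obtain ⟨C, hC⟩ := (isCompact_closedBall (0 : Cn m) 1).exists_bound_of_continuousOn hc.continuousOn
  refine ⟨|C| * 2 ^ opWeight X, by positivity, fun i => ?_⟩
  have h1 := hC (z i) (by simpa using hz i)
  have h2 := one_le_rpow_neg (hρ i) (hρ2 i) (opWeight_nonneg X)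
  rw [one_mul, mul_assoc]
  exact (h1.trans (le_abs_self C)).trans (le_mul_of_one_le_right (abs_nonneg C) h2)

theorem contDiff_apply {A : Cn m → Cn m} (hA : ContDiff ℝ ∞ A) (k : Fin (m + 1)) :
    ContDiff ℝ ∞ fun w => A w k := by
  have h : ContDiff ℂ ∞ fun w : Cn m => w k := by fun_prop
  exact (h.restrict_scalars ℝ).comp hA

/-- Expanding in the standard coordinates separates the vectors `u i`, which enter through bounded
coefficients, from the fixed smooth functions A_k. This gives constants uniform in `u i`. -/
theorem isSymbol_inner (hz : ∀ i, ‖z i‖ ≤ 1) (hρ : ∀ i, 0 < ρ i) (hρ2 : ∀ i, ρ i ≤ 2)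
    (hu : ∀ i, ‖u i‖ ≤ 1) {A : Cn m → Cn m} (hA : ContDiff ℝ ∞ A) (N : ℕ) :
    IsSymbol z ρ N (fun _ => 1) fun i w => inner ℂ (u i) (A w) := by
  have h : ∀ k : Fin (m + 1), IsSymbol z ρ N (fun _ => 1)
      fun i w => (starRingEnd ℂ) (u i k) * A w k := by
    intro k
    have h1 := (isSymbol_const hz hρ hρ2 (contDiff_apply hA k) N).const_mul
      (A := fun _ => 1) (c := fun i => (starRingEnd ℂ) (u i k)) fun i => by
        rw [RCLike.norm_conj]
        exact (PiLp.norm_apply_le (u i) k).trans (hu i)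
    simpa using h1
  have h2 := IsSymbol.sum isOpen_univ (fun i => Set.mem_univ (z i)) hρ Finset.univ
    (fun k _ i => (contDiff_const.mul (contDiff_apply hA k)).contDiffOn) fun k _ => h k
  refine h2.congr isOpen_univ (fun i => Set.mem_univ (z i)) fun i w _ => ?_
  simp only [PiLp.inner_apply, RCLike.inner_apply]
  exact Finset.sum_congr rfl fun k _ => mul_comm _ _

theorem contDiff_inner_sub (u x : Cn m) : ContDiff ℂ ∞ fun w : Cn m => inner ℂ u (w - x) :=
  ((innerSL ℂ u).contDiff).comp (contDiff_id.sub contDiff_const)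

theorem applyField_inner_sub (a : Cn m → Cn m) (u x : Cn m) :
    (applyField a fun w => inner ℂ u (w - x)) = fun w => inner ℂ u (a w) := by
  funext w
  have h : HasFDerivAt (fun w => inner ℂ u (w - x)) ((innerSL ℂ u).restrictScalars ℝ) w := by
    have := ((innerSL ℂ u).hasFDerivAt (x := w - x)).comp w ((hasFDerivAt_id w).sub_const x)
    exact this.restrictScalars ℝ
  simp only [applyField, h.fderiv]
  simp

/-- Affine functions, when they have the right size at the base points, are symbols. -/
theorem isSymbol_inner_sub (hz : ∀ i, ‖z i‖ ≤ 1) (hρ : ∀ i, 0 < ρ i) (hρ2 : ∀ i, ρ i ≤ 2)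
    (hu : ∀ i, ‖u i‖ ≤ 1) {C : ℝ} (hC : 0 ≤ C) (h0 : ∀ i, ‖inner ℂ (u i) (z i - x i)‖ ≤ C * M i)
    {C' : ℝ} (hC' : 0 ≤ C') (hM : ∀ i, ρ i ^ (1 / 2 : ℝ) ≤ C' * M i) (N : ℕ) :
    IsSymbol z ρ N M fun i w => inner ℂ (u i) (w - x i) := by
  cases N with
  | zero => exact ⟨C, hC, h0⟩
  | succ N =>
    refine ⟨⟨C, hC, h0⟩, fun a ha => ?_⟩
    simp only [applyField_inner_sub]
    refine (isSymbol_inner hz hρ hρ2 hu ha N).mono hρ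
      (C := 2 ^ (fieldWeight a - 1 / 2) * C') (by positivity) fun i => ?_
    -- After one derivative the function is merely bounded. That suffices: M ρ^(-ω) dominates ρ^(1/2
    -- − ω), and every weight is at least 1/2.
    have h1 := one_le_rpow_neg (hρ i) (hρ2 i) (sub_nonneg.mpr (fieldWeight_ge a))
    refine h1.trans ?_
    rw [mul_assoc]
    gcongr
    have h2 : ρ i ^ (-(fieldWeight a - 1 / 2)) =
        ρ i ^ (1 / 2 : ℝ) * ρ i ^ (-fieldWeight a) := by
      rw [← Real.rpow_add (hρ i)]
      ring_nf
    rw [h2, ← mul_assoc]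
    exact mul_le_mul_of_nonneg_right (hM i) (Real.rpow_nonneg (hρ i).le _)

theorem tau_eq {ζ : Cn m} (hζ : ‖ζ‖ = 1) (w : Cn m) : tau w ζ = (-1) * inner ℂ ζ (w - ζ) := by
  rw [inner_sub_right, inner_self_eq_norm_sq_to_K, hζ]
  simp [tau]

/-- The function `τ(·, ζ)` is a symbol of amplitude and scale `d(z, ζ)`. -/
theorem isSymbol_tau (hz : ∀ i, ‖z i‖ ≤ 1) (hx : ∀ i, ‖x i‖ = 1)
    (hpos : ∀ i, 0 < pdist (z i) (x i)) (N : ℕ) :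
    IsSymbol z (fun i => pdist (z i) (x i)) N (fun i => pdist (z i) (x i))
      fun i w => tau w (x i) := by
  have hd2 : ∀ i, pdist (z i) (x i) ≤ 2 := fun i => pdist_le_two (hz i) (hx i).le
  have h0 : ∃ C : ℝ, 0 ≤ C ∧ ∀ i, ‖tau (z i) (x i)‖ ≤ C * pdist (z i) (x i) :=
    ⟨1, zero_le_one, fun i => by rw [one_mul]; exact le_rfl⟩
  have hfield : ∀ a : Cn m → Cn m, ∀ i,
      applyField a (fun w => tau w (x i)) = fun w => (-1) * inner ℂ (x i) (a w) := by
    intro a i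
    simp only [tau_eq (hx i), applyField_const_mul, applyField_inner_sub]
  have hinner : ∀ A : Cn m → Cn m, ContDiff ℝ ∞ A → ∀ N,
      IsSymbol z (fun i => pdist (z i) (x i)) N (fun _ => 1)
        fun i w => (-1) * inner ℂ (x i) (A w) := by
    intro A hA N
    simpa using (isSymbol_inner hz hpos hd2 (fun i => (hx i).le) hA N).const_mul
      (A := fun _ => 1) (c := fun _ => -1) (by simp)
  have hone : ∀ s : ℝ, 1 ≤ s → ∀ i,
      1 ≤ 2 ^ (s - 1) * (pdist (z i) (x i) * pdist (z i) (x i) ^ (-s)) := by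
    intro s hs i
    have h1 := one_le_rpow_neg (hpos i) (hd2 i) (sub_nonneg.mpr hs)
    have h2 : pdist (z i) (x i) ^ (-(s - 1)) = pdist (z i) (x i) * pdist (z i) (x i) ^ (-s) := by
      rw [neg_sub, sub_eq_add_neg, Real.rpow_add (hpos i), Real.rpow_one]
    rwa [h2] at h1
  cases N with
  | zero => exact h0
  | succ N =>
    refine ⟨h0, fun a ha => ?_⟩
    simp only [hfield]
    rcases fieldWeight_eq a with hw | hw
    · have htan : ∀ w ∈ Metric.closedBall (0 : Cn m) 1, inner ℂ w (a w) = 0 := by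
        by_contra hne
        rw [fieldWeight, if_neg hne] at hw
        norm_num at hw
      obtain ⟨B, hB⟩ := (isCompact_closedBall (0 : Cn m) 1).exists_bound_of_continuousOn
        ha.continuous.continuousOn
      have hB0 : ∃ C : ℝ, 0 ≤ C ∧ ∀ i, ‖(-1) * inner ℂ (x i) (a (z i))‖ ≤
          C * (pdist (z i) (x i) * pdist (z i) (x i) ^ (-fieldWeight a)) := by
        refine ⟨2 * |B|, by positivity, fun i => ?_⟩
        have hzi : z i ∈ Metric.closedBall (0 : Cn m) 1 := by simpa using hz i
        -- Tangency at `z i` allows subtracting `z i`, which gains the factor |x − z| ≲ d^(1/2).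
        have h1 : (inner ℂ (x i) (a (z i)) : ℂ) = inner ℂ (x i - z i) (a (z i)) := by
          rw [inner_sub_left, htan _ hzi, sub_zero]
        have h2 : pdist (z i) (x i) * pdist (z i) (x i) ^ (-fieldWeight a) =
            pdist (z i) (x i) ^ (1 / 2 : ℝ) := by
          rw [hw]
          nth_rewrite 1 [← Real.rpow_one (pdist (z i) (x i))]
          rw [← Real.rpow_add (hpos i)]
          norm_num
        rw [neg_one_mul, norm_neg, h1, h2]
        refine (norm_inner_le_norm _ _).trans ?_
        have h3 := norm_sub_le_pdist (hz i) (hx i)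
        rw [norm_sub_rev] at h3
        have h4 := (hB _ hzi).trans (le_abs_self B)
        calc ‖x i - z i‖ * ‖a (z i)‖ ≤ (2 * pdist (z i) (x i) ^ (1 / 2 : ℝ)) * |B| :=
              mul_le_mul h3 h4 (norm_nonneg _)
                (mul_nonneg zero_le_two (Real.rpow_nonneg (hpos i).le _))
          _ = _ := by ring
      cases N with
      | zero => exact hB0
      | succ N =>
        -- From the second derivative on no gain is needed: two fields have total weight at least 1,
        -- so the allowed size d^(1 − ω(a) − ω(b)) is bounded below.
        refine ⟨hB0, fun b hb => ?_⟩
        have h1 := ((hinner a ha (N + 1)).2 b hb)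
        simp only [applyField_const_mul]
        have h2 : (fun i : ι => applyField b fun w => inner ℂ (x i) (a w)) =
            fun i w => inner ℂ (x i) (fderiv ℝ a w (b w)) := by
          funext i w
          have : HasFDerivAt (fun w => inner ℂ (x i) (a w))
              (((innerSL ℂ (x i)).restrictScalars ℝ).comp (fderiv ℝ a w)) w :=
            ((innerSL ℂ (x i)).restrictScalars ℝ).hasFDerivAt.comp w
              ((ha.differentiable (by simp)) w).hasFDerivAt
          simp [applyField, this.fderiv]
        have h3 := hinner (fun w => fderiv ℝ a w (b w))
          ((ha.fderiv_right (m := ∞) (by simp)).clm_apply hb) N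
        have h4 : (fun (i : ι) w => (-1) * applyField b (fun w => inner ℂ (x i) (a w)) w) =
            fun i w => (-1) * inner ℂ (x i) (fderiv ℝ a w (b w)) := by
          funext i w
          exact congrArg _ (congrFun (congrFun h2 i) w)
        rw [h4]
        refine h3.mono hpos (C := 2 ^ (fieldWeight a + fieldWeight b - 1)) (by positivity)
          fun i => ?_
        have h5 := hone (fieldWeight a + fieldWeight b)
          (by linarith [fieldWeight_ge a, fieldWeight_ge b]) i
        rwa [neg_add, Real.rpow_add (hpos i), ← mul_assoc (pdist (z i) (x i))] at h5
    · refine (hinner a ha N).mono hpos (C := 1) zero_le_one fun i => ?_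
      have h5 := hone 1 le_rfl i
      rw [hw]
      simpa using h5

theorem contDiff_tau (ζ : Cn m) : ContDiff ℂ ∞ fun w : Cn m => tau w ζ :=
  contDiff_const.sub (innerSL ℂ ζ).contDiff

variable {E : Set (Cn m)}

theorem mem_slitPlane_of_mem_posSet {w ζ : Cn m} (hw : w ∈ posSet E) (hζ : ζ ∈ E) :
    tau w ζ ∈ Complex.slitPlane :=
  Or.inl (hw ζ hζ)

theorem contDiffOn_kern (q : ℝ) {ζ : Cn m} (hζ : ζ ∈ E) :
    ContDiffOn ℂ ∞ (fun w => kern q w ζ) (posSet E) := by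
  intro w hw
  have h1 : ContDiffAt ℂ ∞ (fun u : ℂ => u ^ (-(q : ℂ))) (tau w ζ) :=
    (analyticAt_id.cpow analyticAt_const (mem_slitPlane_of_mem_posSet hw hζ)).contDiffAt
  exact (h1.comp w (contDiff_tau ζ).contDiffAt).contDiffWithinAt

/-- The kernel is a symbol of amplitude `d(z, ζ)^(-q)` and scale `d(z, ζ)`. -/
theorem isSymbol_kern (hE : IsCompact E) (hES : E ⊆ Metric.sphere 0 1)
    (hz : ∀ i, z i ∈ Metric.closedBall (0 : Cn m) 1 \ E) (hx : ∀ i, x i ∈ E) (q : ℝ) (N : ℕ) :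
    IsSymbol z (fun i => pdist (z i) (x i)) N (fun i => pdist (z i) (x i) ^ (-q))
      fun i w => kern q w (x i) := by
  have hU : ∀ i, z i ∈ posSet E := fun i => subset_posSet hES (hz i)
  have h := (isSymbol_tau (fun i => norm_le_one (hz i)) (fun i => norm_eq_one hES (hx i))
    (fun i => pdist_pos (hU i) (hx i)) N).cpow (isOpen_posSet hE hES) hU
    (fun i => pdist_pos (hU i) (hx i))
    (fun i => ((contDiff_tau (x i)).restrict_scalars ℝ).contDiffOn)
    (fun i w hw => mem_slitPlane_of_mem_posSet hw (hx i)) (fun i => rfl) (-q)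
  simp only [Complex.ofReal_neg] at h
  exact h

variable {v : Cn m → Fin (m + 1) → Cn m}

/-- The normal coordinate has size d and the others d^(1/2), which is what the weight of a
multi-index counts. -/
theorem prod_rpow_weight {d : ℝ} (hd : 0 < d) (k : Fin (m + 1) → ℕ) :
    ∏ l, (if l = Fin.last m then d else d ^ (1 / 2 : ℝ)) ^ k l = d ^ wt k := by
  rw [Fin.prod_univ_castSucc, wt, Real.rpow_add hd, mul_comm]
  congr 1
  · simp
  · have : ∀ l : Fin m, (if l.castSucc = Fin.last m then d else d ^ (1 / 2 : ℝ)) ^ k l.castSucc =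
        d ^ ((k l.castSucc : ℝ) / 2) := by
      intro l
      rw [if_neg (Fin.castSucc_lt_last l).ne, ← Real.rpow_natCast, ← Real.rpow_mul hd.le]
      ring_nf
    simp only [this]
    rw [← Real.rpow_sum_of_pos hd, Finset.sum_div]

theorem contDiff_coord (ζ : Cn m) (l : Fin (m + 1)) :
    ContDiff ℂ ∞ fun w => coord v w ζ l := contDiff_inner_sub _ _

theorem contDiff_monomial (ζ : Cn m) (k : Fin (m + 1) → ℕ) :
    ContDiff ℂ ∞ fun w => ∏ l, coord v w ζ l ^ k l :=
  contDiff_prod fun l _ => (contDiff_coord ζ l).pow _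

theorem contDiff_monomial_real (ζ : Cn m) (k : Fin (m + 1) → ℕ) :
    ContDiff ℝ ∞ fun w => ∏ l, coord v w ζ l ^ k l :=
  (contDiff_monomial ζ k).restrict_scalars ℝ

/-- A monomial `w(·, ζ)^k` is a symbol of amplitude `d(z, ζ)^{ω(k)}` and scale `d(z, ζ)`. -/
theorem isSymbol_monomial (hES : E ⊆ Metric.sphere 0 1) (hv : IsFrame E v)
    (hz : ∀ i, z i ∈ Metric.closedBall (0 : Cn m) 1 \ E) (hx : ∀ i, x i ∈ E)
    (k : Fin (m + 1) → ℕ) (N : ℕ) :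
    IsSymbol z (fun i => pdist (z i) (x i)) N (fun i => pdist (z i) (x i) ^ wt k)
      fun i w => ∏ l, coord v w (x i) l ^ k l := by
  have hU : ∀ i, z i ∈ posSet E := fun i => subset_posSet hES (hz i)
  have hx1 : ∀ i, ‖x i‖ = 1 := fun i => norm_eq_one hES (hx i)
  have hz1 : ∀ i, ‖z i‖ ≤ 1 := fun i => norm_le_one (hz i)
  have hpos : ∀ i, 0 < pdist (z i) (x i) := fun i => pdist_pos (hU i) (hx i)
  have hd2 : ∀ i, pdist (z i) (x i) ≤ 2 := fun i => pdist_le_two (hz1 i) (hx1 i).le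
  have hcoord : ∀ l : Fin (m + 1), IsSymbol z (fun i => pdist (z i) (x i)) N
      (fun i => if l = Fin.last m then pdist (z i) (x i) else pdist (z i) (x i) ^ (1 / 2 : ℝ))
      fun i w => coord v w (x i) l := by
    intro l
    by_cases hl : l = Fin.last m
    · simp only [hl, if_true]
      have h1 := (isSymbol_tau hz1 hx1 hpos N).const_mul (A := fun _ => 1) (c := fun _ => -1)
        (by simp)
      simp only [one_mul] at h1
      refine h1.congr isOpen_univ (fun i => Set.mem_univ _) fun i w _ => ?_
      simp only [tau_eq (hx1 i), coord, (hv (x i) (hx i)).2]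
      ring
    · simp only [hl, if_false]
      have hu : ∀ i, ‖v (x i) l‖ = 1 := fun i => (hv (x i) (hx i)).1.1 l
      refine isSymbol_inner_sub hz1 hpos hd2 (fun i => (hu i).le) (C := 2) zero_le_two (fun i => ?_)
        (C' := 1) zero_le_one (fun i => by rw [one_mul]) N
      refine (norm_inner_le_norm _ _).trans ?_
      rw [hu, one_mul]
      exact norm_sub_le_pdist (hz1 i) (hx1 i)
  have h2 := IsSymbol.prod isOpen_univ (fun i => Set.mem_univ (z i)) hpos Finset.univ
    (fun l _ i => (((contDiff_coord (x i) l).restrict_scalars ℝ).pow (k l)).contDiffOn)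
    fun l _ => (hcoord l).pow isOpen_univ (fun i => Set.mem_univ (z i)) hpos
      (fun i => ((contDiff_coord (x i) l).restrict_scalars ℝ).contDiffOn) (k l)
  simpa only [prod_rpow_weight (hpos _)] using h2

/-- At scale 1 this only asserts bounded derivatives. Unlike `isSymbol_monomial`, it allows `z i` to
lie in `E`. -/
theorem isSymbol_monomial_one (hES : E ⊆ Metric.sphere 0 1) (hv : IsFrame E v)
    (hz : ∀ i, ‖z i‖ ≤ 1) (hx : ∀ i, x i ∈ E) (k : Fin (m + 1) → ℕ) (N : ℕ) :
    IsSymbol z (fun _ => 1) N (fun _ => 1) fun i w => ∏ l, coord v w (x i) l ^ k l := by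
  have hcoord : ∀ l : Fin (m + 1), IsSymbol z (fun _ => 1) N (fun _ => 1)
      fun i w => coord v w (x i) l := by
    intro l
    have hu : ∀ i, ‖v (x i) l‖ = 1 := fun i => (hv (x i) (hx i)).1.1 l
    refine isSymbol_inner_sub hz (fun _ => one_pos) (fun _ => one_le_two) (fun i => (hu i).le)
      (C := 2) zero_le_two (fun i => ?_) (C' := 1) zero_le_one (fun i => by simp) N
    refine (norm_inner_le_norm _ _).trans ?_
    rw [hu, one_mul, mul_one]
    refine (norm_sub_le _ _).trans ?_
    linarith [hz i, norm_eq_one hES (hx i)]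
  have h2 := IsSymbol.prod isOpen_univ (fun i => Set.mem_univ (z i)) (fun _ => one_pos) Finset.univ
    (fun l _ i => (((contDiff_coord (x i) l).restrict_scalars ℝ).pow (k l)).contDiffOn)
    fun l _ => (hcoord l).pow isOpen_univ (fun i => Set.mem_univ (z i)) (fun _ => one_pos)
      (fun i => ((contDiff_coord (x i) l).restrict_scalars ℝ).contDiffOn) (k l)
  simpa only [one_pow, Finset.prod_const_one] using h2

end BasicSymbols

/-! ### Re-expansion of Taylor polynomials about another centre. -/

section TaylorExpansion

open MvPolynomial

/-- Each derivative multiplies by the exponent it lowers. Keeping (d i)! on the left replaces the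
falling factorial by a ratio without division. -/
theorem coeff_iterate_pderiv {σ : Type*} (i : σ) (n : ℕ) (d : σ →₀ ℕ) (p : MvPolynomial σ ℂ) :
    coeff d ((pderiv i)^[n] p) * ((d i).factorial : ℂ) =
      ((d i + n).factorial : ℂ) * coeff (d + Finsupp.single i n) p := by
  induction n generalizing p with
  | zero => simp [mul_comm]
  | succ n ih =>
    rw [Function.iterate_succ_apply, ih, coeff_pderiv, add_assoc, ← Finsupp.single_add,
      ← add_assoc, Nat.factorial_succ]
    simp
    ring

theorem coeff_foldr_pderiv {σ : Type*} (k : σ → ℕ) (L : List σ) (hL : L.Nodup) (d : σ →₀ ℕ)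
    (hd : ∀ i ∈ L, d i = 0) (p : MvPolynomial σ ℂ) :
    coeff d (L.foldr (fun i p => (pderiv i)^[k i] p) p) =
      (L.map fun i => ((k i).factorial : ℂ)).prod *
        coeff (d + (L.map fun i => Finsupp.single i (k i)).sum) p := by
  induction L generalizing d with
  | nil => simp
  | cons i L ih =>
    rw [List.nodup_cons] at hL
    have h1 := coeff_iterate_pderiv i (k i) d (L.foldr (fun i p => (pderiv i)^[k i] p) p)
    rw [hd i (by simp)] at h1
    simp only [Nat.factorial_zero, Nat.cast_one, mul_one, zero_add] at h1
    rw [List.foldr_cons, h1, ih hL.2]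
    · simp only [List.map_cons, List.prod_cons, List.sum_cons]
      rw [mul_assoc, add_assoc]
    · intro l hl
      have hne : l ≠ i := fun h => hL.1 (h ▸ hl)
      simp [hd l (by simp [hl]), hne.symm]

variable {m : ℕ}

theorem orthonormal_sum {b : Fin (m + 1) → Cn m} (hb : Orthonormal ℂ b) (y : Cn m) :
    ∑ l, (inner ℂ (b l) y : ℂ) • b l = y := by
  have hcard : Fintype.card (Fin (m + 1)) = Module.finrank ℂ (Cn m) := by simp
  have h1 : Orthonormal ℂ (basisOfOrthonormalOfCardEqFinrank hb hcard) := by simpa using hb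
  simpa using ((basisOfOrthonormalOfCardEqFinrank hb hcard).toOrthonormalBasis h1).sum_repr' y

theorem contDiff_eval (b : Fin (m + 1) → Cn m) (x : Cn m) (p : MvPolynomial (Fin (m + 1)) ℂ) :
    ContDiff ℂ ∞ fun z => eval (fun l => inner ℂ (b l) (z - x)) p := by
  induction p using MvPolynomial.induction_on with
  | C a => simpa using contDiff_const
  | add p q hp hq => simpa using hp.add hq
  | mul_X p i hp => simpa using hp.mul (contDiff_inner_sub (b i) x)

theorem fderiv_eval {b : Fin (m + 1) → Cn m} (hb : Orthonormal ℂ b) (x z : Cn m)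
    (i : Fin (m + 1)) (p : MvPolynomial (Fin (m + 1)) ℂ) :
    fderiv ℂ (fun z => eval (fun l => inner ℂ (b l) (z - x)) p) z (b i) =
      eval (fun l => inner ℂ (b l) (z - x)) (pderiv i p) := by
  have hd : ∀ p : MvPolynomial (Fin (m + 1)) ℂ, DifferentiableAt ℂ
      (fun z => eval (fun l => inner ℂ (b l) (z - x)) p) z := fun p =>
    (contDiff_eval b x p).differentiable (by simp) z
  induction p using MvPolynomial.induction_on with
  | C a => simp
  | add p q hp hq =>
    simp only [map_add]
    rw [fderiv_fun_add (hd p) (hd q)]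
    rw [add_apply, hp, hq]
  | mul_X p l hp =>
    have hl : HasFDerivAt (fun w => inner ℂ (b l) (w - x)) (innerSL ℂ (b l)) z := by
      have := ((innerSL ℂ (b l)).hasFDerivAt (x := z - x)).comp z ((hasFDerivAt_id z).sub_const x)
      exact this
    simp only [map_mul, eval_X, pderiv_mul, map_add]
    rw [fderiv_fun_mul (hd p) hl.differentiableAt, hl.fderiv]
    simp only [add_apply, smul_apply, smul_eq_mul, hp, innerSL_apply_apply,
      orthonormal_iff_ite.mp hb l i, pderiv_X, Pi.single_apply]
    split_ifs with h1
    · rw [map_one]; ring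
    · rw [map_zero]; ring

/-- In orthonormal coordinates the directional derivatives are formal partial derivatives, and
evaluation at the centre keeps the constant coefficient. This translates Δ_j into coefficients of
re-expanded polynomials. -/
theorem coordDeriv_eval {b : Fin (m + 1) → Cn m} (hb : Orthonormal ℂ b) (x : Cn m)
    (k : Fin (m + 1) → ℕ) (p : MvPolynomial (Fin (m + 1)) ℂ) :
    coordDeriv b k (fun z => eval (fun l => inner ℂ (b l) (z - x)) p) x =
      (∏ i, ((k i).factorial : ℂ)) * coeff (Finsupp.equivFunOnFinite.symm k) p := by
  have hit : ∀ (i : Fin (m + 1)) (n : ℕ) (p : MvPolynomial (Fin (m + 1)) ℂ),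
      (fun (H : Cn m → ℂ) z => fderiv ℂ H z (b i))^[n]
        (fun z => eval (fun l => inner ℂ (b l) (z - x)) p) =
      fun z => eval (fun l => inner ℂ (b l) (z - x)) ((pderiv i)^[n] p) := by
    intro i n
    induction n with
    | zero => intro p; rfl
    | succ n ih =>
      intro p
      rw [Function.iterate_succ_apply, Function.iterate_succ_apply, ← ih]
      congr 1
      funext z
      exact fderiv_eval hb x z i p
  have hfold : ∀ L : List (Fin (m + 1)),
      L.foldr (fun i G => (fun (H : Cn m → ℂ) z => fderiv ℂ H z (b i))^[k i] G)
        (fun z => eval (fun l => inner ℂ (b l) (z - x)) p) =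
      fun z => eval (fun l => inner ℂ (b l) (z - x))
        (L.foldr (fun i p => (pderiv i)^[k i] p) p) := by
    intro L
    induction L with
    | nil => rfl
    | cons i L ih => rw [List.foldr_cons, ih, hit, List.foldr_cons]
  rw [coordDeriv, hfold]
  simp only [sub_self, inner_zero_right]
  have h0 : ∀ p : MvPolynomial (Fin (m + 1)) ℂ, eval (fun _ => 0) p = coeff 0 p := fun p => by
    rw [← constantCoeff_eq]
    exact congrFun (congrArg _ (MvPolynomial.eval_zero (R := ℂ) (σ := Fin (m + 1)))) p
  rw [h0, coeff_foldr_pderiv k _ (List.nodup_finRange _) 0 (by simp), zero_add,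
    ← Fin.prod_univ_def, ← Fin.sum_univ_def]
  congr 2
  ext l
  simp [Finsupp.finsetSum_apply, Finsupp.single_apply]

variable (v : Cn m → Fin (m + 1) → Cn m)

/-- The coordinate `w_i(·, ξ)` as an affine polynomial in the coordinates given by the basis `b`
and the origin `x`. -/
noncomputable def coordPoly (ξ : Cn m) (b : Fin (m + 1) → Cn m) (x : Cn m) (i : Fin (m + 1)) :
    MvPolynomial (Fin (m + 1)) ℂ :=
  ∑ l, C (inner ℂ (v ξ i) (b l)) * X l + C (inner ℂ (v ξ i) (x - ξ))

/-- The Taylor polynomial `T_ξ f` in the coordinates given by the basis `b` and the origin `x`. -/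
noncomputable def taylorPoly (α : ℝ) (f : Jet m) (ξ : Cn m) (b : Fin (m + 1) → Cn m) (x : Cn m) :
    MvPolynomial (Fin (m + 1)) ℂ :=
  ∑ j ∈ indices m α, C ((∏ i, ((j i).factorial : ℂ))⁻¹ * f j ξ) * ∏ i, coordPoly v ξ b x i ^ j i

theorem eval_coordPoly {b : Fin (m + 1) → Cn m} (hb : Orthonormal ℂ b) (ξ x z : Cn m)
    (i : Fin (m + 1)) :
    eval (fun l => inner ℂ (b l) (z - x)) (coordPoly v ξ b x i) = coord v z ξ i := by
  have h : z - ξ = (z - x) + (x - ξ) := by abel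
  rw [coord, h, inner_add_right]
  nth_rewrite 2 [← orthonormal_sum hb (z - x)]
  simp only [coordPoly, map_add, map_sum, map_mul, eval_C, eval_X, inner_sum, inner_smul_right,
    mul_comm]

theorem eval_taylorPoly {b : Fin (m + 1) → Cn m} (hb : Orthonormal ℂ b) (α : ℝ) (f : Jet m)
    (ξ x z : Cn m) :
    eval (fun l => inner ℂ (b l) (z - x)) (taylorPoly v α f ξ b x) = taylor v α f ξ z := by
  simp only [taylorPoly, taylor, map_sum, map_mul, map_prod, map_pow, eval_C, eval_coordPoly v hb]

/-- Each of the m + 1 exponents is at most ⌊2α⌋ and each coordinate is affine. The bound is crude,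
but it is uniform in `f`, `ξ` and the coordinates. -/
theorem totalDegree_taylorPoly_le (α : ℝ) (f : Jet m) (ξ : Cn m) (b : Fin (m + 1) → Cn m)
    (x : Cn m) : (taylorPoly v α f ξ b x).totalDegree ≤ (m + 1) * ⌊2 * α⌋₊ := by
  have h1 : ∀ i, (coordPoly v ξ b x i).totalDegree ≤ 1 := by
    intro i
    refine (totalDegree_add _ _).trans (max_le ?_ (by rw [totalDegree_C]; exact zero_le_one))
    refine totalDegree_finsetSum_le fun l _ => (totalDegree_mul _ _).trans ?_
    simp
  refine totalDegree_finsetSum_le fun j hj => (totalDegree_mul _ _).trans ?_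
  rw [totalDegree_C, zero_add]
  refine (totalDegree_finsetProd _ _).trans ?_
  have h2 : ∀ i ∈ Finset.univ, (coordPoly v ξ b x i ^ j i).totalDegree ≤ ⌊2 * α⌋₊ := by
    intro i _
    refine (totalDegree_pow _ _).trans ?_
    have h3 : j i ≤ ⌊2 * α⌋₊ := by
      simp only [indices, Finset.mem_filter, Fintype.mem_piFinset, Finset.mem_range] at hj
      exact Nat.lt_succ_iff.mp (hj.1 i)
    calc j i * (coordPoly v ξ b x i).totalDegree ≤ j i * 1 := Nat.mul_le_mul_left _ (h1 i)
      _ ≤ _ := by omega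
  simpa using Finset.sum_le_card_nsmul _ _ _ h2

/-- A finite set of multi-indices that contains all those occurring in the Taylor polynomials. -/
noncomputable def taylorIndices (m : ℕ) (α : ℝ) : Finset (Fin (m + 1) → ℕ) :=
  Fintype.piFinset fun _ => Finset.range ((m + 1) * ⌊2 * α⌋₊ + 1)

theorem indices_subset (m : ℕ) (α : ℝ) : indices m α ⊆ taylorIndices m α := by
  intro j hj
  simp only [indices, Finset.mem_filter, Fintype.mem_piFinset, Finset.mem_range] at hj
  simp only [taylorIndices, Fintype.mem_piFinset, Finset.mem_range]
  intro i
  have := hj.1 i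
  nlinarith [Nat.zero_le (m * ⌊2 * α⌋₊)]

theorem taylor_eq_sum_coeff {b : Fin (m + 1) → Cn m} (hb : Orthonormal ℂ b) (α : ℝ) (f : Jet m)
    (ξ x z : Cn m) :
    taylor v α f ξ z = ∑ k ∈ taylorIndices m α,
      coeff (Finsupp.equivFunOnFinite.symm k) (taylorPoly v α f ξ b x) *
        ∏ l, (inner ℂ (b l) (z - x) : ℂ) ^ k l := by
  rw [← eval_taylorPoly v hb α f ξ x z, eval_eq']
  have hsub : (taylorPoly v α f ξ b x).support ⊆
      (taylorIndices m α).map Finsupp.equivFunOnFinite.symm.toEmbedding := by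
    intro d hd
    rw [Finset.mem_map_equiv]
    simp only [taylorIndices, Fintype.mem_piFinset, Finset.mem_range, Equiv.symm_symm]
    intro i
    refine Nat.lt_succ_of_le (le_trans ?_ (totalDegree_taylorPoly_le v α f ξ b x))
    refine le_trans ?_ (le_totalDegree hd)
    rw [Finsupp.sum_fintype _ _ (by simp)]
    exact Finset.single_le_sum (f := fun i => d i) (fun _ _ => Nat.zero_le _) (Finset.mem_univ i)
  rw [Finset.sum_subset hsub, Finset.sum_map]
  · rfl
  · intro d _ hd
    rw [notMem_support_iff.mp hd, zero_mul]

/-- A bound, for each monomial, on its coefficients in a family of polynomials. -/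
def CoeffBounded {ι : Type*} (p : ι → MvPolynomial (Fin (m + 1)) ℂ) : Prop :=
  ∀ d, ∃ C : ℝ, 0 ≤ C ∧ ∀ i, ‖coeff d (p i)‖ ≤ C

namespace CoeffBounded

variable {ι : Type*} {p p' : ι → MvPolynomial (Fin (m + 1)) ℂ}

theorem const (p₀ : MvPolynomial (Fin (m + 1)) ℂ) : CoeffBounded fun _ : ι => p₀ :=
  fun _ => ⟨_, norm_nonneg _, fun _ => le_rfl⟩

theorem C {c : ι → ℂ} {A : ℝ} (hA : 0 ≤ A) (hc : ∀ i, ‖c i‖ ≤ A) :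
    CoeffBounded (m := m) fun i => C (c i) := by
  intro d
  refine ⟨A, hA, fun i => ?_⟩
  rw [coeff_C]
  split_ifs
  · exact hc i
  · simpa using hA

theorem add (h : CoeffBounded p) (h' : CoeffBounded p') : CoeffBounded fun i => p i + p' i := by
  intro d
  obtain ⟨C, hC, h⟩ := h d
  obtain ⟨C', hC', h'⟩ := h' d
  refine ⟨C + C', add_nonneg hC hC', fun i => ?_⟩
  rw [coeff_add]
  exact (norm_add_le _ _).trans (add_le_add (h i) (h' i))

theorem mul (h : CoeffBounded p) (h' : CoeffBounded p') : CoeffBounded fun i => p i * p' i := by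
  classical
  intro d
  choose C hC h using h
  choose C' hC' h' using h'
  refine ⟨∑ x ∈ Finset.HasAntidiagonal.antidiagonal d, C x.1 * C' x.2,
    Finset.sum_nonneg fun x _ => mul_nonneg (hC _) (hC' _), fun i => ?_⟩
  rw [coeff_mul]
  refine norm_sum_le_of_le _ fun x _ => ?_
  rw [norm_mul]
  exact mul_le_mul (h _ i) (h' _ i) (norm_nonneg _) (hC _)

theorem sum {κ : Type*} (s : Finset κ) {P : κ → ι → MvPolynomial (Fin (m + 1)) ℂ}
    (h : ∀ k ∈ s, CoeffBounded (P k)) : CoeffBounded fun i => ∑ k ∈ s, P k i := by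
  classical
  induction s using Finset.induction_on with
  | empty => simpa using const 0
  | insert k s hk ih =>
    simp only [Finset.sum_insert hk]
    exact (h k (by simp)).add (ih fun l hl => h l (by simp [hl]))

theorem prod {κ : Type*} (s : Finset κ) {P : κ → ι → MvPolynomial (Fin (m + 1)) ℂ}
    (h : ∀ k ∈ s, CoeffBounded (P k)) : CoeffBounded fun i => ∏ k ∈ s, P k i := by
  classical
  induction s using Finset.induction_on with
  | empty => simpa using const 1
  | insert k s hk ih =>
    simp only [Finset.prod_insert hk]
    exact (h k (by simp)).mul (ih fun l hl => h l (by simp [hl]))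

theorem pow (h : CoeffBounded p) (n : ℕ) : CoeffBounded fun i => p i ^ n := by
  induction n with
  | zero => simpa using const 1
  | succ n ih => simpa only [pow_succ] using ih.mul h

end CoeffBounded

variable {v} {E : Set (Cn m)} {α : ℝ}

theorem norm_inner_le_of_norm_le {x y : Cn m} {A B : ℝ} (hx : ‖x‖ ≤ A) (hy : ‖y‖ ≤ B) :
    ‖(inner ℂ x y : ℂ)‖ ≤ A * B :=
  (norm_inner_le_norm x y).trans (mul_le_mul hx hy (norm_nonneg _) ((norm_nonneg _).trans hx))

theorem MemLip.norm_jet_le {f : Jet m} (hf : MemLip E v α f) {j : Fin (m + 1) → ℕ}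
    (hj : j ∈ indices m α) {x : Cn m} (hx : x ∈ E) : ‖f j x‖ ≤ lipNorm E v α f := by
  rw [lipNorm, ← ENNReal.ofReal_le_iff_le_toReal hf.finite.ne, lipENorm]
  refine le_trans ?_ (Finset.single_le_sum (fun _ _ => zero_le) hj)
  exact (le_iSup₂ (f := fun x (_ : x ∈ E) => ENNReal.ofReal ‖f j x‖) x hx).trans le_self_add

theorem lipNorm_nonneg (f : Jet m) : 0 ≤ lipNorm E v α f := ENNReal.toReal_nonneg

/-- Positivity of the distance is required because at x = y the quotient in the norm may be a
division by zero, with value 0. -/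
theorem MemLip.norm_delta_le {f : Jet m} (hf : MemLip E v α f) {j : Fin (m + 1) → ℕ}
    (hj : j ∈ indices m α) {x y : Cn m} (hx : x ∈ E) (hy : y ∈ E) (hd : 0 < pdist x y) :
    ‖delta v α f j y x‖ ≤ lipNorm E v α f * pdist x y ^ (α - wt j) := by
  rw [← div_le_iff₀ (Real.rpow_pos_of_pos hd _), lipNorm,
    ← ENNReal.ofReal_le_iff_le_toReal hf.finite.ne, lipENorm]
  refine le_trans ?_ (Finset.single_le_sum (fun _ _ => zero_le) hj)
  refine le_trans ?_ le_add_self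
  refine le_trans ?_ (le_iSup₂ (f := fun x (_ : x ∈ E) => ⨆ y ∈ E,
    ENNReal.ofReal (‖delta v α f j y x‖ / pdist x y ^ (α - wt j))) x hx)
  exact le_iSup₂ (f := fun y (_ : y ∈ E) =>
    ENNReal.ofReal (‖delta v α f j y x‖ / pdist x y ^ (α - wt j))) y hy

/-- The coefficients of `T_ξ f` in the coordinates centred at `ζ` are bounded by `‖f‖`. -/
theorem exists_coeff_taylorPoly_le (hES : E ⊆ Metric.sphere 0 1) (hv : IsFrame E v) (α : ℝ)
    (d : Fin (m + 1) →₀ ℕ) :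
    ∃ C : ℝ, 0 ≤ C ∧ ∀ f, MemLip E v α f → ∀ ξ ∈ E, ∀ ζ ∈ E,
      ‖coeff d (taylorPoly v α f ξ (v ζ) ζ)‖ ≤ C * lipNorm E v α f := by
  have h1 : ∀ i, CoeffBounded fun p : E × E => coordPoly v p.1 (v p.2) p.2 i := by
    intro i
    have hv1 : ∀ (x : E) l, ‖v x l‖ ≤ 1 := fun x l => ((hv x x.2).1.1 l).le
    refine (CoeffBounded.sum Finset.univ fun l _ => ?_).add ?_
    · exact (CoeffBounded.C (A := 1 * 1) (by norm_num) fun p =>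
        norm_inner_le_of_norm_le (hv1 _ i) (hv1 _ l)).mul (CoeffBounded.const _)
    · refine CoeffBounded.C (A := 1 * (1 + 1)) (by norm_num) fun p =>
        norm_inner_le_of_norm_le (hv1 _ i) ((norm_sub_le _ _).trans (add_le_add ?_ ?_))
      · exact (norm_eq_one hES p.2.2).le
      · exact (norm_eq_one hES p.1.2).le
  have h2 : ∀ j : Fin (m + 1) → ℕ,
      CoeffBounded fun p : E × E => ∏ i, coordPoly v p.1 (v p.2) p.2 i ^ j i := fun j =>
    CoeffBounded.prod _ fun i _ => (h1 i).pow (j i)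
  choose C hC h3 using fun j => h2 j d
  refine ⟨∑ j ∈ indices m α, ‖(∏ i, ((j i).factorial : ℂ))⁻¹‖ * C j,
    Finset.sum_nonneg fun j _ => mul_nonneg (norm_nonneg _) (hC j), fun f hf ξ hξ ζ hζ => ?_⟩
  rw [taylorPoly, coeff_sum, Finset.sum_mul]
  refine norm_sum_le_of_le _ fun j hj => ?_
  rw [coeff_C_mul, norm_mul, norm_mul, mul_right_comm]
  have h4 := h3 j (⟨ξ, hξ⟩, ⟨ζ, hζ⟩)
  have h5 := hf.norm_jet_le hj hξ
  exact mul_le_mul (mul_le_mul_of_nonneg_left h4 (norm_nonneg _)) h5 (norm_nonneg _)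
    (mul_nonneg (norm_nonneg _) (hC j))

open scoped Classical in
/-- The expansion of `T_ζ f - T_ξ f` in the coordinates centred at `ζ`. -/
theorem exists_taylor_sub_expansion (hES : E ⊆ Metric.sphere 0 1) (hv : IsFrame E v) (α : ℝ) :
    ∃ C : ℝ, 0 ≤ C ∧ ∀ f, MemLip E v α f → ∀ ξ ∈ E, ∀ ζ ∈ E, 0 < pdist ζ ξ →
      ∃ c : (Fin (m + 1) → ℕ) → ℂ,
        (∀ z, taylor v α f ζ z - taylor v α f ξ z =
          ∑ k ∈ taylorIndices m α, c k * ∏ l, coord v z ζ l ^ k l) ∧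
        ∀ k ∈ taylorIndices m α, ‖c k‖ ≤ C * lipNorm E v α f *
          if wt k ≤ α then pdist ζ ξ ^ (α - wt k) else 1 := by
  choose C hC h using fun k : Fin (m + 1) → ℕ =>
    exists_coeff_taylorPoly_le hES hv α (Finsupp.equivFunOnFinite.symm k)
  refine ⟨1 + ∑ k ∈ taylorIndices m α, C k,
    add_nonneg zero_le_one (Finset.sum_nonneg fun k _ => hC k), fun f hf ξ hξ ζ hζ hd => ?_⟩
  have hsum : 0 ≤ ∑ k ∈ taylorIndices m α, C k := Finset.sum_nonneg fun k _ => hC k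
  -- The coefficient of T_ζ f minus that of T_ξ f, both in the coordinates at `ζ`. For ω(k) ≤ α it
  -- equals Δ_k(ξ, ζ)/k!.
  refine ⟨fun k => (if k ∈ indices m α then (∏ i, ((k i).factorial : ℂ))⁻¹ * f k ζ else 0) -
    coeff (Finsupp.equivFunOnFinite.symm k) (taylorPoly v α f ξ (v ζ) ζ), fun z => ?_,
    fun k hk => ?_⟩
  · rw [taylor_eq_sum_coeff v (hv ζ hζ).1 α f ξ ζ z]
    simp only [sub_mul, Finset.sum_sub_distrib, coord]
    congr 1
    rw [taylor, ← Finset.sum_subset (indices_subset m α)]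
    · refine Finset.sum_congr rfl fun j hj => ?_
      rw [if_pos hj]
      rfl
    · intro j _ hj
      rw [if_neg hj, zero_mul]
  · by_cases hkα : wt k ≤ α
    · have hk' : k ∈ indices m α := mem_indices.mpr hkα
      simp only [if_pos hkα, if_pos hk']
      have h1 := hf.norm_delta_le hk' hζ hξ hd
      have h2 : delta v α f k ξ ζ = f k ζ - (∏ i, ((k i).factorial : ℂ)) *
          coeff (Finsupp.equivFunOnFinite.symm k) (taylorPoly v α f ξ (v ζ) ζ) := by
        rw [delta, ← coordDeriv_eval (hv ζ hζ).1 ζ k]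
        congr 2
        funext z
        exact (eval_taylorPoly v (hv ζ hζ).1 α f ξ ζ z).symm
      have h3 : (∏ i, ((k i).factorial : ℂ)) ≠ 0 :=
        Finset.prod_ne_zero_iff.mpr fun i _ => by exact_mod_cast (k i).factorial_ne_zero
      have h4 : (∏ i, ((k i).factorial : ℂ))⁻¹ * f k ζ -
          coeff (Finsupp.equivFunOnFinite.symm k) (taylorPoly v α f ξ (v ζ) ζ) =
          (∏ i, ((k i).factorial : ℂ))⁻¹ * delta v α f k ξ ζ := by
        rw [h2]
        field_simp
      have h5 : ‖(∏ i, ((k i).factorial : ℂ))⁻¹‖ ≤ 1 := by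
        rw [← Nat.cast_prod, norm_inv, Complex.norm_natCast]
        exact inv_le_one_of_one_le₀ (by
          exact_mod_cast Nat.one_le_iff_ne_zero.mpr
            (Finset.prod_ne_zero_iff.mpr fun i _ => (k i).factorial_ne_zero))
      rw [h4, norm_mul]
      have h6 : 0 ≤ lipNorm E v α f * pdist ζ ξ ^ (α - wt k) :=
        mul_nonneg (lipNorm_nonneg f) (Real.rpow_nonneg hd.le _)
      calc _ ≤ 1 * (lipNorm E v α f * pdist ζ ξ ^ (α - wt k)) :=
            mul_le_mul h5 h1 (norm_nonneg _) zero_le_one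
        _ ≤ (1 + ∑ k ∈ taylorIndices m α, C k) * (lipNorm E v α f * pdist ζ ξ ^ (α - wt k)) := by
            gcongr
            linarith
        _ = _ := by ring
    -- Re-expansion can raise the weight, since a tangential coordinate at `ξ` may involve the
    -- normal coordinate at `ζ`. These coefficients are only bounded.
    · have hk' : k ∉ indices m α := fun h => hkα (mem_indices.mp h)
      simp only [if_neg hkα, if_neg hk', zero_sub, norm_neg, mul_one]
      refine (h k f hf ξ hξ ζ hζ).trans ?_
      gcongr
      · exact lipNorm_nonneg f
      · have := Finset.single_le_sum (fun k _ => hC k) hk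
        linarith

/-- The Taylor polynomials, in a fixed finite-dimensional space of polynomials, have continuous
coefficients. -/
theorem exists_taylor_eq_sum (v : Cn m → Fin (m + 1) → Cn m) (α : ℝ) :
    ∃ (n : ℕ) (Q : Fin n → Cn m → ℂ), (∀ l, ContDiff ℂ ∞ (Q l)) ∧
      ∀ f, MemLip E v α f → ∃ g : Fin n → Cn m → ℂ, (∀ l, ContinuousOn (g l) E) ∧
        ∀ ζ z, taylor v α f ζ z = ∑ l, g l ζ * Q l z := by
  set b : Fin (m + 1) → Cn m := fun i => EuclideanSpace.basisFun (Fin (m + 1)) ℂ i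
  have hbo : Orthonormal ℂ b := (EuclideanSpace.basisFun (Fin (m + 1)) ℂ).orthonormal
  let ev : MvPolynomial (Fin (m + 1)) ℂ →ₗ[ℂ] (Cn m → ℂ) :=
    { toFun := fun p z => eval (fun l => inner ℂ (b l) (z - 0)) p
      map_add' := fun p q => by funext z; simp
      map_smul' := fun c p => by funext z; simp [smul_eval] }
  let W : Submodule ℂ (Cn m → ℂ) :=
    (restrictTotalDegree (Fin (m + 1)) ℂ ((m + 1) * ⌊2 * α⌋₊)).map ev
  have hW : ∀ f ζ, taylor v α f ζ ∈ W := by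
    intro f ζ
    refine ⟨taylorPoly v α f ζ b 0, ?_, ?_⟩
    · exact (mem_restrictTotalDegree _ _ _).mpr (totalDegree_taylorPoly_le v α f ζ b 0)
    · funext z
      exact eval_taylorPoly v hbo α f ζ 0 z
  let B := Module.finBasis ℂ W
  refine ⟨_, fun l => (B l : Cn m → ℂ), fun l => ?_, fun f hf => ?_⟩
  · obtain ⟨p, -, hp⟩ := (B l).2
    have : ContDiff ℂ ∞ (ev p) := contDiff_eval b 0 p
    rwa [hp] at this
  · refine ⟨fun l ζ => B.repr ⟨taylor v α f ζ, hW f ζ⟩ l, fun l => ?_, fun ζ z => ?_⟩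
    -- `W` carries the topology of pointwise convergence. It is finite-dimensional, so its
    -- coordinate functionals are continuous, and pointwise continuity of ζ ↦ T_ζ f passes to the
    -- coefficients.
    · have h1 : ContinuousOn (fun ζ => (⟨taylor v α f ζ, hW f ζ⟩ : W)) E := by
        rw [Topology.IsInducing.subtypeVal.continuousOn_iff]
        exact continuousOn_pi.mpr fun z => hf.continuous z
      exact (LinearMap.continuous_of_finiteDimensional (B.coord l)).comp_continuousOn h1
    · have h2 := congrArg (fun w : W => (w : Cn m → ℂ) z) (B.sum_repr ⟨taylor v α f ζ, hW f ζ⟩)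
      refine h2.symm.trans ?_
      simp only [Submodule.coe_sum, Submodule.coe_smul, Finset.sum_apply, Pi.smul_apply,
        smul_eq_mul]

end TaylorExpansion

/-! ### Differentiation of kernel integrals. -/

section KernelIntegrals

variable {m : ℕ} {E : Set (Cn m)} {μ : Measure (Cn m)}

theorem integrable_of_continuousOn [IsFiniteMeasure μ] (hE : IsCompact E)
    (hμE : ∀ᵐ ζ ∂μ, ζ ∈ E) {F : Type*} [NormedAddCommGroup F] {G : Cn m → F}
    (hG : ContinuousOn G E) : Integrable G μ := by
  have h := hG.integrableOn_compact hE (μ := μ)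
  rwa [IntegrableOn, Measure.restrict_eq_self_of_ae_mem hμE] at h

theorem continuousOn_kern (q : ℝ) {z : Cn m} (hz : z ∈ posSet E) : ContinuousOn (kern q z) E := by
  intro ζ hζ
  have h1 : ContinuousAt (fun u : ℂ => u ^ (-(q : ℂ))) (tau z ζ) :=
    (analyticAt_id.cpow analyticAt_const (mem_slitPlane_of_mem_posSet hz hζ)).continuousAt
  have h2 : Continuous fun ζ => tau z ζ := continuous_tau.comp (Continuous.prodMk_right z)
  exact (ContinuousAt.comp (f := fun ζ => tau z ζ) h1 h2.continuousAt).continuousWithinAt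

theorem hasFDerivAt_kern (q : ℝ) {z ζ : Cn m} (hz : z ∈ posSet E) (hζ : ζ ∈ E) :
    HasFDerivAt (fun w => kern q w ζ) ((q * kern (q + 1) z ζ) • innerSL ℂ ζ) z := by
  have hs := mem_slitPlane_of_mem_posSet hz hζ
  have h1 : HasFDerivAt (fun w => tau w ζ) (-(innerSL ℂ ζ)) z :=
    ((innerSL ℂ ζ).hasFDerivAt (x := z)).const_sub 1
  have h2 := ((hasStrictDerivAt_id (tau z ζ)).cpow_const (c := -(q : ℂ)) hs).hasDerivAt
  have h3 := h2.comp_hasFDerivAt z h1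
  refine h3.congr_fderiv ?_
  simp only [id, kern, mul_one, smul_neg, ← neg_smul]
  push_cast
  ring_nf

theorem norm_kern (q : ℝ) (z ζ : Cn m) : ‖kern q z ζ‖ = pdist z ζ ^ (-q) := by
  rw [kern, ← Complex.ofReal_neg, Complex.norm_cpow_real, pdist]

theorem exists_norm_kern_le (hE : IsCompact E) (hES : E ⊆ Metric.sphere 0 1) (q : ℝ)
    {z : Cn m} (hz : z ∈ posSet E) :
    ∃ ε > 0, ∃ C : ℝ, Metric.ball z ε ⊆ posSet E ∧
      ∀ w ∈ Metric.ball z ε, ∀ ζ ∈ E, ‖kern q w ζ‖ ≤ C := by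
  obtain ⟨ε, hε, h⟩ := exists_re_tau_ge hE hES hz
  -- One summand bounds the kernel for q ≥ 0, from the lower bound on the distance; the other for q
  -- ≤ 0, from the upper bound.
  refine ⟨ε, hε, ε ^ (-q) + (1 + (‖z‖ + ε)) ^ (-q),
    fun w hw ζ hζ => hε.trans_le (h w hw ζ hζ), fun w hw ζ hζ => ?_⟩
  rw [norm_kern]
  have h1 : ε ≤ pdist w ζ := (h w hw ζ hζ).trans (Complex.re_le_norm _)
  have h2 : pdist w ζ ≤ 1 + (‖z‖ + ε) := by
    have h3 : ‖w‖ ≤ ‖z‖ + ε := by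
      have := norm_sub_norm_le w z
      rw [Metric.mem_ball, dist_eq_norm] at hw
      linarith
    have h4 := norm_inner_le_norm (𝕜 := ℂ) ζ w
    rw [norm_eq_one hES hζ, one_mul] at h4
    refine (norm_sub_le _ _).trans ?_
    rw [norm_one]
    linarith
  have h0 : 0 < 1 + (‖z‖ + ε) := by positivity
  rcases le_total 0 q with hq | hq
  · have := Real.rpow_le_rpow_of_nonpos hε h1 (neg_nonpos.mpr hq)
    linarith [Real.rpow_nonneg h0.le (-q)]
  · have := Real.rpow_le_rpow (pdist_nonneg _ _) h2 (neg_nonneg.mpr hq)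
    linarith [Real.rpow_nonneg hε.le (-q)]

theorem hasFDerivAt_integral_kern [IsFiniteMeasure μ] (hE : IsCompact E)
    (hES : E ⊆ Metric.sphere 0 1) (hμE : ∀ᵐ ζ ∂μ, ζ ∈ E) {g : Cn m → ℂ} (hg : ContinuousOn g E)
    (q : ℝ) {z : Cn m} (hz : z ∈ posSet E) :
    Integrable (fun ζ => (g ζ * (q * kern (q + 1) z ζ)) • innerSL ℂ ζ) μ ∧
    HasFDerivAt (fun w => ∫ ζ, g ζ * kern q w ζ ∂μ)
      (∫ ζ, (g ζ * (q * kern (q + 1) z ζ)) • innerSL ℂ ζ ∂μ) z := by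
  obtain ⟨ε, hε, C, hball, hC⟩ := exists_norm_kern_le hE hES (q + 1) hz
  obtain ⟨A, hA⟩ := hE.exists_bound_of_continuousOn hg
  have hint : ∀ w ∈ posSet E, Integrable (fun ζ => g ζ * kern q w ζ) μ := fun w hw =>
    integrable_of_continuousOn hE hμE (hg.mul (continuousOn_kern q hw))
  have hint' : Integrable (fun ζ => (g ζ * (q * kern (q + 1) z ζ)) • innerSL ℂ ζ) μ :=
    integrable_of_continuousOn hE hμE
      ((hg.mul (continuousOn_const.mul (continuousOn_kern (q + 1) hz))).smul
        (innerSL ℂ).continuous.continuousOn)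
  refine ⟨hint', hasFDerivAt_integral_of_dominated_of_fderiv_le (𝕜 := ℂ)
    (F' := fun w ζ => (g ζ * (q * kern (q + 1) w ζ)) • innerSL ℂ ζ)
    (bound := fun _ => |A| * (|q| * |C|)) (Metric.ball_mem_nhds z hε) ?_ (hint z hz)
    hint'.aestronglyMeasurable ?_ (integrable_const _) ?_⟩
  · filter_upwards [Metric.ball_mem_nhds z hε] with w hw
    exact (hint w (hball hw)).aestronglyMeasurable
  · filter_upwards [hμE] with ζ hζ w hw
    rw [norm_smul, norm_mul, norm_mul, innerSL_apply_norm, norm_eq_one hES hζ, mul_one,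
      Complex.norm_real, Real.norm_eq_abs]
    gcongr
    · exact (hA ζ hζ).trans (le_abs_self A)
    · exact (hC w hw ζ hζ).trans (le_abs_self C)
  · filter_upwards [hμE] with ζ hζ w hw
    have := (hasFDerivAt_kern q (hball hw) hζ).const_mul (g ζ)
    rwa [smul_smul] at this

/-- A derivative is again a kernel integral, with density multiplied by q⟨ζ, y⟩ and exponent q + 1;
this is what makes the induction for smoothness close up. -/
theorem fderiv_integral_kern_apply [IsFiniteMeasure μ] (hE : IsCompact E)
    (hES : E ⊆ Metric.sphere 0 1) (hμE : ∀ᵐ ζ ∂μ, ζ ∈ E) {g : Cn m → ℂ} (hg : ContinuousOn g E)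
    (q : ℝ) {z : Cn m} (hz : z ∈ posSet E) (y : Cn m) :
    fderiv ℂ (fun w => ∫ ζ, g ζ * kern q w ζ ∂μ) z y =
      ∫ ζ, (g ζ * (q * inner ℂ ζ y)) * kern (q + 1) z ζ ∂μ := by
  obtain ⟨h1, h2⟩ := hasFDerivAt_integral_kern hE hES hμE hg q hz
  rw [h2.fderiv, ContinuousLinearMap.integral_apply h1]
  congr 1
  funext ζ
  simp only [smul_apply, innerSL_apply_apply, smul_eq_mul]
  ring

theorem contDiffOn_integral_kern [IsFiniteMeasure μ] (hE : IsCompact E)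
    (hES : E ⊆ Metric.sphere 0 1) (hμE : ∀ᵐ ζ ∂μ, ζ ∈ E) {g : Cn m → ℂ} (hg : ContinuousOn g E)
    (q : ℝ) : ContDiffOn ℂ ∞ (fun w => ∫ ζ, g ζ * kern q w ζ ∂μ) (posSet E) := by
  have hdiff : ∀ {g : Cn m → ℂ}, ContinuousOn g E → ∀ q : ℝ,
      DifferentiableOn ℂ (fun w => ∫ ζ, g ζ * kern q w ζ ∂μ) (posSet E) := fun hg q z hz =>
    (hasFDerivAt_integral_kern hE hES hμE hg q hz).2.differentiableAt.differentiableWithinAt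
  refine contDiffOn_infty.mpr fun n => ?_
  induction n generalizing g q with
  | zero => exact contDiffOn_zero.mpr (hdiff hg q).continuousOn
  | succ n ih =>
    push_cast
    rw [contDiffOn_succ_iff_fderiv_of_isOpen (isOpen_posSet hE hES)]
    refine ⟨hdiff hg q, by simp, ?_⟩
    rw [contDiffOn_clm_apply]
    intro y
    have hg' : ContinuousOn (fun ζ => g ζ * (q * inner ℂ ζ y)) E := by
      have : Continuous fun ζ : Cn m => (inner ℂ ζ y : ℂ) := by fun_prop
      exact hg.mul (continuous_const.mul this).continuousOn
    exact (ih hg' (q + 1)).congr fun z hz => fderiv_integral_kern_apply hE hES hμE hg q hz y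

/-- Finite sums of products `g(ζ) b(z) (1 - z ζ̄)^(-q)`: a class of families of functions of `z`
which is stable under vector fields. -/
inductive IsKernelFamily (E : Set (Cn m)) : (Cn m → Cn m → ℂ) → Prop
  | base (g b : Cn m → ℂ) (q : ℝ) : ContinuousOn g E → ContDiff ℝ ∞ b →
      IsKernelFamily E fun ζ z => b z * (g ζ * kern q z ζ)
  | add (G H : Cn m → Cn m → ℂ) : IsKernelFamily E G → IsKernelFamily E H →
      IsKernelFamily E fun ζ z => G ζ z + H ζ z

namespace IsKernelFamily

theorem sum {κ : Type*} (s : Finset κ) {G : κ → Cn m → Cn m → ℂ}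
    (h : ∀ k ∈ s, IsKernelFamily E (G k)) : IsKernelFamily E fun ζ z => ∑ k ∈ s, G k ζ z := by
  classical
  induction s using Finset.induction_on with
  | empty => simpa using base (E := E) 0 0 0 continuousOn_const contDiff_const
  | insert k s hk ih =>
    simp only [Finset.sum_insert hk]
    exact add _ _ (h k (by simp)) (ih fun l hl => h l (by simp [hl]))

variable {G : Cn m → Cn m → ℂ}

theorem integrable [IsFiniteMeasure μ] (hE : IsCompact E) (hμE : ∀ᵐ ζ ∂μ, ζ ∈ E)
    (h : IsKernelFamily E G) {z : Cn m} (hz : z ∈ posSet E) :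
    Integrable (fun ζ => G ζ z) μ := by
  induction h with
  | base g b q hg hb =>
    exact (integrable_of_continuousOn hE hμE (hg.mul (continuousOn_kern q hz))).const_mul _
  | add G H _ _ ih1 ih2 => exact ih1.add ih2

theorem contDiffOn (h : IsKernelFamily E G) {ζ : Cn m} (hζ : ζ ∈ E) :
    ContDiffOn ℝ ∞ (G ζ) (posSet E) := by
  induction h with
  | base g b q hg hb =>
    exact hb.contDiffOn.mul (contDiffOn_const.mul ((contDiffOn_kern q hζ).restrict_scalars ℝ))
  | add G H _ _ ih1 ih2 => exact ih1.add ih2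

theorem contDiffOn_integral [IsFiniteMeasure μ] (hE : IsCompact E) (hES : E ⊆ Metric.sphere 0 1)
    (hμE : ∀ᵐ ζ ∂μ, ζ ∈ E) (h : IsKernelFamily E G) :
    ContDiffOn ℝ ∞ (fun z => ∫ ζ, G ζ z ∂μ) (posSet E) := by
  induction h with
  | base g b q hg hb =>
    simp only [integral_const_mul]
    exact hb.contDiffOn.mul ((contDiffOn_integral_kern hE hES hμE hg q).restrict_scalars ℝ)
  | add G H hG hH ih1 ih2 =>
    exact (ih1.add ih2).congr fun z hz =>
      integral_add (hG.integrable hE hμE hz) (hH.integrable hE hμE hz)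

theorem applyField_kern (a : Cn m → Cn m) (q : ℝ) {z ζ : Cn m} (hz : z ∈ posSet E) (hζ : ζ ∈ E) :
    applyField a (fun w => kern q w ζ) z = q * inner ℂ ζ (a z) * kern (q + 1) z ζ := by
  rw [applyField, ((hasFDerivAt_kern q hz hζ).restrictScalars ℝ).fderiv]
  simp only [ContinuousLinearMap.coe_restrictScalars', smul_apply, innerSL_apply_apply,
    smul_eq_mul]
  ring

/-- A vector field maps the class to itself, and commutes with the integration in `ζ`. -/
theorem applyField [IsFiniteMeasure μ] (hE : IsCompact E) (hES : E ⊆ Metric.sphere 0 1)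
    (hμE : ∀ᵐ ζ ∂μ, ζ ∈ E) (h : IsKernelFamily E G) {a : Cn m → Cn m} (ha : ContDiff ℝ ∞ a) :
    ∃ G', IsKernelFamily E G' ∧
      (∀ ζ ∈ E, Set.EqOn (NonIso.applyField a (G ζ)) (G' ζ) (posSet E)) ∧
      Set.EqOn (NonIso.applyField a fun z => ∫ ζ, G ζ z ∂μ) (fun z => ∫ ζ, G' ζ z ∂μ)
        (posSet E) := by
  have hU := isOpen_posSet hE hES
  induction h with
  | base g b q hg hb =>
    -- The factor a(z)·ζ̄ produced by differentiating the kernel mixes the variables; expanding it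
    -- separates them and so stays in the class.
    have hinner : ∀ (ζ y : Cn m), (inner ℂ ζ y : ℂ) = ∑ k, y k * (starRingEnd ℂ) (ζ k) := by
      intro ζ y
      simp only [PiLp.inner_apply, RCLike.inner_apply]
    have hcoef : ∀ k : Fin (m + 1),
        ContinuousOn (fun ζ : Cn m => g ζ * (q * (starRingEnd ℂ) (ζ k))) E := by
      intro k
      have : Continuous fun ζ : Cn m => (starRingEnd ℂ) (ζ k) :=
        Complex.continuous_conj.comp (by fun_prop)
      exact hg.mul (continuous_const.mul this).continuousOn
    have hfam : IsKernelFamily E fun ζ z => NonIso.applyField a b z * (g ζ * kern q z ζ) +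
        ∑ k, (b z * a z k) * ((g ζ * (q * (starRingEnd ℂ) (ζ k))) * kern (q + 1) z ζ) := by
      refine add _ _ (base g _ q hg ?_) (sum _ fun k _ => base _ _ _ (hcoef k)
        (hb.mul (contDiff_apply ha k)))
      exact contDiffOn_univ.mp (contDiffOn_applyField isOpen_univ ha hb.contDiffOn)
    refine ⟨_, hfam, fun ζ hζ z hz => ?_, fun z hz => ?_⟩
    · have hk : ContDiffOn ℝ ∞ (fun w => kern q w ζ) (posSet E) :=
        (contDiffOn_kern q hζ).restrict_scalars ℝ
      rw [applyField_mul hU a hb.contDiffOn (contDiffOn_const.mul hk) hz]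
      simp only [applyField_const_mul, applyField_kern a q hz hζ, hinner]
      rw [Finset.mul_sum, Finset.sum_mul, Finset.mul_sum, Finset.mul_sum]
      congr 1
      refine Finset.sum_congr rfl fun k _ => by ring
    · have hk := (contDiffOn_integral_kern hE hES hμE hg q).restrict_scalars ℝ
      have hd := (hasFDerivAt_integral_kern hE hES hμE hg q hz).2
      simp only [integral_const_mul]
      rw [applyField_mul hU a hb.contDiffOn hk hz]
      have h1 : NonIso.applyField a (fun w => ∫ ζ, g ζ * kern q w ζ ∂μ) z =
          ∫ ζ, (g ζ * (q * inner ℂ ζ (a z))) * kern (q + 1) z ζ ∂μ := by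
        rw [← fderiv_integral_kern_apply hE hES hμE hg q hz, NonIso.applyField,
          (hd.restrictScalars ℝ).fderiv, hd.fderiv]
        rfl
      have hint0 : Integrable (fun ζ => g ζ * kern q z ζ) μ :=
        integrable_of_continuousOn hE hμE (hg.mul (continuousOn_kern q hz))
      have hint : ∀ k : Fin (m + 1), Integrable (fun ζ => (b z * a z k) *
          ((g ζ * (q * (starRingEnd ℂ) (ζ k))) * kern (q + 1) z ζ)) μ := fun k =>
        (integrable_of_continuousOn hE hμE
          ((hcoef k).mul (continuousOn_kern (q + 1) hz))).const_mul _
      rw [integral_add (hint0.const_mul _) (integrable_finsetSum _ fun k _ => hint k),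
        integral_const_mul]
      refine congrArg _ ?_
      dsimp only
      rw [h1, ← integral_const_mul]
      congr 1
      funext ζ
      rw [hinner, Finset.mul_sum, Finset.mul_sum, Finset.sum_mul, Finset.mul_sum]
      refine Finset.sum_congr rfl fun k _ => by ring
  | add G H hG hH ih1 ih2 =>
    obtain ⟨G', hG', h1, h2⟩ := ih1
    obtain ⟨H', hH', h3, h4⟩ := ih2
    refine ⟨_, add _ _ hG' hH', fun ζ hζ z hz => ?_, fun z hz => ?_⟩
    · rw [applyField_add hU a (hG.contDiffOn hζ) (hH.contDiffOn hζ) hz]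
      exact congrArg₂ (· + ·) (h1 ζ hζ hz) (h3 ζ hζ hz)
    · have h5 : Set.EqOn (fun z => ∫ ζ, (G ζ z + H ζ z) ∂μ)
          (fun z => ∫ ζ, G ζ z ∂μ + ∫ ζ, H ζ z ∂μ) (posSet E) := fun z hz =>
        integral_add (hG.integrable hE hμE hz) (hH.integrable hE hμE hz)
      rw [applyField_congr hU a h5 hz, applyField_add hU a
        (hG.contDiffOn_integral hE hES hμE) (hH.contDiffOn_integral hE hES hμE) hz]
      exact (congrArg₂ (· + ·) (h2 hz) (h4 hz)).trans
        (integral_add (hG'.integrable hE hμE hz) (hH'.integrable hE hμE hz)).symm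

/-- The innermost field passes under the integral and leaves a family of the same class, so the
induction peels the list from the end. -/
theorem applyOp_integral [IsFiniteMeasure μ] (hE : IsCompact E) (hES : E ⊆ Metric.sphere 0 1)
    (hμE : ∀ᵐ ζ ∂μ, ζ ∈ E) (h : IsKernelFamily E G) {X : List (Cn m → Cn m)} (hX : SmoothOp X) :
    Set.EqOn (applyOp X fun z => ∫ ζ, G ζ z ∂μ) (fun z => ∫ ζ, applyOp X (G ζ) z ∂μ)
      (posSet E) := by
  have hU := isOpen_posSet hE hES
  induction X using List.reverseRecOn generalizing G with
  | nil => exact fun _ _ => rfl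
  | append_singleton X a ih =>
    intro z hz
    obtain ⟨G', hG', h1, h2⟩ := h.applyField hE hES hμE (hX a (by simp))
    simp only [applyOp_append_singleton]
    rw [applyOp_congr hU X h2 hz, ih hG' (fun b hb => hX b (by simp [hb])) hz]
    refine integral_congr_ae ?_
    filter_upwards [hμE] with ζ hζ
    exact (applyOp_congr hU X (h1 ζ hζ) hz).symm

end IsKernelFamily

end KernelIntegrals

/-! ### Size of differences of Taylor polynomials. -/

section TaylorDifference

variable {m : ℕ} {E : Set (Cn m)} {v : Cn m → Fin (m + 1) → Cn m} {α : ℝ}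

theorem wt_nonneg (j : Fin (m + 1) → ℕ) : 0 ≤ wt j := by
  unfold wt
  positivity

theorem contDiff_taylor (f : Jet m) (ζ : Cn m) : ContDiff ℂ ∞ (taylor v α f ζ) := by
  unfold taylor
  exact ContDiff.sum fun j _ => contDiff_const.mul (contDiff_monomial ζ j)

theorem contDiff_taylor_real (f : Jet m) (ζ : Cn m) : ContDiff ℝ ∞ (taylor v α f ζ) :=
  (contDiff_taylor f ζ).restrict_scalars ℝ

theorem pdist_pos_of_ne (hES : E ⊆ Metric.sphere 0 1) {ζ ξ : Cn m} (hζ : ζ ∈ E) (hξ : ξ ∈ E)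
    (hne : ζ ≠ ξ) : 0 < pdist ζ ξ := by
  have h1 := norm_sub_sq_le_pdist (norm_eq_one hES hζ).le (norm_eq_one hES hξ)
  have h2 : 0 < ‖ζ - ξ‖ := norm_pos_iff.mpr (sub_ne_zero.mpr hne)
  nlinarith

/-- Unifies both ranges of weights: for ω(k) ≤ α, the distance d(ζ, ξ) is replaced by 4d; for ω(k) >
α, the exponent of d is negative and d ≤ 2, so a bounded coefficient is absorbed. -/
theorem exists_taylor_sub_coeff (hES : E ⊆ Metric.sphere 0 1) (hv : IsFrame E v) (hα : 0 ≤ α) :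
    ∃ C : ℝ, 0 ≤ C ∧ ∀ f, MemLip E v α f → ∀ ξ ∈ E, ∀ ζ ∈ E, ∀ d : ℝ, 0 < d → d ≤ 2 →
      pdist ζ ξ ≤ 4 * d → ∃ c : (Fin (m + 1) → ℕ) → ℂ,
        (∀ z, taylor v α f ζ z - taylor v α f ξ z =
          ∑ k ∈ taylorIndices m α, c k * ∏ l, coord v z ζ l ^ k l) ∧
        ∀ k ∈ taylorIndices m α, ‖c k‖ ≤ C * lipNorm E v α f * d ^ (α - wt k) := by
  classical
  obtain ⟨C, hC, h⟩ := exists_taylor_sub_expansion hES hv α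
  have hS : ∀ k ∈ taylorIndices m α, (0 : ℝ) ≤ 2 ^ wt k := fun k _ => by positivity
  have hS0 := Finset.sum_nonneg hS
  have h4 : (0 : ℝ) ≤ 4 ^ α := by positivity
  refine ⟨C * (4 ^ α + ∑ k ∈ taylorIndices m α, 2 ^ wt k), mul_nonneg hC (add_nonneg h4 hS0),
    fun f hf ξ hξ ζ hζ d hd hd2 hle => ?_⟩
  have hL := lipNorm_nonneg (E := E) (v := v) (α := α) f
  by_cases hne : ζ = ξ
  · subst hne
    refine ⟨fun _ => 0, fun z => by simp, fun k _ => ?_⟩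
    rw [norm_zero]
    positivity
  · obtain ⟨c, hc1, hc2⟩ := h f hf ξ hξ ζ hζ (pdist_pos_of_ne hES hζ hξ hne)
    refine ⟨c, hc1, fun k hk => (hc2 k hk).trans ?_⟩
    have h2k := Finset.single_le_sum hS hk
    have key : (if wt k ≤ α then pdist ζ ξ ^ (α - wt k) else 1) ≤
        (4 ^ α + ∑ k ∈ taylorIndices m α, 2 ^ wt k) * d ^ (α - wt k) := by
      have hdα : 0 ≤ d ^ (α - wt k) := by positivity
      split_ifs with hk'
      · have hs : 0 ≤ α - wt k := sub_nonneg.mpr hk'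
        calc pdist ζ ξ ^ (α - wt k) ≤ (4 * d) ^ (α - wt k) :=
              Real.rpow_le_rpow (pdist_nonneg _ _) hle hs
          _ = 4 ^ (α - wt k) * d ^ (α - wt k) := Real.mul_rpow (by norm_num) hd.le
          _ ≤ (4 ^ α + ∑ k ∈ taylorIndices m α, 2 ^ wt k) * d ^ (α - wt k) := by
              gcongr
              have : (4 : ℝ) ^ (α - wt k) ≤ 4 ^ α :=
                Real.rpow_le_rpow_of_exponent_le (by norm_num) (by linarith [wt_nonneg k])
              linarith
      · have h1 := one_le_rpow_neg hd hd2 (s := wt k - α) (by linarith)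
        rw [neg_sub] at h1
        refine h1.trans ?_
        gcongr
        have : (2 : ℝ) ^ (wt k - α) ≤ 2 ^ wt k :=
          Real.rpow_le_rpow_of_exponent_le (by norm_num) (by linarith)
        linarith
    calc C * lipNorm E v α f * (if wt k ≤ α then pdist ζ ξ ^ (α - wt k) else 1)
        ≤ C * lipNorm E v α f *
          ((4 ^ α + ∑ k ∈ taylorIndices m α, 2 ^ wt k) * d ^ (α - wt k)) := by gcongr
      _ = _ := by ring

/-- The differences of Taylor polynomials, at points `ζ, ξ` such that `d(ζ, ξ)` is controlled by
`d(z, ζ)`, are symbols of amplitude `‖f‖ d(z, ζ)^α` and scale `d(z, ζ)`. -/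
theorem isSymbol_taylor_sub (hES : E ⊆ Metric.sphere 0 1) (hv : IsFrame E v) (hα : 0 ≤ α)
    {ι : Type*} {z ζ ξ : ι → Cn m} {f : ι → Jet m} (hf : ∀ i, MemLip E v α (f i))
    (hz : ∀ i, z i ∈ Metric.closedBall (0 : Cn m) 1 \ E) (hζ : ∀ i, ζ i ∈ E) (hξ : ∀ i, ξ i ∈ E)
    (hd : ∀ i, pdist (ζ i) (ξ i) ≤ 4 * pdist (z i) (ζ i)) (N : ℕ) :
    IsSymbol z (fun i => pdist (z i) (ζ i)) N
      (fun i => lipNorm E v α (f i) * pdist (z i) (ζ i) ^ α)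
      fun i w => taylor v α (f i) (ζ i) w - taylor v α (f i) (ξ i) w := by
  have hpos : ∀ i, 0 < pdist (z i) (ζ i) := fun i => pdist_pos (subset_posSet hES (hz i)) (hζ i)
  obtain ⟨C, hC, h⟩ := exists_taylor_sub_coeff (α := α) hES hv hα
  choose c hc1 hc2 using fun i => h (f i) (hf i) (ξ i) (hξ i) (ζ i) (hζ i) _ (hpos i)
    (pdist_le_two (norm_le_one (hz i)) (norm_eq_one hES (hζ i)).le) (hd i)
  have hterm : ∀ k ∈ taylorIndices m α, IsSymbol z (fun i => pdist (z i) (ζ i)) N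
      (fun i => lipNorm E v α (f i) * pdist (z i) (ζ i) ^ α)
      fun i w => c i k * ∏ l, coord v w (ζ i) l ^ k l := by
    intro k hk
    -- The coefficient d^(α − ω(k)) and the monomial d^(ω(k)) combine to d^α for every k, including
    -- the weights above α.
    refine ((isSymbol_monomial hES hv hz hζ k N).const_mul fun i => hc2 i k hk).mono hpos hC
      fun i => le_of_eq ?_
    rw [mul_assoc, ← Real.rpow_add (hpos i), sub_add_cancel, mul_assoc]
  refine (IsSymbol.sum isOpen_univ (fun i => Set.mem_univ (z i)) hpos _ (fun k _ i =>
    (contDiff_const.mul (contDiff_monomial_real (ζ i) k)).contDiffOn) hterm).congr isOpen_univ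
    (fun i => Set.mem_univ (z i)) fun i w _ => (hc1 i w).symm

/-- The Taylor polynomials have derivatives bounded by `‖f‖` on the closed ball. -/
theorem isSymbol_taylor_one (hES : E ⊆ Metric.sphere 0 1) (hv : IsFrame E v)
    {ι : Type*} {z ξ : ι → Cn m} {f : ι → Jet m} (hf : ∀ i, MemLip E v α (f i))
    (hz : ∀ i, ‖z i‖ ≤ 1) (hξ : ∀ i, ξ i ∈ E) (N : ℕ) :
    IsSymbol z (fun _ => 1) N (fun i => lipNorm E v α (f i)) fun i => taylor v α (f i) (ξ i) := by
  have hterm : ∀ j ∈ indices m α, IsSymbol z (fun _ => 1) N (fun i => lipNorm E v α (f i))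
      fun i w => (∏ l, ((j l).factorial : ℂ))⁻¹ * f i j (ξ i) * ∏ l, coord v w (ξ i) l ^ j l := by
    intro j hj
    have h1 := (isSymbol_monomial_one hES hv hz hξ j N).const_mul
      (c := fun i => (∏ l, ((j l).factorial : ℂ))⁻¹ * f i j (ξ i))
      (A := fun i => ‖(∏ l, ((j l).factorial : ℂ))⁻¹‖ * lipNorm E v α (f i)) fun i => by
        rw [norm_mul]
        exact mul_le_mul_of_nonneg_left ((hf i).norm_jet_le hj (hξ i)) (norm_nonneg _)
    exact h1.mono (fun _ => one_pos) (norm_nonneg _) fun i => le_of_eq (mul_one _)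
  exact IsSymbol.sum isOpen_univ (fun i => Set.mem_univ (z i)) (fun _ => one_pos) _ (fun k _ i =>
    (contDiff_const.mul (contDiff_monomial_real (ξ i) k)).contDiffOn) hterm

end TaylorDifference

/-! ### The extension operator and its comparison with Taylor polynomials. -/

section Extension

variable {m : ℕ} {E : Set (Cn m)} {α υ q : ℝ} {μ : Measure (Cn m)}
  {v : Cn m → Fin (m + 1) → Cn m}

theorem pdist_le_of_nearest (hES : E ⊆ Metric.sphere 0 1) {z ζ ξ : Cn m} (hz : ‖z‖ ≤ 1)
    (hζ : ζ ∈ E) (hξ : ξ ∈ E) (h : pdist z ξ = pdistSet z E) :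
    pdist ζ ξ ≤ 4 * pdist z ζ := by
  have h1 := pdist_triangle (norm_eq_one hES hζ).le hz (norm_eq_one hES hξ).le
  have h2 := pdistSet_le (z := z) hζ
  rw [pdist_comm ζ z] at h1
  linarith

/-- Integration in `ζ` of symbols of amplitude `A d(z, ζ)^(-s)` and scale `d(z, ζ)`, for `s > υ`. -/
theorem isSymbol_integral (hE : IsCompact E) (hES : E ⊆ Metric.sphere 0 1) (hμ : MemU E υ μ)
    {ι : Type*} {z ξ : ι → Cn m} {A : ι → ℝ} {s : ℝ} {G : ι → Cn m → Cn m → ℂ}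
    (hz : ∀ i, z i ∈ Metric.closedBall (0 : Cn m) 1 \ E) (hξ : ∀ i, ξ i ∈ E)
    (hnear : ∀ i, pdist (z i) (ξ i) = pdistSet (z i) E) (hA : ∀ i, 0 ≤ A i) (hs : υ < s)
    (hG : ∀ i, IsKernelFamily E (G i))
    (h : ∀ N, IsSymbol (fun p : ι × E => z p.1) (fun p => pdist (z p.1) p.2) N
      (fun p => A p.1 * pdist (z p.1) p.2 ^ (-s)) fun p => G p.1 p.2) (N : ℕ) :
    IsSymbol z (fun i => pdistSet (z i) E) N
      (fun i => A i * pdistSet (z i) E ^ (-s) * μ.real (pball (ξ i) (3 * pdistSet (z i) E)))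
      fun i w => ∫ ζ, G i ζ w ∂μ := by
  have := hμ.prob
  have hU : ∀ i, z i ∈ posSet E := fun i => subset_posSet hES (hz i)
  have hδ : ∀ i, 0 < pdistSet (z i) E := fun i => hnear i ▸ pdist_pos (hU i) (hξ i)
  refine IsSymbol.of_applyOp_bound hδ (fun X hX => ?_) N
  obtain ⟨C, hC, h1⟩ := IsSymbol.applyOp_bound h (fun p => pdist_pos (hU p.1) p.2.2) hX
  have hω := opWeight_nonneg X
  -- Differentiation only raises the exponent, so it stays above υ. This also converts the scale
  -- d(z, ζ) into d(z, E).
  obtain ⟨C', hC', h2⟩ := hμ.norm_integral_le hE hES (p := s + opWeight X) (by linarith)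
  refine ⟨C' * C, mul_nonneg hC' hC, fun i => ?_⟩
  rw [(hG i).applyOp_integral hE hES hμ.ae_mem hX (hU i)]
  refine (h2 (z i) (norm_le_one (hz i)) _ (hδ i) (ξ i) (hξ i) (hnear i).le
    (fun ζ hζ => pdistSet_le hζ) (C * A i) (fun ζ => applyOp X (G i ζ) (z i))
    (mul_nonneg hC (hA i)) fun ζ hζ => ?_).trans (le_of_eq ?_)
  · refine (h1 (i, ⟨ζ, hζ⟩)).trans (le_of_eq ?_)
    rw [neg_add, Real.rpow_add (pdist_pos (hU i) hζ)]
    ring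
  · rw [neg_add, Real.rpow_add (hδ i)]
    ring

/-- The points near which the extension is defined and smooth. -/
def extDomain (E : Set (Cn m)) (μ : Measure (Cn m)) (q : ℝ) : Set (Cn m) :=
  {z ∈ posSet E | hq μ q z ≠ 0}

theorem contDiffOn_hq [IsFiniteMeasure μ] (hE : IsCompact E) (hES : E ⊆ Metric.sphere 0 1)
    (hμE : ∀ᵐ ζ ∂μ, ζ ∈ E) (q : ℝ) : ContDiffOn ℂ ∞ (hq μ q) (posSet E) := by
  have h := contDiffOn_integral_kern hE hES hμE (g := fun _ => 1) continuousOn_const q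
  simp only [one_mul] at h
  exact h

theorem isOpen_extDomain [IsFiniteMeasure μ] (hE : IsCompact E) (hES : E ⊆ Metric.sphere 0 1)
    (hμE : ∀ᵐ ζ ∂μ, ζ ∈ E) (q : ℝ) : IsOpen (extDomain E μ q) :=
  (contDiffOn_hq hE hES hμE q).continuousOn.isOpen_inter_preimage (isOpen_posSet hE hES)
    isOpen_compl_singleton

theorem extDomain_subset : extDomain E μ q ⊆ posSet E := fun _ h => h.1

theorem subset_extDomain (hES : E ⊆ Metric.sphere 0 1) (hμ : MemU E υ μ)
    (hlow : LowerBound E μ q) :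
    Metric.closedBall (0 : Cn m) 1 \ E ⊆ extDomain E μ q := by
  obtain ⟨c, hc, h⟩ := hlow
  intro z hz
  refine ⟨subset_posSet hES hz, fun h0 => ?_⟩
  obtain ⟨ξ, hξ, hnear, hle⟩ := h z hz
  have hδ : 0 < pdistSet z E := hnear ▸ pdist_pos (subset_posSet hES hz) hξ
  have hM := hμ.pball_pos hES hξ (r := 3 * pdistSet z E) (by positivity)
  rw [h0, norm_zero] at hle
  have : 0 < c * pdistSet z E ^ (-q) * μ.real (pball ξ (3 * pdistSet z E)) := by positivity
  linarith

theorem isKernelFamily_kern (E : Set (Cn m)) (q : ℝ) :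
    IsKernelFamily E fun ζ z => kern q z ζ := by
  simpa only [Pi.one_apply, one_mul] using
    IsKernelFamily.base (E := E) 1 1 q continuousOn_const contDiff_const

/-- The families `T_ζ f(z) (1 - z ζ̄)^(-q)`. -/
theorem MemLip.isKernelFamily {f : Jet m} (hf : MemLip E v α f) (q : ℝ) :
    IsKernelFamily E fun ζ z => taylor v α f ζ z * kern q z ζ := by
  obtain ⟨n, Q, hQ, h⟩ := exists_taylor_eq_sum (E := E) v α
  obtain ⟨g, hg, hfg⟩ := h f hf
  have h1 : (fun ζ z => taylor v α f ζ z * kern q z ζ) =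
      fun ζ z => ∑ l, Q l z * (g l ζ * kern q z ζ) := by
    funext ζ z
    rw [hfg, Finset.sum_mul]
    exact Finset.sum_congr rfl fun l _ => by ring
  rw [h1]
  exact IsKernelFamily.sum _ fun l _ =>
    IsKernelFamily.base _ _ q (hg l) ((hQ l).restrict_scalars ℝ)

theorem MemLip.isKernelFamily_sub {f : Jet m} (hf : MemLip E v α f) (q : ℝ) (ξ : Cn m) :
    IsKernelFamily E fun ζ z => (taylor v α f ζ z - taylor v α f ξ z) * kern q z ζ := by
  have h := IsKernelFamily.add _ _ (hf.isKernelFamily q)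
    (IsKernelFamily.base (E := E) (fun _ => -1) (taylor v α f ξ) q continuousOn_const
      (contDiff_taylor_real f ξ))
  convert h using 3
  ring

theorem MemLip.integrable_applyOp [IsFiniteMeasure μ] (hE : IsCompact E)
    (hμE : ∀ᵐ ζ ∂μ, ζ ∈ E) {f : Jet m} (hf : MemLip E v α f) {X : List (Cn m → Cn m)}
    (hX : SmoothOp X) (q : ℝ) {z : Cn m} (hz : z ∈ posSet E) :
    Integrable (fun ζ => applyOp X (taylor v α f ζ) z * kern q z ζ) μ := by
  obtain ⟨n, Q, hQ, h⟩ := exists_taylor_eq_sum (E := E) v α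
  obtain ⟨g, hg, hfg⟩ := h f hf
  have h1 : ∀ ζ, applyOp X (taylor v α f ζ) z = ∑ l, g l ζ * applyOp X (Q l) z := by
    intro ζ
    have h2 : taylor v α f ζ = fun z => ∑ l, g l ζ * Q l z := funext fun z => hfg ζ z
    rw [h2, applyOp_sum isOpen_univ hX _ (fun l _ =>
      (contDiff_const.mul ((hQ l).restrict_scalars ℝ)).contDiffOn) (Set.mem_univ z)]
    simp only [applyOp_const_mul]
  simp only [h1]
  refine integrable_of_continuousOn hE hμE (ContinuousOn.mul ?_ (continuousOn_kern q hz))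
  exact continuousOn_finsetSum _ fun l _ => (hg l).mul continuousOn_const

theorem contDiffOn_extOperator [IsFiniteMeasure μ] (hE : IsCompact E)
    (hES : E ⊆ Metric.sphere 0 1) (hμE : ∀ᵐ ζ ∂μ, ζ ∈ E) {f : Jet m} (hf : MemLip E v α f)
    (q : ℝ) : ContDiffOn ℂ ∞ (extOperator μ q v α f) (extDomain E μ q) := by
  obtain ⟨n, Q, hQ, h⟩ := exists_taylor_eq_sum (E := E) v α
  obtain ⟨g, hg, hfg⟩ := h f hf
  have h1 : Set.EqOn (extOperator μ q v α f)
      (fun z => (hq μ q z)⁻¹ * ∑ l, Q l z * ∫ ζ, g l ζ * kern q z ζ ∂μ) (extDomain E μ q) := by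
    intro z hz
    simp only [extOperator, mean, hfg, Finset.sum_mul]
    congr 1
    rw [integral_finsetSum]
    · refine Finset.sum_congr rfl fun l _ => ?_
      rw [← integral_const_mul]
      congr 1
      funext ζ
      ring
    · intro l _
      exact integrable_of_continuousOn hE hμE
        (((hg l).mul continuousOn_const).mul (continuousOn_kern q hz.1))
  refine ContDiffOn.congr ?_ h1
  refine (((contDiffOn_hq hE hES hμE q).mono extDomain_subset).inv fun z hz => hz.2).mul ?_
  exact ContDiffOn.sum fun l _ => (hQ l).contDiffOn.mul
    ((contDiffOn_integral_kern hE hES hμE (hg l) q).mono extDomain_subset)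

/-- The extension differs from a Taylor polynomial by the mean of the differences. -/
theorem extOperator_eq [IsFiniteMeasure μ] (hE : IsCompact E) (hμE : ∀ᵐ ζ ∂μ, ζ ∈ E) {f : Jet m}
    (hf : MemLip E v α f) (ξ : Cn m) :
    Set.EqOn (extOperator μ q v α f) (fun z => taylor v α f ξ z +
      (hq μ q z)⁻¹ * ∫ ζ, (taylor v α f ζ z - taylor v α f ξ z) * kern q z ζ ∂μ)
      (extDomain E μ q) := by
  intro z hz
  simp only [extOperator, mean, sub_mul]
  rw [integral_sub ((hf.isKernelFamily q).integrable hE hμE hz.1)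
    (((isKernelFamily_kern E q).integrable hE hμE hz.1).const_mul _), integral_const_mul]
  have h0 := hz.2
  unfold hq at h0 ⊢
  field_simp
  ring

/-- `ξ` is a point of `E` nearest to `z`, at which the lower bound for `h_q(z)` holds. -/
structure LowerBoundAt (E : Set (Cn m)) (μ : Measure (Cn m)) (q c : ℝ) (z ξ : Cn m) : Prop where
  mem : ξ ∈ E
  nearest : pdist z ξ = pdistSet z E
  le : c * (pdistSet z E ^ (-q) * μ.real (pball ξ (3 * pdistSet z E))) ≤ ‖hq μ q z‖

theorem LowerBound.exists_lowerBoundAt (hlow : LowerBound E μ q) :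
    ∃ c : ℝ, 0 < c ∧ ∀ z ∈ Metric.closedBall (0 : Cn m) 1 \ E, ∃ ξ, LowerBoundAt E μ q c z ξ := by
  obtain ⟨c, hc, h⟩ := hlow
  refine ⟨c, hc, fun z hz => ?_⟩
  obtain ⟨ξ, h1, h2, h3⟩ := h z hz
  exact ⟨ξ, h1, h2, by rwa [← mul_assoc]⟩

theorem LowerBoundAt.pdistSet_pos (hES : E ⊆ Metric.sphere 0 1) {c : ℝ} {z ξ : Cn m}
    (hz : z ∈ Metric.closedBall (0 : Cn m) 1 \ E) (h : LowerBoundAt E μ q c z ξ) :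
    0 < pdistSet z E :=
  h.nearest ▸ pdist_pos (subset_posSet hES hz) h.mem

theorem LowerBoundAt.amplitude_pos (hES : E ⊆ Metric.sphere 0 1) (hμ : MemU E υ μ) {c : ℝ}
    {z ξ : Cn m} (hz : z ∈ Metric.closedBall (0 : Cn m) 1 \ E) (h : LowerBoundAt E μ q c z ξ) :
    0 < pdistSet z E ^ (-q) * μ.real (pball ξ (3 * pdistSet z E)) := by
  have h1 := h.pdistSet_pos hES hz
  have h2 := hμ.pball_pos hES h.mem (mul_pos three_pos h1)
  positivity

/-- Upper bounds for h_q and its derivatives come from integrating the kernel. The assumed lower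
bound has the same amplitude δ^(-q) μ(B_z), so the inverse is a symbol. -/
theorem isSymbol_hq_inv (hE : IsCompact E) (hES : E ⊆ Metric.sphere 0 1) (hμ : MemU E υ μ)
    (hqυ : υ < q) (hlow : LowerBound E μ q) {c : ℝ} (hc : 0 < c) {ι : Type*} {z ξ : ι → Cn m}
    (hz : ∀ i, z i ∈ Metric.closedBall (0 : Cn m) 1 \ E)
    (hlo : ∀ i, LowerBoundAt E μ q c (z i) (ξ i)) (N : ℕ) :
    IsSymbol z (fun i => pdistSet (z i) E) N
      (fun i => (pdistSet (z i) E ^ (-q) * μ.real (pball (ξ i) (3 * pdistSet (z i) E)))⁻¹)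
      fun _ w => (hq μ q w)⁻¹ := by
  have := hμ.prob
  have hVsub := subset_extDomain hES hμ hlow
  have hh := isSymbol_integral hE hES hμ (A := fun _ => 1) hz (fun i => (hlo i).mem)
    (fun i => (hlo i).nearest) (fun _ => zero_le_one) hqυ (fun _ => isKernelFamily_kern E q)
    (fun N => by
      simpa only [one_mul] using
        isSymbol_kern hE hES (fun p : ι × E => hz p.1) (fun p => p.2.2) q N) N
  simp only [one_mul] at hh
  exact hh.inv (isOpen_extDomain hE hES hμ.ae_mem q) (fun i => hVsub (hz i))
    (fun i => (hlo i).pdistSet_pos hES (hz i))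
    (fun _ => ((contDiffOn_hq hE hES hμ.ae_mem q).restrict_scalars ℝ).mono extDomain_subset)
    (fun _ w hw => hw.2) hc (fun i => (hlo i).amplitude_pos hES hμ (hz i)) fun i => (hlo i).le

/-- The difference contributes d(z, ζ)^α and the kernel d(z, ζ)^(-q). The resulting exponent q − α
exceeds υ, as the integration requires. -/
theorem isSymbol_integral_taylor_sub (hE : IsCompact E) (hES : E ⊆ Metric.sphere 0 1)
    (hα : 0 ≤ α) (hμ : MemU E υ μ) (hqα : α + υ < q) (hv : IsFrame E v) {ι : Type*}
    {z ξ : ι → Cn m} {f : ι → Jet m} (hf : ∀ i, MemLip E v α (f i))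
    (hz : ∀ i, z i ∈ Metric.closedBall (0 : Cn m) 1 \ E) (hξ : ∀ i, ξ i ∈ E)
    (hnear : ∀ i, pdist (z i) (ξ i) = pdistSet (z i) E) (N : ℕ) :
    IsSymbol z (fun i => pdistSet (z i) E) N
      (fun i => lipNorm E v α (f i) * pdistSet (z i) E ^ (-(q - α)) *
        μ.real (pball (ξ i) (3 * pdistSet (z i) E)))
      fun i w => ∫ ζ, (taylor v α (f i) ζ w - taylor v α (f i) (ξ i) w) * kern q w ζ ∂μ := by
  have hpos : ∀ p : ι × E, 0 < pdist (z p.1) p.2 := fun p =>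
    pdist_pos (subset_posSet hES (hz p.1)) p.2.2
  have hU : ∀ p : ι × E, z p.1 ∈ posSet E := fun p => subset_posSet hES (hz p.1)
  have hd : ∀ p : ι × E, pdist (p.2 : Cn m) (ξ p.1) ≤ 4 * pdist (z p.1) p.2 := fun p =>
    pdist_le_of_nearest hES (norm_le_one (hz p.1)) p.2.2 (hξ p.1) (hnear p.1)
  have key : ∀ N, IsSymbol (fun p : ι × E => z p.1) (fun p => pdist (z p.1) p.2) N
      (fun p => lipNorm E v α (f p.1) * pdist (z p.1) p.2 ^ (-(q - α)))
      fun p w => (taylor v α (f p.1) p.2 w - taylor v α (f p.1) (ξ p.1) w) * kern q w p.2 := by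
    intro N
    have hdiff : IsSymbol (fun p : ι × E => z p.1) (fun p => pdist (z p.1) p.2) N
        (fun p => lipNorm E v α (f p.1) * pdist (z p.1) p.2 ^ α)
        fun p w => taylor v α (f p.1) p.2 w - taylor v α (f p.1) (ξ p.1) w :=
      isSymbol_taylor_sub (f := fun p : ι × E => f p.1) (z := fun p : ι × E => z p.1)
        (ζ := fun p : ι × E => p.2) (ξ := fun p : ι × E => ξ p.1) hES hv hα
        (fun p : ι × E => hf p.1) (fun p : ι × E => hz p.1) (fun p : ι × E => p.2.2)
        (fun p : ι × E => hξ p.1) hd N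
    have hkern : IsSymbol (fun p : ι × E => z p.1) (fun p => pdist (z p.1) p.2) N
        (fun p => pdist (z p.1) p.2 ^ (-q)) fun p w => kern q w p.2 :=
      isSymbol_kern hE hES (fun p : ι × E => hz p.1) (fun p : ι × E => p.2.2) q N
    refine (hdiff.mul (isOpen_posSet hE hES) hU hpos
      (fun p => ((contDiff_taylor_real _ _).sub (contDiff_taylor_real _ _)).contDiffOn)
      (fun p => (contDiffOn_kern q p.2.2).restrict_scalars ℝ) hkern).mono hpos zero_le_one
      fun p => le_of_eq ?_
    rw [one_mul, mul_assoc, ← Real.rpow_add (hpos p)]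
    ring_nf
  exact isSymbol_integral (A := fun i => lipNorm E v α (f i)) (s := q - α)
    (G := fun i ζ w => (taylor v α (f i) ζ w - taylor v α (f i) (ξ i) w) * kern q w ζ)
    hE hES hμ hz hξ hnear (fun i => lipNorm_nonneg _) (by linarith)
    (fun i => (hf i).isKernelFamily_sub q (ξ i)) key N

theorem inv_amplitude_mul {δ M L : ℝ} (hδ : 0 < δ) (hM : 0 < δ ^ (-q) * M) (s : ℝ) :
    (δ ^ (-q) * M)⁻¹ * (L * δ ^ (-(q - s)) * M) = L * δ ^ s := by
  have h1 : δ ^ (-(q - s)) = δ ^ (-q) * δ ^ s := by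
    rw [← Real.rpow_add hδ]
    ring_nf
  rw [h1]
  rw [inv_mul_eq_div, div_eq_iff hM.ne']
  ring

/-- The fundamental estimate: near `z`, the extension is close to the Taylor polynomial at a point
of `E` nearest to `z`. -/
theorem exists_applyOp_extOperator_sub_le (hE : IsCompact E) (hES : E ⊆ Metric.sphere 0 1)
    (hα : 0 ≤ α) (hμ : MemU E υ μ) (hqα : α + υ < q) (hv : IsFrame E v)
    (hlow : LowerBound E μ q) {c : ℝ} (hc : 0 < c) {X : List (Cn m → Cn m)} (hX : SmoothOp X) :
    ∃ C : ℝ, 0 ≤ C ∧ ∀ f, MemLip E v α f → ∀ z ∈ Metric.closedBall (0 : Cn m) 1 \ E,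
      ∀ ξ, LowerBoundAt E μ q c z ξ →
        ‖applyOp X (extOperator μ q v α f) z - applyOp X (taylor v α f ξ) z‖ ≤
          C * (lipNorm E v α f * pdistSet z E ^ (α - opWeight X)) := by
  have := hμ.prob
  have hμE := hμ.ae_mem
  have hV : IsOpen (extDomain E μ q) := isOpen_extDomain hE hES hμE q
  have hVsub := subset_extDomain hES hμ hlow
  have hhinv : ContDiffOn ℝ ∞ (fun w => (hq μ q w)⁻¹) (extDomain E μ q) :=
    (((contDiffOn_hq hE hES hμE q).restrict_scalars ℝ).mono extDomain_subset).inv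
      fun w hw => hw.2
  have hυ := hμ.exponent_nonneg hES
  -- Indexing by all admissible triples (f, z, ξ) makes the symbol constants independent of them.
  let I := {p : Jet m × Cn m × Cn m // MemLip E v α p.1 ∧
    p.2.1 ∈ Metric.closedBall (0 : Cn m) 1 \ E ∧ LowerBoundAt E μ q c p.2.1 p.2.2}
  have hδ : ∀ i : I, 0 < pdistSet i.1.2.1 E := fun i => i.2.2.2.pdistSet_pos hES i.2.2.1
  have hJsmooth : ∀ i : I, ContDiffOn ℝ ∞ (fun w => ∫ ζ, (taylor v α i.1.1 ζ w -
      taylor v α i.1.1 i.1.2.2 w) * kern q w ζ ∂μ) (extDomain E μ q) := fun i =>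
    ((i.2.1.isKernelFamily_sub q i.1.2.2).contDiffOn_integral hE hES hμE).mono extDomain_subset
  have hR : ∀ N, IsSymbol (fun i : I => i.1.2.1) (fun i => pdistSet i.1.2.1 E) N
      (fun i => lipNorm E v α i.1.1 * pdistSet i.1.2.1 E ^ α) fun i w => (hq μ q w)⁻¹ *
      ∫ ζ, (taylor v α i.1.1 ζ w - taylor v α i.1.1 i.1.2.2 w) * kern q w ζ ∂μ := by
    intro N
    have h1 := isSymbol_hq_inv hE hES hμ (by linarith) hlow hc (fun i : I => i.2.2.1)
      (fun i => i.2.2.2) N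
    have h2 := isSymbol_integral_taylor_sub hE hES hα hμ hqα hv (fun i : I => i.2.1)
      (fun i => i.2.2.1) (fun i => i.2.2.2.mem) (fun i => i.2.2.2.nearest) N
    refine (h1.mul hV (fun i => hVsub i.2.2.1) hδ (fun _ => hhinv) hJsmooth h2).mono hδ zero_le_one
      fun i => le_of_eq ?_
    rw [one_mul, inv_amplitude_mul (hδ i) (i.2.2.2.amplitude_pos hES hμ i.2.2.1)]
  obtain ⟨C, hC, h⟩ := IsSymbol.applyOp_bound hR hδ hX
  refine ⟨C, hC, fun f hf z hz ξ hξ => ?_⟩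
  have hzV := hVsub hz
  have h5 : applyOp X (extOperator μ q v α f) z = applyOp X (taylor v α f ξ) z +
      applyOp X (fun w => (hq μ q w)⁻¹ *
        ∫ ζ, (taylor v α f ζ w - taylor v α f ξ w) * kern q w ζ ∂μ) z := by
    rw [applyOp_congr hV X (extOperator_eq hE hμE hf ξ) hzV]
    exact applyOp_add hV hX (contDiff_taylor_real f ξ).contDiffOn
      (hhinv.mul (hJsmooth ⟨(f, z, ξ), hf, hz, hξ⟩)) hzV
  rw [h5, add_sub_cancel_left]
  refine (h ⟨(f, z, ξ), hf, hz, hξ⟩).trans (le_of_eq ?_)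
  rw [mul_assoc (lipNorm E v α f), ← Real.rpow_add (hδ ⟨(f, z, ξ), hf, hz, hξ⟩), ← sub_eq_add_neg]

/-- The difference of two Taylor polynomials, one of which is at a nearest point. -/
theorem exists_applyOp_taylor_sub_le (hES : E ⊆ Metric.sphere 0 1) (hα : 0 ≤ α)
    (hv : IsFrame E v) {X : List (Cn m → Cn m)} (hX : SmoothOp X) :
    ∃ C : ℝ, 0 ≤ C ∧ ∀ f, MemLip E v α f → ∀ z ∈ Metric.closedBall (0 : Cn m) 1 \ E,
      ∀ ξ ∈ E, pdist z ξ = pdistSet z E → ∀ ζ ∈ E,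
        ‖applyOp X (taylor v α f ζ) z - applyOp X (taylor v α f ξ) z‖ ≤
          C * (lipNorm E v α f * pdist z ζ ^ (α - opWeight X)) := by
  let I := {p : Jet m × Cn m × Cn m × Cn m // MemLip E v α p.1 ∧
    p.2.1 ∈ Metric.closedBall (0 : Cn m) 1 \ E ∧ p.2.2.1 ∈ E ∧
    pdist p.2.1 p.2.2.1 = pdistSet p.2.1 E ∧ p.2.2.2 ∈ E}
  have hpos : ∀ i : I, 0 < pdist i.1.2.1 i.1.2.2.2 := fun i =>
    pdist_pos (subset_posSet hES i.2.2.1) i.2.2.2.2.2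
  obtain ⟨C, hC, h⟩ := IsSymbol.applyOp_bound (fun N => isSymbol_taylor_sub hES hv hα
    (fun i : I => i.2.1) (fun i => i.2.2.1) (fun i => i.2.2.2.2.2) (fun i => i.2.2.2.1)
    (fun i => pdist_le_of_nearest hES (norm_le_one i.2.2.1) i.2.2.2.2.2 i.2.2.2.1 i.2.2.2.2.1) N)
    hpos hX
  refine ⟨C, hC, fun f hf z hz ξ hξ hnear ζ hζ => ?_⟩
  have h1 := h ⟨(f, z, ξ, ζ), hf, hz, hξ, hnear, hζ⟩
  have h2 := applyOp_sub isOpen_univ hX (contDiff_taylor_real (v := v) (α := α) f ζ).contDiffOn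
    (contDiff_taylor_real (v := v) (α := α) f ξ).contDiffOn (Set.mem_univ z)
  dsimp only at h1 h2
  rw [h2] at h1
  refine h1.trans (le_of_eq ?_)
  rw [mul_assoc (lipNorm E v α f), ← Real.rpow_add (hpos ⟨(f, z, ξ, ζ), hf, hz, hξ, hnear, hζ⟩),
    ← sub_eq_add_neg]

/-- No derivative falls on the kernel or on h_q here: the pointwise bound d(z, ζ)^(α − ω) for 𝕏(T_ζ
f − T_ξ f) is integrated against the kernel, then divided by h_q. -/
theorem exists_extDeriv_sub_le (hE : IsCompact E) (hES : E ⊆ Metric.sphere 0 1)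
    (hα : 0 ≤ α) (hμ : MemU E υ μ) (hqα : α + υ < q) (hv : IsFrame E v)
    (hlow : LowerBound E μ q) {c : ℝ} (hc : 0 < c) {X : List (Cn m → Cn m)} (hX : SmoothOp X) :
    ∃ C : ℝ, 0 ≤ C ∧ ∀ f, MemLip E v α f → ∀ z ∈ Metric.closedBall (0 : Cn m) 1 \ E,
      ∀ ξ, LowerBoundAt E μ q c z ξ →
        ‖extDeriv μ q v α X f z - applyOp X (taylor v α f ξ) z‖ ≤
          C * (lipNorm E v α f * pdistSet z E ^ (α - opWeight X)) := by
  have := hμ.prob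
  have hμE := hμ.ae_mem
  have hω := opWeight_nonneg X
  obtain ⟨C₁, hC₁, h1⟩ := exists_applyOp_taylor_sub_le hES hα hv hX
  obtain ⟨C₂, hC₂, h2⟩ := hμ.norm_integral_le hE hES (p := q - (α - opWeight X)) (by linarith)
  refine ⟨c⁻¹ * (C₂ * C₁), by positivity, fun f hf z hz ξ hξ => ?_⟩
  have hU := subset_posSet hES hz
  have hδ := hξ.pdistSet_pos hES hz
  have hM := hξ.amplitude_pos hES hμ hz
  have hL := lipNorm_nonneg (E := E) (v := v) (α := α) f
  have hint := hf.integrable_applyOp hE hμE hX q hU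
  have hintk := (isKernelFamily_kern E q).integrable hE hμE hU
  have h0 : hq μ q z ≠ 0 := (subset_extDomain hES hμ hlow hz).2
  have h5 : extDeriv μ q v α X f z - applyOp X (taylor v α f ξ) z = (hq μ q z)⁻¹ *
      ∫ ζ, (applyOp X (taylor v α f ζ) z - applyOp X (taylor v α f ξ) z) * kern q z ζ ∂μ := by
    simp only [sub_mul]
    rw [integral_sub hint (hintk.const_mul _), integral_const_mul, mul_sub]
    have h7 : ∫ ζ, kern q z ζ ∂μ = hq μ q z := rfl
    rw [h7, extDeriv, mean]
    field_simp
  have h6 := h2 z (norm_le_one hz) _ hδ ξ hξ.mem hξ.nearest.le (fun ζ hζ => pdistSet_le hζ)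
    (C₁ * lipNorm E v α f)
    (fun ζ => (applyOp X (taylor v α f ζ) z - applyOp X (taylor v α f ξ) z) * kern q z ζ)
    (mul_nonneg hC₁ hL) fun ζ hζ => by
      rw [norm_mul, norm_kern]
      refine (mul_le_mul_of_nonneg_right (h1 f hf z hz ξ hξ.mem hξ.nearest ζ hζ)
        (Real.rpow_nonneg (pdist_nonneg _ _) _)).trans (le_of_eq ?_)
      rw [← mul_assoc, mul_assoc, ← Real.rpow_add (pdist_pos hU hζ)]
      ring_nf
  have h7 : ‖hq μ q z‖⁻¹ ≤
      c⁻¹ * (pdistSet z E ^ (-q) * μ.real (pball ξ (3 * pdistSet z E)))⁻¹ := by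
    rw [← mul_inv]
    exact inv_anti₀ (mul_pos hc hM) hξ.le
  rw [h5, norm_mul, norm_inv]
  refine (mul_le_mul h7 h6 (norm_nonneg _) (by positivity)).trans (le_of_eq ?_)
  have h8 := inv_amplitude_mul (L := lipNorm E v α f) hδ hM (α - opWeight X)
  rw [← h8]
  ring

end Extension

/-! ### From gradient growth to Hölder continuity. -/

section HardyLittlewood

variable {V W : Type*} [NormedAddCommGroup V] [NormedSpace ℝ V] [NormedAddCommGroup W]
  [NormedSpace ℝ W] {H : V → W} {K γ : ℝ}

/-- Along t ↦ (1 − t)z the distance to the sphere is η + t|z| with η = 1 − |z|, and the gradient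
bound has primitive (K/γ)(η + t|z|)^γ. Subadditivity of the γ-th power removes η. -/
theorem norm_sub_radial_le (hγ0 : 0 < γ) (hγ1 : γ ≤ 1) (hK : 0 ≤ K)
    (hH : ∀ z ∈ Metric.ball (0 : V) 1, DifferentiableAt ℝ H z)
    (hb : ∀ z ∈ Metric.ball (0 : V) 1, ‖fderiv ℝ H z‖ ≤ K * (1 - ‖z‖) ^ (γ - 1))
    {z : V} (hz : z ∈ Metric.ball (0 : V) 1) {s : ℝ} (hs0 : 0 ≤ s) (hs1 : s ≤ 1) :
    ‖H ((1 - s) • z) - H z‖ ≤ K / γ * s ^ γ := by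
  have hz1 : ‖z‖ < 1 := by simpa using hz
  set η := 1 - ‖z‖ with hη
  have hη0 : 0 < η := by linarith
  have hmem : ∀ t ∈ Set.Icc (0 : ℝ) s, (1 - t) • z ∈ Metric.ball (0 : V) 1 := by
    intro t ht
    rw [mem_ball_zero_iff, norm_smul, Real.norm_of_nonneg (by linarith [ht.2])]
    nlinarith [norm_nonneg z, ht.1]
  have hder : ∀ t ∈ Set.Icc (0 : ℝ) s, HasDerivAt (fun t : ℝ => H ((1 - t) • z) - H z)
      (fderiv ℝ H ((1 - t) • z) ((-1 : ℝ) • z)) t := by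
    intro t ht
    have h1 : HasDerivAt (fun t : ℝ => (1 - t) • z) ((-1 : ℝ) • z) t :=
      ((hasDerivAt_id t).const_sub 1).smul_const z
    exact ((hH _ (hmem t ht)).hasFDerivAt.comp_hasDerivAt t h1).sub_const _
  have hpos : ∀ t ∈ Set.Icc (0 : ℝ) s, 0 < η + t * ‖z‖ := fun t ht => by
    have := mul_nonneg ht.1 (norm_nonneg z)
    linarith
  have hB : ∀ t ∈ Set.Icc (0 : ℝ) s, HasDerivAt
      (fun t : ℝ => K / γ * ((η + t * ‖z‖) ^ γ - η ^ γ))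
      (K * (η + t * ‖z‖) ^ (γ - 1) * ‖z‖) t := by
    intro t ht
    have h1 : HasDerivAt (fun t : ℝ => η + t * ‖z‖) (1 * ‖z‖) t :=
      ((hasDerivAt_id t).mul_const ‖z‖).const_add η
    have h2 := ((h1.rpow_const (p := γ) (Or.inl (hpos t ht).ne')).sub_const (η ^ γ)).const_mul
      (K / γ)
    refine h2.congr_deriv ?_
    field_simp
  have h := image_norm_le_of_norm_deriv_right_le_deriv_boundary'
    (f := fun t : ℝ => H ((1 - t) • z) - H z)
    (f' := fun t => fderiv ℝ H ((1 - t) • z) ((-1 : ℝ) • z))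
    (B := fun t : ℝ => K / γ * ((η + t * ‖z‖) ^ γ - η ^ γ))
    (B' := fun t => K * (η + t * ‖z‖) ^ (γ - 1) * ‖z‖) (a := 0) (b := s)
    (fun t ht => (hder t ht).continuousAt.continuousWithinAt)
    (fun t ht => (hder t ⟨ht.1, ht.2.le⟩).hasDerivWithinAt) (by simp)
    (fun t ht => (hB t ht).continuousAt.continuousWithinAt)
    (fun t ht => (hB t ⟨ht.1, ht.2.le⟩).hasDerivWithinAt)
    (fun t ht => by
      have ht' : t ∈ Set.Icc (0 : ℝ) s := ⟨ht.1, ht.2.le⟩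
      refine (ContinuousLinearMap.le_opNorm _ _).trans ?_
      rw [neg_one_smul, norm_neg]
      refine mul_le_mul_of_nonneg_right ((hb _ (hmem t ht')).trans (le_of_eq ?_)) (norm_nonneg z)
      rw [norm_smul, Real.norm_of_nonneg (by linarith [ht'.2])]
      congr 2
      rw [hη]
      ring) (x := s) ⟨hs0, le_rfl⟩
  refine h.trans ?_
  gcongr
  have h1 : (η + s * ‖z‖) ^ γ ≤ η ^ γ + (s * ‖z‖) ^ γ :=
    Real.rpow_add_le_add_rpow hη0.le (by positivity) hγ0.le hγ1
  have h2 : (s * ‖z‖) ^ γ ≤ s ^ γ :=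
    Real.rpow_le_rpow (by positivity) (mul_le_of_le_one_right hs0 hz1.le) hγ0.le
  linarith

/-- The Hardy–Littlewood lemma: a gradient bound `O((1 - |z|)^(γ - 1))` in the unit ball gives
Hölder continuity with exponent `γ`. -/
theorem norm_sub_le_of_norm_fderiv_le (hγ0 : 0 < γ) (hγ1 : γ ≤ 1) (hK : 0 ≤ K)
    (hH : ∀ z ∈ Metric.ball (0 : V) 1, DifferentiableAt ℝ H z)
    (hb : ∀ z ∈ Metric.ball (0 : V) 1, ‖fderiv ℝ H z‖ ≤ K * (1 - ‖z‖) ^ (γ - 1))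
    {z w : V} (hz : z ∈ Metric.ball (0 : V) 1) (hw : w ∈ Metric.ball (0 : V) 1) :
    ‖H z - H w‖ ≤ (2 * (K / γ) + K) * ‖z - w‖ ^ γ := by
  rcases eq_or_ne z w with rfl | hne
  · simp only [sub_self, norm_zero]
    positivity
  set r := ‖z - w‖ with hr
  have hr0 : 0 < r := norm_pos_iff.mpr (sub_ne_zero.mpr hne)
  -- Both points are pulled towards the origin by |z − w|, into the ball of radius 1 − s, where the
  -- gradient is at most K s^(γ − 1). If the distance is at least 1 both go to the origin and the
  -- middle term vanishes.
  set s := min r 1 with hs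
  have hs0 : 0 < s := lt_min hr0 one_pos
  have hs1 : s ≤ 1 := min_le_right _ _
  have hsr : s ^ γ ≤ r ^ γ := Real.rpow_le_rpow hs0.le (min_le_left _ _) hγ0.le
  have h1 := norm_sub_radial_le hγ0 hγ1 hK hH hb hz hs0.le hs1
  have h2 := norm_sub_radial_le hγ0 hγ1 hK hH hb hw hs0.le hs1
  have hmid : ‖H ((1 - s) • z) - H ((1 - s) • w)‖ ≤ K * r ^ γ := by
    rcases eq_or_lt_of_le hs1 with hs1' | hs1'
    · rw [hs1', sub_self, zero_smul, zero_smul, sub_self, norm_zero]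
      positivity
    · have hsr' : s = r := by
        rcases min_choice r 1 with h | h
        · exact h
        · exact absurd (hs.trans h) hs1'.ne
      have hsub : Metric.closedBall (0 : V) (1 - s) ⊆ Metric.ball 0 1 :=
        Metric.closedBall_subset_ball (by linarith)
      have hin : ∀ y ∈ Metric.ball (0 : V) 1, (1 - s) • y ∈ Metric.closedBall (0 : V) (1 - s) := by
        intro y hy
        rw [mem_closedBall_zero_iff, norm_smul, Real.norm_of_nonneg (by linarith)]
        have : ‖y‖ < 1 := by simpa using hy
        exact mul_le_of_le_one_right (by linarith) this.le
      have h3 := (convex_closedBall (0 : V) (1 - s)).norm_image_sub_le_of_norm_fderiv_le (𝕜 := ℝ)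
        (f := H) (C := K * s ^ (γ - 1)) (fun y hy => hH y (hsub hy)) (fun y hy => by
          refine (hb y (hsub hy)).trans ?_
          gcongr 1
          have : ‖y‖ ≤ 1 - s := by simpa using hy
          exact Real.rpow_le_rpow_of_nonpos hs0 (by linarith) (by linarith))
        (hin w hw) (hin z hz)
      refine h3.trans ?_
      have h4 : ‖(1 - s) • z - (1 - s) • w‖ ≤ r := by
        rw [← smul_sub, norm_smul, Real.norm_of_nonneg (by linarith), ← hr]
        exact mul_le_of_le_one_left hr0.le (by linarith)
      calc K * s ^ (γ - 1) * ‖(1 - s) • z - (1 - s) • w‖ ≤ K * s ^ (γ - 1) * r := by gcongr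
        _ = K * r ^ γ := by
          rw [hsr', mul_assoc]
          congr 1
          nth_rewrite 2 [← Real.rpow_one r]
          rw [← Real.rpow_add hr0]
          ring_nf
  have h5 : H z - H w = -(H ((1 - s) • z) - H z) + (H ((1 - s) • z) - H ((1 - s) • w)) +
      (H ((1 - s) • w) - H w) := by abel
  rw [h5]
  refine (norm_add₃_le).trans ?_
  rw [norm_neg]
  have h6 : K / γ * s ^ γ ≤ K / γ * r ^ γ := by gcongr
  linarith

end HardyLittlewood

/-! ### Norms of multilinear maps from values on a basis. -/

section MultilinearBounds

variable {V W κ : Type*} [NormedAddCommGroup V] [NormedSpace ℝ V] [FiniteDimensional ℝ V]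
  [NormedAddCommGroup W] [NormedSpace ℝ W] [Fintype κ]

/-- A multilinear map is controlled by its values on a basis. -/
theorem exists_norm_multilinear_le (b : Module.Basis κ ℝ V) (k : ℕ) :
    ∃ C : ℝ, 0 ≤ C ∧ ∀ (L : ContinuousMultilinearMap ℝ (fun _ : Fin k => V) W) (B : ℝ), 0 ≤ B →
      (∀ r : Fin k → κ, ‖L fun i => b (r i)‖ ≤ B) → ‖L‖ ≤ C * B := by
  classical
  have hc : ∀ j, ∃ c : ℝ, 0 ≤ c ∧ ∀ y, ‖b.repr y j‖ ≤ c * ‖y‖ := fun j =>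
    ⟨_, norm_nonneg _, (LinearMap.toContinuousLinearMap (b.coord j)).le_opNorm⟩
  choose c hc0 hc using hc
  refine ⟨∑ r : Fin k → κ, ∏ i, c (r i),
    Finset.sum_nonneg fun r _ => Finset.prod_nonneg fun i _ => hc0 _, fun L B hB h => ?_⟩
  have hnn : 0 ≤ ∑ r : Fin k → κ, ∏ i, c (r i) :=
    Finset.sum_nonneg fun r _ => Finset.prod_nonneg fun i _ => hc0 _
  refine ContinuousMultilinearMap.opNorm_le_bound (mul_nonneg hnn hB) fun y => ?_
  have h1 : L y = ∑ r : Fin k → κ, (∏ i, b.repr (y i) (r i)) • L fun i => b (r i) := by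
    have h2 : y = fun i => ∑ j, b.repr (y i) j • b j := funext fun i => (b.sum_repr (y i)).symm
    conv_lhs => rw [h2]
    rw [L.map_sum]
    exact Finset.sum_congr rfl fun r _ => L.map_smul_univ _ _
  rw [h1, Finset.sum_mul, Finset.sum_mul]
  refine norm_sum_le_of_le _ fun r _ => ?_
  rw [norm_smul, norm_prod, mul_right_comm, ← Finset.prod_mul_distrib]
  refine mul_le_mul ?_ (h r) (norm_nonneg _)
    (Finset.prod_nonneg fun i _ => mul_nonneg (hc0 _) (norm_nonneg _))
  exact Finset.prod_le_prod (fun i _ => norm_nonneg _) fun i _ => hc _ _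

end MultilinearBounds

/-! ### Iterated derivatives as operators with constant fields. -/

section ConstantFields

variable {m : ℕ} {V : Set (Cn m)} {F : Cn m → ℂ}

theorem iteratedFDeriv_eq_applyOp (hV : IsOpen V) (hF : ContDiffOn ℝ ∞ F V) (k : ℕ)
    (y : Fin k → Cn m) {z : Cn m} (hz : z ∈ V) :
    iteratedFDeriv ℝ k F z y = applyOp (List.ofFn fun i _ => y i) F z := by
  induction k generalizing z with
  | zero => simp [applyOp]
  | succ k ih =>
    rw [iteratedFDeriv_succ_apply_left, List.ofFn_succ, applyOp_cons, applyField]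
    have hd : DifferentiableAt ℝ (iteratedFDeriv ℝ k F) z :=
      (hF.contDiffAt (hV.mem_nhds hz)).differentiableAt_iteratedFDeriv (by
        exact_mod_cast WithTop.coe_lt_top k)
    have h1 : (applyOp (List.ofFn fun (i : Fin k) _ => y i.succ) F) =ᶠ[𝓝 z]
        fun w => iteratedFDeriv ℝ k F w (Fin.tail y) :=
      Filter.eventuallyEq_of_mem (hV.mem_nhds hz) fun w hw => (ih (Fin.tail y) hw).symm
    rw [h1.fderiv_eq]
    have h2 := ((ContinuousMultilinearMap.apply ℝ (fun _ : Fin k => Cn m) ℂ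
      (Fin.tail y)).hasFDerivAt.comp z hd.hasFDerivAt).fderiv
    have h3 : (fun w => iteratedFDeriv ℝ k F w (Fin.tail y)) =
        (ContinuousMultilinearMap.apply ℝ (fun _ : Fin k => Cn m) ℂ (Fin.tail y)) ∘
          iteratedFDeriv ℝ k F := rfl
    rw [h3, h2]
    rfl

/-- Tangency fails at the point y/|y|. Thus derivatives along basis vectors have weight equal to
their order. -/
theorem fieldWeight_const {y : Cn m} (hy : y ≠ 0) : fieldWeight (fun _ => y) = 1 := by
  rw [fieldWeight, if_neg]
  intro h
  have hn : ‖y‖ ≠ 0 := norm_ne_zero_iff.mpr hy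
  have h1 := h ((‖y‖⁻¹ : ℂ) • y) (by
    rw [mem_closedBall_zero_iff, norm_smul]
    simp [hn])
  rw [inner_smul_left] at h1
  simp [hy] at h1

theorem opWeight_const (k : ℕ) {y : Fin k → Cn m} (hy : ∀ i, y i ≠ 0) :
    opWeight (List.ofFn fun i _ => y i) = k := by
  induction k with
  | zero => simp [opWeight]
  | succ k ih =>
    have := ih (y := fun i => y i.succ) fun i => hy _
    rw [List.ofFn_succ, opWeight, List.map_cons, List.sum_cons, fieldWeight_const (hy 0)]
    rw [opWeight] at this
    rw [this]
    push_cast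
    ring

theorem smoothOp_const (k : ℕ) (y : Fin k → Cn m) : SmoothOp (List.ofFn fun i _ => y i) := by
  intro a ha
  obtain ⟨i, rfl⟩ := (List.mem_ofFn' _ _).mp ha
  exact contDiff_const

end ConstantFields

/-! ### The estimates of the theorem. -/

section Main

variable {m : ℕ} {E : Set (Cn m)} {α υ q : ℝ} {μ : Measure (Cn m)}
  {v : Cn m → Fin (m + 1) → Cn m}

theorem exists_applyOp_taylor_le (hES : E ⊆ Metric.sphere 0 1) (hv : IsFrame E v) (α : ℝ)
    {X : List (Cn m → Cn m)} (hX : SmoothOp X) :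
    ∃ C : ℝ, 0 ≤ C ∧ ∀ f, MemLip E v α f → ∀ z : Cn m, ‖z‖ ≤ 1 → ∀ ξ ∈ E,
      ‖applyOp X (taylor v α f ξ) z‖ ≤ C * lipNorm E v α f := by
  let I := {p : Jet m × Cn m × Cn m // MemLip E v α p.1 ∧ ‖p.2.1‖ ≤ 1 ∧ p.2.2 ∈ E}
  obtain ⟨C, hC, h⟩ := IsSymbol.applyOp_bound (fun N => isSymbol_taylor_one hES hv
    (fun i : I => i.2.1) (fun i : I => i.2.2.1) (fun i : I => i.2.2.2) N) (fun _ => one_pos) hX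
  refine ⟨C, hC, fun f hf z hz ξ hξ => ?_⟩
  simpa using h ⟨(f, z, ξ), hf, hz, hξ⟩

theorem LowerBoundAt.pdistSet_le_two (hES : E ⊆ Metric.sphere 0 1) {c : ℝ} {z ξ : Cn m}
    (hz : z ∈ Metric.closedBall (0 : Cn m) 1 \ E) (h : LowerBoundAt E μ q c z ξ) :
    pdistSet z E ≤ 2 :=
  h.nearest ▸ pdist_le_two (norm_le_one hz) (norm_eq_one hES h.mem).le

theorem exists_applyOp_extOperator_sub_extDeriv_le (hE : IsCompact E)
    (hES : E ⊆ Metric.sphere 0 1) (hα : 0 ≤ α) (hμ : MemU E υ μ) (hqα : α + υ < q)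
    (hv : IsFrame E v) (hlow : LowerBound E μ q) {X : List (Cn m → Cn m)} (hX : SmoothOp X) :
    ∃ C : ℝ, ∀ f, MemLip E v α f → ∀ z ∈ Metric.closedBall (0 : Cn m) 1 \ E,
      ‖applyOp X (extOperator μ q v α f) z - extDeriv μ q v α X f z‖ ≤
        C * lipNorm E v α f * pdistSet z E ^ (α - opWeight X) := by
  obtain ⟨c, hc, hlo⟩ := hlow.exists_lowerBoundAt
  obtain ⟨C₁, -, h1⟩ := exists_applyOp_extOperator_sub_le hE hES hα hμ hqα hv hlow hc hX
  obtain ⟨C₂, -, h2⟩ := exists_extDeriv_sub_le hE hES hα hμ hqα hv hlow hc hX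
  refine ⟨C₁ + C₂, fun f hf z hz => ?_⟩
  obtain ⟨ξ, hξ⟩ := hlo z hz
  refine (norm_sub_le_norm_sub_add_norm_sub _ (applyOp X (taylor v α f ξ) z) _).trans ?_
  rw [norm_sub_rev (applyOp X (taylor v α f ξ) z)]
  refine (add_le_add (h1 f hf z hz ξ hξ) (h2 f hf z hz ξ hξ)).trans (le_of_eq ?_)
  ring

/-- The term 𝕏 T_ξ f is O(‖f‖), and α − ω(𝕏) < 0 with d(z, E) ≤ 2 lets it be absorbed. -/
theorem exists_applyOp_extOperator_le (hE : IsCompact E) (hES : E ⊆ Metric.sphere 0 1)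
    (hα : 0 ≤ α) (hμ : MemU E υ μ) (hqα : α + υ < q) (hv : IsFrame E v)
    (hlow : LowerBound E μ q) {X : List (Cn m → Cn m)} (hX : SmoothOp X)
    (hω : α < opWeight X) :
    ∃ C : ℝ, 0 ≤ C ∧ ∀ f, MemLip E v α f → ∀ z ∈ Metric.closedBall (0 : Cn m) 1 \ E,
      ‖applyOp X (extOperator μ q v α f) z‖ ≤
        C * lipNorm E v α f * pdistSet z E ^ (α - opWeight X) := by
  obtain ⟨c, hc, hlo⟩ := hlow.exists_lowerBoundAt
  obtain ⟨C₁, hC₁, h1⟩ := exists_applyOp_extOperator_sub_le hE hES hα hμ hqα hv hlow hc hX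
  obtain ⟨C₂, hC₂, h2⟩ := exists_applyOp_taylor_le hES hv α hX
  refine ⟨C₁ + C₂ * 2 ^ (opWeight X - α), by positivity, fun f hf z hz => ?_⟩
  obtain ⟨ξ, hξ⟩ := hlo z hz
  have hL := lipNorm_nonneg (E := E) (v := v) (α := α) f
  have h3 := one_le_rpow_neg (hξ.pdistSet_pos hES hz) (hξ.pdistSet_le_two hES hz)
    (s := opWeight X - α) (by linarith)
  rw [neg_sub] at h3
  have h4 := norm_le_norm_sub_add (applyOp X (extOperator μ q v α f) z)
    (applyOp X (taylor v α f ξ) z)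
  have h5 := h2 f hf z (norm_le_one hz) ξ hξ.mem
  have h6 := le_mul_of_one_le_right (mul_nonneg hC₂ hL) h3
  have h7 := h1 f hf z hz ξ hξ
  calc _ ≤ C₁ * (lipNorm E v α f * pdistSet z E ^ (α - opWeight X)) + C₂ * lipNorm E v α f *
        (2 ^ (opWeight X - α) * pdistSet z E ^ (α - opWeight X)) := by linarith
    _ = _ := by ring

/-- Here the exponent α − ω(𝕏) is positive, so the comparison error is itself bounded; this handles
the derivatives of order at most ⌊α⌋. -/
theorem exists_applyOp_extOperator_le_of_lt (hE : IsCompact E) (hES : E ⊆ Metric.sphere 0 1)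
    (hα : 0 ≤ α) (hμ : MemU E υ μ) (hqα : α + υ < q) (hv : IsFrame E v)
    (hlow : LowerBound E μ q) {X : List (Cn m → Cn m)} (hX : SmoothOp X)
    (hω : opWeight X < α) :
    ∃ C : ℝ, 0 ≤ C ∧ ∀ f, MemLip E v α f → ∀ z ∈ Metric.closedBall (0 : Cn m) 1 \ E,
      ‖applyOp X (extOperator μ q v α f) z‖ ≤ C * lipNorm E v α f := by
  obtain ⟨c, hc, hlo⟩ := hlow.exists_lowerBoundAt
  obtain ⟨C₁, hC₁, h1⟩ := exists_applyOp_extOperator_sub_le hE hES hα hμ hqα hv hlow hc hX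
  obtain ⟨C₂, hC₂, h2⟩ := exists_applyOp_taylor_le hES hv α hX
  refine ⟨C₁ * 2 ^ (α - opWeight X) + C₂, by positivity, fun f hf z hz => ?_⟩
  obtain ⟨ξ, hξ⟩ := hlo z hz
  have hL := lipNorm_nonneg (E := E) (v := v) (α := α) f
  have h3 : pdistSet z E ^ (α - opWeight X) ≤ 2 ^ (α - opWeight X) :=
    Real.rpow_le_rpow (hξ.pdistSet_pos hES hz).le (hξ.pdistSet_le_two hES hz) (by linarith)
  have h4 := norm_le_norm_sub_add (applyOp X (extOperator μ q v α f) z)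
    (applyOp X (taylor v α f ξ) z)
  have h5 := h2 f hf z (norm_le_one hz) ξ hξ.mem
  have h6 := mul_le_mul_of_nonneg_left (mul_le_mul_of_nonneg_left h3 hL) hC₁
  have h7 := h1 f hf z hz ξ hξ
  calc _ ≤ C₁ * (lipNorm E v α f * 2 ^ (α - opWeight X)) + C₂ * lipNorm E v α f := by linarith
    _ = _ := by ring

theorem ball_subset_closedBall_diff (hES : E ⊆ Metric.sphere 0 1) :
    Metric.ball (0 : Cn m) 1 ⊆ Metric.closedBall (0 : Cn m) 1 \ E := by
  intro z hz
  refine ⟨Metric.ball_subset_closedBall hz, fun h => ?_⟩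
  have h1 := norm_eq_one hES h
  rw [mem_ball_zero_iff] at hz
  linarith

theorem memHolLip_extOperator (hE : IsCompact E) (hES : E ⊆ Metric.sphere 0 1)
    (hα : 0 < α) (h2α : ∀ k : ℕ, 2 * α ≠ k) (hμ : MemU E υ μ) (hqα : α + υ < q)
    (hv : IsFrame E v) (hlow : LowerBound E μ q) {f : Jet m} (hf : MemLip E v α f) :
    MemHolLip α (extOperator μ q v α f) := by
  have := hμ.prob
  have hV : IsOpen (extDomain E μ q) := isOpen_extDomain hE hES hμ.ae_mem q
  have hΩ := ball_subset_closedBall_diff hES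
  have hVsub := hΩ.trans (subset_extDomain hES hμ hlow)
  have hsm := contDiffOn_extOperator hE hES hμ.ae_mem hf q
  have hsmR := hsm.restrict_scalars ℝ
  set F := extOperator μ q v α f with hF
  have hL := lipNorm_nonneg (E := E) (v := v) (α := α) f
  obtain ⟨c, hc, hlo⟩ := hlow.exists_lowerBoundAt
  let b := Module.finBasis ℝ (Cn m)
  -- Non-integrality of α puts the order ⌊α⌋ strictly below α and leaves a positive Hölder exponent.
  have hfloor : (⌊α⌋₊ : ℝ) < α := by
    refine lt_of_le_of_ne (Nat.floor_le hα.le) fun h => h2α (2 * ⌊α⌋₊) ?_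
    push_cast
    rw [h]
  have hlow_order : ∀ k : ℕ, k ≤ ⌊α⌋₊ → ∃ C : ℝ, 0 ≤ C ∧
      ∀ z ∈ Metric.ball (0 : Cn m) 1, ‖iteratedFDeriv ℝ k F z‖ ≤ C := by
    intro k hk
    obtain ⟨C₀, hC₀, h0⟩ := exists_norm_multilinear_le (W := ℂ) b k
    have hkα : (k : ℝ) < α := lt_of_le_of_lt (by exact_mod_cast hk) hfloor
    have h1 : ∀ r : Fin k → _, ∃ C : ℝ, 0 ≤ C ∧ ∀ f, MemLip E v α f →
        ∀ z ∈ Metric.closedBall (0 : Cn m) 1 \ E,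
        ‖applyOp (List.ofFn fun i _ => b (r i)) (extOperator μ q v α f) z‖ ≤
          C * lipNorm E v α f := fun r =>
      exists_applyOp_extOperator_le_of_lt hE hES hα.le hμ hqα hv hlow (smoothOp_const k _)
        (by rwa [opWeight_const k fun i => b.ne_zero _])
    choose C₁ hC₁ h1 using h1
    have hS : 0 ≤ ∑ r, C₁ r := Finset.sum_nonneg fun r _ => hC₁ r
    refine ⟨C₀ * ((∑ r, C₁ r) * lipNorm E v α f), by positivity, fun z hz => ?_⟩
    refine h0 _ _ (by positivity) fun r => ?_
    rw [iteratedFDeriv_eq_applyOp hV hsmR k _ (hVsub hz)]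
    refine (h1 r f hf z (hΩ hz)).trans ?_
    gcongr
    exact Finset.single_le_sum (fun r _ => hC₁ r) (Finset.mem_univ r)
  have htop : ∃ K : ℝ, 0 ≤ K ∧ ∀ z ∈ Metric.ball (0 : Cn m) 1,
      ‖fderiv ℝ (iteratedFDeriv ℝ ⌊α⌋₊ F) z‖ ≤ K * (1 - ‖z‖) ^ (α - ⌊α⌋₊ - 1) := by
    obtain ⟨C₀, hC₀, h0⟩ := exists_norm_multilinear_le (W := ℂ) b (⌊α⌋₊ + 1)
    have hαk : α < ((⌊α⌋₊ + 1 : ℕ) : ℝ) := by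
      push_cast
      exact Nat.lt_floor_add_one α
    have h1 : ∀ r : Fin (⌊α⌋₊ + 1) → _, ∃ C : ℝ, 0 ≤ C ∧ ∀ f, MemLip E v α f →
        ∀ z ∈ Metric.closedBall (0 : Cn m) 1 \ E,
        ‖applyOp (List.ofFn fun i _ => b (r i)) (extOperator μ q v α f) z‖ ≤
          C * lipNorm E v α f *
            pdistSet z E ^ (α - opWeight (List.ofFn fun i _ => b (r i))) := fun r =>
      exists_applyOp_extOperator_le hE hES hα.le hμ hqα hv hlow (smoothOp_const _ _)
        (by rwa [opWeight_const _ fun i => b.ne_zero _])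
    choose C₁ hC₁ h1 using h1
    have hS : 0 ≤ ∑ r, C₁ r := Finset.sum_nonneg fun r _ => hC₁ r
    refine ⟨C₀ * ((∑ r, C₁ r) * lipNorm E v α f), by positivity, fun z hz => ?_⟩
    have hz1 : 0 < 1 - ‖z‖ := by
      rw [mem_ball_zero_iff] at hz
      linarith
    rw [norm_fderiv_iteratedFDeriv, mul_assoc]
    refine h0 _ _ (mul_nonneg (by positivity) (Real.rpow_nonneg hz1.le _)) fun r => ?_
    rw [iteratedFDeriv_eq_applyOp hV hsmR _ _ (hVsub hz)]
    refine (h1 r f hf z (hΩ hz)).trans ?_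
    rw [opWeight_const _ fun i => b.ne_zero _]
    obtain ⟨ξ, hξ⟩ := hlo z (hΩ hz)
    -- The exponent α − ⌊α⌋ − 1 is negative, so this turns the bound in d(z, E) into the growth in 1
    -- − |z| needed by Hardy–Littlewood.
    have h2 : 1 - ‖z‖ ≤ pdistSet z E :=
      hξ.nearest ▸ one_sub_norm_le_pdist z (norm_eq_one hES hξ.mem)
    have h3 : pdistSet z E ^ (α - ((⌊α⌋₊ + 1 : ℕ) : ℝ)) ≤ (1 - ‖z‖) ^ (α - ⌊α⌋₊ - 1) := by
      have h4 : α - ((⌊α⌋₊ + 1 : ℕ) : ℝ) = α - ⌊α⌋₊ - 1 := by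
        push_cast
        ring
      rw [← h4]
      exact Real.rpow_le_rpow_of_nonpos hz1 h2 (by linarith)
    have h5 := Finset.single_le_sum (fun r _ => hC₁ r) (Finset.mem_univ r)
    exact mul_le_mul (mul_le_mul_of_nonneg_right h5 hL) h3
      (Real.rpow_nonneg (hz1.le.trans h2) _) (by positivity)
  obtain ⟨K, hK, hK'⟩ := htop
  have hdiff : ∀ z ∈ Metric.ball (0 : Cn m) 1,
      DifferentiableAt ℝ (iteratedFDeriv ℝ ⌊α⌋₊ F) z := fun z hz =>
    (hsmR.contDiffAt (hV.mem_nhds (hVsub hz))).differentiableAt_iteratedFDeriv (by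
      exact_mod_cast WithTop.coe_lt_top _)
  have hγ0 : 0 < α - ⌊α⌋₊ := by linarith
  have hγ1 : α - ⌊α⌋₊ ≤ 1 := by linarith [Nat.lt_floor_add_one α]
  choose! C hC0 hC using hlow_order
  have hS : 0 ≤ ∑ k ∈ Finset.range (⌊α⌋₊ + 1), C k := Finset.sum_nonneg fun k hk =>
    hC0 k (Nat.lt_succ_iff.mp (Finset.mem_range.mp hk))
  have hK2 : 0 ≤ 2 * (K / (α - ⌊α⌋₊)) + K := by positivity
  refine ⟨(hsm.differentiableOn (by simp)).mono hVsub,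
    ∑ k ∈ Finset.range (⌊α⌋₊ + 1), C k + (2 * (K / (α - ⌊α⌋₊)) + K), fun k hk z hz => ?_,
    fun z hz w hw => ?_⟩
  · have h1 : C k ≤ ∑ k ∈ Finset.range (⌊α⌋₊ + 1), C k :=
      Finset.single_le_sum (fun k hk => hC0 k (Nat.lt_succ_iff.mp (Finset.mem_range.mp hk)))
        (Finset.mem_range.mpr (Nat.lt_succ_of_le hk))
    linarith [hC k hk z hz]
  · refine (norm_sub_le_of_norm_fderiv_le hγ0 hγ1 hK hdiff hK' hz hw).trans ?_
    exact mul_le_mul_of_nonneg_right (le_add_of_nonneg_left hS)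
      (Real.rpow_nonneg (norm_nonneg _) _)

/-- The nearest point `ξ` varies with `z`, but both 𝓔(f) and T_{ζ₀} f are close to T_ξ f after
applying 𝕏. Since d(z, E) ≤ d(z, ζ₀), both errors are O(d(z, ζ₀)^(α − ω(𝕏))), which tends to 0;
continuity of 𝕏 T_{ζ₀} f finishes. -/
theorem tendsto_applyOp_extOperator (hE : IsCompact E) (hES : E ⊆ Metric.sphere 0 1)
    (hα : 0 ≤ α) (hμ : MemU E υ μ) (hqα : α + υ < q) (hv : IsFrame E v)
    (hlow : LowerBound E μ q) {f : Jet m} (hf : MemLip E v α f) {X : List (Cn m → Cn m)}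
    (hX : SmoothOp X) (hω : opWeight X < α) {ζ₀ : Cn m} (hζ₀ : ζ₀ ∈ E) :
    Tendsto (applyOp X (extOperator μ q v α f)) (𝓝[Metric.closedBall (0 : Cn m) 1 \ E] ζ₀)
      (𝓝 (applyOp X (taylor v α f ζ₀) ζ₀)) := by
  obtain ⟨c, hc, hlo⟩ := hlow.exists_lowerBoundAt
  obtain ⟨C₁, hC₁, h1⟩ := exists_applyOp_extOperator_sub_le hE hES hα hμ hqα hv hlow hc hX
  obtain ⟨C₂, hC₂, h2⟩ := exists_applyOp_taylor_sub_le (α := α) hES hα hv hX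
  have hL := lipNorm_nonneg (E := E) (v := v) (α := α) f
  have hcont : Continuous (applyOp X (taylor v α f ζ₀)) := continuousOn_univ.mp
    (contDiffOn_applyOp isOpen_univ hX (contDiff_taylor_real f ζ₀).contDiffOn).continuousOn
  have hlim : Tendsto (fun z => (C₁ + C₂) * lipNorm E v α f * pdist z ζ₀ ^ (α - opWeight X))
      (𝓝[Metric.closedBall (0 : Cn m) 1 \ E] ζ₀) (𝓝 0) := by
    have h3 : Continuous fun z : Cn m => pdist z ζ₀ :=
      (continuous_tau.comp (Continuous.prodMk_left ζ₀)).norm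
    have h4 : Continuous fun z : Cn m =>
        (C₁ + C₂) * lipNorm E v α f * pdist z ζ₀ ^ (α - opWeight X) :=
      continuous_const.mul (h3.rpow_const fun _ => Or.inr (by linarith))
    have h5 : pdist ζ₀ ζ₀ = 0 := by simp [pdist, tau, norm_eq_one hES hζ₀]
    have h6 := h4.tendsto ζ₀
    rw [h5, Real.zero_rpow (by linarith), mul_zero] at h6
    exact h6.mono_left nhdsWithin_le_nhds
  have hsub : Tendsto (fun z => applyOp X (extOperator μ q v α f) z -
      applyOp X (taylor v α f ζ₀) z) (𝓝[Metric.closedBall (0 : Cn m) 1 \ E] ζ₀) (𝓝 0) := by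
    refine squeeze_zero_norm' ?_ hlim
    filter_upwards [self_mem_nhdsWithin] with z hz
    obtain ⟨ξ, hξ⟩ := hlo z hz
    refine (norm_sub_le_norm_sub_add_norm_sub _ (applyOp X (taylor v α f ξ) z) _).trans ?_
    rw [norm_sub_rev (applyOp X (taylor v α f ξ) z)]
    have h3 := h1 f hf z hz ξ hξ
    have h4 := h2 f hf z hz ξ hξ.mem hξ.nearest ζ₀ hζ₀
    have h5 : pdistSet z E ^ (α - opWeight X) ≤ pdist z ζ₀ ^ (α - opWeight X) :=
      Real.rpow_le_rpow (hξ.pdistSet_pos hES hz).le (pdistSet_le hζ₀) (by linarith)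
    have h6 := mul_le_mul_of_nonneg_left (mul_le_mul_of_nonneg_left h5 hL) hC₁
    calc _ ≤ C₁ * (lipNorm E v α f * pdist z ζ₀ ^ (α - opWeight X)) +
          C₂ * (lipNorm E v α f * pdist z ζ₀ ^ (α - opWeight X)) := by linarith
      _ = _ := by ring
  have h7 := hsub.add (hcont.continuousAt.mono_left (nhdsWithin_le_nhds
    (s := Metric.closedBall (0 : Cn m) 1 \ E) (a := ζ₀)))
  simpa using h7

end Main

end NonIso


theorem theorem7 (m : ℕ) (E : Set (NonIso.Cn m)) (hE : IsClosed E)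
    (hES : E ⊆ Metric.sphere 0 1) (α υ q : ℝ) (hα : 0 < α) (h2α : ∀ k : ℕ, 2 * α ≠ k)
    (μ : Measure (NonIso.Cn m)) (hμ : NonIso.MemU E υ μ) (hq : α + υ < q)
    (hlow : NonIso.LowerBound E μ q)
    (v : NonIso.Cn m → Fin (m + 1) → NonIso.Cn m) (hv : NonIso.IsFrame E v) :
    -- the extension is well defined, and holomorphic near each point of the closed ball off `E`
    (∀ f, NonIso.MemLip E v α f → ∀ z ∈ Metric.closedBall (0 : NonIso.Cn m) 1 \ E,
      Integrable (fun ζ => NonIso.taylor v α f ζ z * NonIso.kern q z ζ) μ ∧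
      ContDiffAt ℂ ∞ (NonIso.extOperator μ q v α f) z) ∧
    -- operators of weight less than `α`
    (∀ X : List (NonIso.Cn m → NonIso.Cn m), NonIso.SmoothOp X → NonIso.opWeight X < α →
      ∃ C : ℝ, ∀ f, NonIso.MemLip E v α f → ∀ z ∈ Metric.closedBall (0 : NonIso.Cn m) 1 \ E,
        Integrable (fun ζ => NonIso.applyOp X (NonIso.taylor v α f ζ) z * NonIso.kern q z ζ) μ ∧
        ‖NonIso.applyOp X (NonIso.extOperator μ q v α f) z - NonIso.extDeriv μ q v α X f z‖ ≤
          C * NonIso.lipNorm E v α f * NonIso.pdistSet z E ^ (α - NonIso.opWeight X)) ∧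
    -- operators of weight greater than `α`
    (∀ X : List (NonIso.Cn m → NonIso.Cn m), NonIso.SmoothOp X → α < NonIso.opWeight X →
      ∃ C : ℝ, ∀ f, NonIso.MemLip E v α f → ∀ z ∈ Metric.closedBall (0 : NonIso.Cn m) 1 \ E,
        ‖NonIso.applyOp X (NonIso.extOperator μ q v α f) z‖ ≤
          C * NonIso.lipNorm E v α f * NonIso.pdistSet z E ^ (α - NonIso.opWeight X)) ∧
    -- the extension lies in `A_α(B)`
    (∀ f, NonIso.MemLip E v α f → NonIso.MemHolLip α (NonIso.extOperator μ q v α f)) ∧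
    -- the extension interpolates the jet on `E`
    (∀ f, NonIso.MemLip E v α f → ∀ X : List (NonIso.Cn m → NonIso.Cn m), NonIso.SmoothOp X →
      NonIso.opWeight X < α → ∀ ζ₀ ∈ E,
        Tendsto (NonIso.applyOp X (NonIso.extOperator μ q v α f))
          (𝓝[Metric.closedBall (0 : NonIso.Cn m) 1 \ E] ζ₀)
          (𝓝 (NonIso.applyOp X (NonIso.taylor v α f ζ₀) ζ₀))) := by
  have hEc : IsCompact E := (isCompact_sphere (0 : NonIso.Cn m) 1).of_isClosed_subset hE hES
  have hprob := hμ.prob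
  have hμE := hμ.ae_mem
  refine ⟨fun f hf z hz => ⟨(hf.isKernelFamily q).integrable hEc hμE (NonIso.subset_posSet hES hz),
    (NonIso.contDiffOn_extOperator hEc hES hμE hf q).contDiffAt
      ((NonIso.isOpen_extDomain hEc hES hμE q).mem_nhds
        (NonIso.subset_extDomain hES hμ hlow hz))⟩, fun X hX _ => ?_, fun X hX hω => ?_,
    fun f hf => NonIso.memHolLip_extOperator hEc hES hα h2α hμ hq hv hlow hf,
    fun f hf X hX hω ζ₀ hζ₀ =>
      NonIso.tendsto_applyOp_extOperator hEc hES hα.le hμ hq hv hlow hf hX hω hζ₀⟩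
  · obtain ⟨C, hC⟩ := NonIso.exists_applyOp_extOperator_sub_extDeriv_le hEc hES hα.le hμ hq hv
      hlow hX
    exact ⟨C, fun f hf z hz => ⟨hf.integrable_applyOp hEc hμE hX q (NonIso.subset_posSet hES hz),
      hC f hf z hz⟩⟩
  · obtain ⟨C, -, hC⟩ := NonIso.exists_applyOp_extOperator_le hEc hES hα.le hμ hq hv hlow hX hω
    exact ⟨C, hC⟩
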